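/- **Theorem 2.5.** Let $\|\cdot\|$ be any norm on $\mathbb R^d$ and $(M,\mathcal M)$ any measurable space. Let $f\colon[0,\infty)\times M\to[0,\infty)$ be an *ordering function*: $f$ is measurable and $v\mapsto f(v,q)$ is nondecreasing for every $q\in M$. *The graph.* For marked points $(v_i,q_i)\in\mathbb R^d\times M$, call $v_2$ *$f$-closer* to $v_1$ than to $v_3$ if $f(\|v_1-v_2\|,q_1)<f(\|v_3-v_2\|,q_3)$, or if these two values are equal and $\|v_1-v_2\|<\|v_3-v_2\|$. For a locally finite set $\mathbf x$ of marked points, a point $w\neq v$ of $\mathbf x$ is the $n$-th nearest neighbour of $v\in\mathbf x$ ($n\ge1$) if $v$ is $f$-closer to exactly $n-1$ points of $\mathbf x\setminus\{v\}$ than to $w$. The $f$-$k$NN graph $g_{k,f}(\mathbf x)$ has the points of $\mathbf x$ as vertices, and two points are joined if each is among the $k$ nearest neighbours of the other. A graph *percolates* if it has an infinite connected component. *The process.* Let $\mathbf X$ be a marked point process in $\mathbb R^d\times M$, with underlying point process $X$ of positions, such that - $\mathbf X$ is stationary: its law is invariant under all translations of the positions, the marks being carried along; - $X$ is nonequidistant: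 almost surely $\|X_i-X_j\|=\|X_k-X_l\|>0$ implies $\{i,j\}=\{k,l\}$, and $\|X_i\|=\|X_j\|$ implies $i=j$; - $X$ has finite intensity $\mathbb E[X([0,1]^d)]<\infty$; - $\mathbf X$ is deletion-tolerant: for every $(\mathbb R^d\times M)$-valued random variable $\mathbf z$ on the same probability space with $\mathbf z\in\mathbf X$ almost surely on $\{\mathbf X\ne\emptyset\}$, the law of $\mathbf X\setminus\{\mathbf z\}$ is absolutely continuous with respect to the law of $\mathbf X$. Then $g_{2,f}(\mathbf X)$ almost surely does not percolate. In particular, the bidirectional $2$-nearest-neighbour graph (trivial marks, $f(v)=v$) of a stationary nonequidistant Cox process of finite intensity almost surely does not percolate, nor does that of any homogeneous Poisson process. Let $k_{\mathbf B,2}$ be the least $k\ge1$ such that the bidirectional $k$-nearest-neighbour graph of a homogeneous Poisson process on $\mathbb R^2$, for the Euclidean norm, percolates with positive probability. Then $k_{\mathbf B,2}\ge3$. -/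

import Mathlib

open MeasureTheory ProbabilityTheory
open scoped NNReal ENNReal

namespace NNPerc

/-- A locally finite set of marked points `(x, q)`, with position `x` in `ℝ ^ d` and mark `q` in
`M`: only finitely many of its points have their position in a given bounded set. -/
structure MarkedConfig (d : ℕ) (M : Type*) where
  carrier : Set ((Fin d → ℝ) × M)
  locallyFinite : ∀ K : Set (Fin d → ℝ), Bornology.IsBounded K →
    {p ∈ carrier | p.1 ∈ K}.Finite

namespace MarkedConfig

variable {d : ℕ} {M : Type*}

/-- The number of points of the configuration in a set `B` of marked points. -/
noncomputable def count (ξ : MarkedConfig d M) (B : Set ((Fin d → ℝ) × M)) : ℕ∞ :=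
  (ξ.carrier ∩ B).encard

/-- The number of points of the configuration with position in `B`. -/
noncomputable def posCount (ξ : MarkedConfig d M) (B : Set (Fin d → ℝ)) : ℕ∞ :=
  ξ.count {p | p.1 ∈ B}

/-- The evaluation σ-algebra: the smallest one for which the number of points in each measurable
set of marked points is measurable. -/
noncomputable instance instMeasurableSpace [MeasurableSpace M] : MeasurableSpace (MarkedConfig d M) :=
  ⨆ B : {B : Set ((Fin d → ℝ) × M) // MeasurableSet B},
    MeasurableSpace.comap (fun ξ : MarkedConfig d M => ξ.count B.1) ⊤

/-- Translation of all positions by `t`; the marks are kept. -/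
def translate (ξ : MarkedConfig d M) (t : Fin d → ℝ) : MarkedConfig d M where
  carrier := (fun p => (p.1 + t, p.2)) '' ξ.carrier
  locallyFinite := by
    intro K hK
    obtain ⟨R, hR⟩ := hK.exists_norm_le
    have hK' : Bornology.IsBounded {x : Fin d → ℝ | x + t ∈ K} := by
      refine isBounded_iff_forall_norm_le.2 ⟨R + ‖t‖, fun x hx => ?_⟩
      have h1 : ‖x + t - t‖ ≤ ‖x + t‖ + ‖t‖ := norm_sub_le _ _
      rw [add_sub_cancel_right] at h1
      have h2 := hR _ hx
      linarith
    refine ((ξ.locallyFinite _ hK').image (fun p => (p.1 + t, p.2))).subset ?_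
    rintro _ ⟨⟨p, hp, rfl⟩, hpK⟩
    exact ⟨p, ⟨hp, hpK⟩, rfl⟩

/-- The configuration with the marked point `z` removed. -/
def erase (ξ : MarkedConfig d M) (z : (Fin d → ℝ) × M) : MarkedConfig d M where
  carrier := ξ.carrier \ {z}
  locallyFinite := fun K hK =>
    (ξ.locallyFinite K hK).subset fun _ hp => ⟨hp.1.1, hp.2⟩

/-- Nonequidistant configurations with respect to a norm `ν` on `ℝ ^ d`: any two distinct
(unordered) pairs of points with distinct positions have different distances, and distinct points
have different distances to the origin. In particular distinct points have distinct positions. -/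
def Nonequidistant (ν : Seminorm ℝ (Fin d → ℝ)) (ξ : MarkedConfig d M) : Prop :=
  (∀ a ∈ ξ.carrier, ∀ b ∈ ξ.carrier, ∀ a' ∈ ξ.carrier, ∀ b' ∈ ξ.carrier,
      ν (a.1 - b.1) = ν (a'.1 - b'.1) → 0 < ν (a.1 - b.1) →
        ({a, b} : Set ((Fin d → ℝ) × M)) = {a', b'}) ∧
    ∀ a ∈ ξ.carrier, ∀ b ∈ ξ.carrier, ν a.1 = ν b.1 → a = b

end MarkedConfig

/-! ### Nearest-neighbour graphs -/

section Graph

variable {d : ℕ} {M : Type*}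

/-- Ordering functions `f : [0, ∞) × M → [0, ∞)`: jointly measurable, and nondecreasing in the
distance for each mark. -/
def IsOrderingFunction [MeasurableSpace M] (f : ℝ≥0 → M → ℝ≥0) : Prop :=
  Measurable (fun p : ℝ≥0 × M => f p.1 p.2) ∧ ∀ q : M, Monotone fun v => f v q

/-- `b` is `f`-closer to `a` than to `c`. -/
def FCloser (ν : Seminorm ℝ (Fin d → ℝ)) (f : ℝ≥0 → M → ℝ≥0) (b a c : (Fin d → ℝ) × M) :
    Prop :=
  f (ν (a.1 - b.1)).toNNReal a.2 < f (ν (c.1 - b.1)).toNNReal c.2 ∨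
    (f (ν (a.1 - b.1)).toNNReal a.2 = f (ν (c.1 - b.1)).toNNReal c.2 ∧
      ν (a.1 - b.1) < ν (c.1 - b.1))

/-- For `1 ≤ n`: the point `w` is the `n`-th nearest neighbour of `v` in `ξ` for the `f`-ordering,
that is, exactly `n - 1` points of `ξ` other than `v` come before `w`. -/
def IsNthNN (ν : Seminorm ℝ (Fin d → ℝ)) (f : ℝ≥0 → M → ℝ≥0) (ξ : MarkedConfig d M) (n : ℕ)
    (v w : (Fin d → ℝ) × M) : Prop :=
  w ∈ ξ.carrier ∧ w ≠ v ∧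
    {u ∈ ξ.carrier | u ≠ v ∧ FCloser ν f v u w}.encard + 1 = (n : ℕ∞)

/-- `w` is one of the `k` nearest neighbours of `v` in `ξ` for the `f`-ordering. -/
def IsAmongNN (ν : Seminorm ℝ (Fin d → ℝ)) (f : ℝ≥0 → M → ℝ≥0) (ξ : MarkedConfig d M) (k : ℕ)
    (v w : (Fin d → ℝ) × M) : Prop :=
  ∃ n : ℕ, 1 ≤ n ∧ n ≤ k ∧ IsNthNN ν f ξ n v w

/-- The `f`-`k`-nearest-neighbour graph of `ξ`: its vertices are the points of `ξ`, and two points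
are joined by an edge if each is among the `k` nearest neighbours of the other. -/
def fkNNGraph (ν : Seminorm ℝ (Fin d → ℝ)) (f : ℝ≥0 → M → ℝ≥0) (k : ℕ) (ξ : MarkedConfig d M) :
    SimpleGraph ξ.carrier where
  Adj v w := IsAmongNN ν f ξ k v.1 w.1 ∧ IsAmongNN ν f ξ k w.1 v.1
  symm := ⟨fun _ _ h => ⟨h.2, h.1⟩⟩
  loopless := ⟨fun _ h => by
    obtain ⟨⟨_, _, _, hn⟩, _⟩ := h
    exact hn.2.1 rfl⟩

/-- The bidirectional `k`-nearest-neighbour graph of a configuration with trivial marks. -/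
def bkNNGraph (ν : Seminorm ℝ (Fin d → ℝ)) (k : ℕ) (ξ : MarkedConfig d Unit) :
    SimpleGraph ξ.carrier :=
  fkNNGraph ν (fun v _ => v) k ξ

/-- A graph percolates if it has an infinite connected component. -/
def Percolates {V : Type*} (G : SimpleGraph V) : Prop :=
  ∃ C : G.ConnectedComponent, C.supp.Infinite

end Graph

/-! ### Marked point processes -/

section PointProc

variable {d : ℕ} {M : Type*} [MeasurableSpace M] {Ω : Type*} [MeasurableSpace Ω]

/-- The law of the marked point process is invariant under all translations of the positions. -/
def IsStationary (X : Ω → MarkedConfig d M) (μ : Measure Ω) : Prop :=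
  ∀ t : Fin d → ℝ, μ.map (fun ω => (X ω).translate t) = μ.map X

/-- The expected number of points with position in `[0, 1] ^ d` is finite. -/
def HasFiniteIntensity (X : Ω → MarkedConfig d M) (μ : Measure Ω) : Prop :=
  ∫⁻ ω, (((X ω).posCount (Set.Icc 0 1) : ℕ∞) : ℝ≥0∞) ∂μ < ∞

/-- `z` is an `X`-point: a random marked point that almost surely belongs to `X`, as long as there
is a point to choose. If `X` is almost surely nonempty, this is `z ∈ X` almost surely. -/
def IsPointOf (z : Ω → (Fin d → ℝ) × M) (X : Ω → MarkedConfig d M) (μ : Measure Ω) : Prop :=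
  Measurable z ∧ ∀ᵐ ω ∂μ, (X ω).carrier.Nonempty → z ω ∈ (X ω).carrier

/-- For each `X`-point `z`, the law of `X \ {z}` is absolutely continuous with respect to the law
of `X`. -/
def IsDeletionTolerant (X : Ω → MarkedConfig d M) (μ : Measure Ω) : Prop :=
  ∀ z : Ω → (Fin d → ℝ) × M, IsPointOf z X μ →
    μ.map (fun ω => (X ω).erase (z ω)) ≪ μ.map X

end PointProc

/-! ### Poisson and Cox point processes -/

section Poisson

variable {d : ℕ} {Ω : Type*} [MeasurableSpace Ω]

/-- The probability that a Poisson point process with intensity measure `Λ` has exactly `k i`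
points in `B i` for all `i`, where the sets `B i` are disjoint and of finite `Λ`-measure. -/
noncomputable def poissonFidi (Λ : Measure (Fin d → ℝ)) {n : ℕ} (B : Fin n → Set (Fin d → ℝ))
    (k : Fin n → ℕ) : ℝ≥0∞ :=
  ∏ i, poissonMeasure (Λ (B i)).toNNReal {k i}

/-- `Λ` is finite on bounded sets. -/
def IsFiniteOnBounded (Λ : Measure (Fin d → ℝ)) : Prop :=
  ∀ B : Set (Fin d → ℝ), Bornology.IsBounded B → Λ B < ∞

/-- A Cox point process: its law is that of a Poisson point process whose intensity measure is
itself random, with law `Q`. It is given through the numbers of points in disjoint bounded sets. -/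
def IsCoxProcess (X : Ω → MarkedConfig d Unit) (μ : Measure Ω) : Prop :=
  Measurable X ∧ ∃ Q : Measure (Measure (Fin d → ℝ)), IsProbabilityMeasure Q ∧
    (∀ᵐ Λ ∂Q, IsFiniteOnBounded Λ) ∧
    ∀ (n : ℕ) (B : Fin n → Set (Fin d → ℝ)) (k : Fin n → ℕ),
      (∀ i, MeasurableSet (B i)) → (∀ i, Bornology.IsBounded (B i)) →
      Pairwise (fun i j => Disjoint (B i) (B j)) →
        μ {ω | ∀ i, (X ω).posCount (B i) = (k i : ℕ∞)} = ∫⁻ Λ, poissonFidi Λ B k ∂Q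

/-- A homogeneous Poisson point process of intensity `c`. -/
def IsHomogeneousPoisson (X : Ω → MarkedConfig d Unit) (μ : Measure Ω) (c : ℝ≥0) : Prop :=
  Measurable X ∧
    ∀ (n : ℕ) (B : Fin n → Set (Fin d → ℝ)) (k : Fin n → ℕ),
      (∀ i, MeasurableSet (B i)) → (∀ i, Bornology.IsBounded (B i)) →
      Pairwise (fun i j => Disjoint (B i) (B j)) →
        μ {ω | ∀ i, (X ω).posCount (B i) = (k i : ℕ∞)} = poissonFidi (c • volume) B k

/-- The Euclidean norm on `ℝ ^ d`. -/
noncomputable def euclideanNorm (d : ℕ) : Seminorm ℝ (Fin d → ℝ) :=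
  (normSeminorm ℝ (EuclideanSpace ℝ (Fin d))).comp
    ((WithLp.linearEquiv 2 ℝ (Fin d → ℝ)).symm : (Fin d → ℝ) →ₗ[ℝ] EuclideanSpace ℝ (Fin d))

/-- The critical number of neighbours: the least `k ≥ 1` such that the bidirectional
`k`-nearest-neighbour graph of a homogeneous Poisson point process on `ℝ ^ d`, for the Euclidean
norm, percolates with positive probability (`⊤` if there is no such `k`). -/
noncomputable def criticalB (d : ℕ) : ℕ∞ :=
  sInf {K : ℕ∞ | ∃ k : ℕ, K = k ∧ 1 ≤ k ∧
    ∃ (P : Measure (MarkedConfig d Unit)) (c : ℝ≥0), IsProbabilityMeasure P ∧ 0 < c ∧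
      IsHomogeneousPoisson (fun ξ => ξ) P c ∧
      ¬ ∀ᵐ ξ ∂P, ¬ Percolates (bkNNGraph (euclideanNorm d) k ξ)}

end Poisson

end NNPerc

/-! Let G be the graph joining two points when each is among the first two in the ranking of the
other. Its degrees are at most two, so an infinite cluster is a path, infinite in one or in both
directions. Mass transport excludes the first kind: every point sends unit mass to each endpoint of
its cluster, hence at most two units, and by stationarity and finite intensity every point almost
surely receives finite mass; an endpoint of an infinite cluster would receive infinite mass
(`ae_endpointFree`). By deletion tolerance, infinite clusters almost surely have no endpoints even
after removal of any finite set of points.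

The rest is deterministic. Let v lie on an infinite cluster, with neighbours a and b, the first two
in its ranking. Removing a leaves an infinite half-path at v. It may not end there, so v gains a
neighbour w, the next point in its ranking; removing b instead yields the same w. If w were on an
infinite cluster, it would keep two neighbours and gain a third unless it is adjacent to a, and
likewise to b; but then v, a, w, b form a whole finite cluster. So w is off the infinite clusters
(`exists_third_neighbour`). Now remove w as well and repeat: every point of finite rank for v, apart
from a and b, is off the infinite clusters and becomes a neighbour of v once suitable points are
removed (`ranked_off_infSet`), and there are infinitely many such points (`infinite_ranks`). On the
other hand, if seven vertices ranked the same w, three of them would be pairwise nonadjacent;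
performing their removals simultaneously spares these three and makes all of them neighbours of w,
which is impossible (`encard_ranks_le_six`). A second mass transport, from w to the at most six
vertices that rank it, contradicts the infinite mass received by v (`ae_infSet_eq_empty`).

For a Cox process, deletion tolerance follows from the Mecke equation. If P A is the mixture of φ(Λ)
over the law Q of the intensity, the reduced Campbell measure of D × A is the mixture of Λ(D) φ(Λ).
This is proved for events A that depend on finitely many counts (`exists_mixing`) and carried over
to null events by approximation and truncation of Λ(D) (`IsMixedPoisson.campbell_eq_zero`). For a
homogeneous Poisson process the Campbell measure is a product with Lebesgue measure
(`campbell_eq_prod`), and nonequidistance holds because spheres have volume zero. -/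

namespace NNPerc

/-! ### Graphs with degrees at most two -/

section DegreeTwo

variable {V : Type*}

/-- Every vertex has at most two neighbours. -/
def MaxDegTwo (G : SimpleGraph V) : Prop :=
  ∀ v x y z, G.Adj v x → G.Adj v y → G.Adj v z → x = y ∨ y = z ∨ x = z

/-- `v` has at most one neighbour. -/
def IsEndpoint (G : SimpleGraph V) (v : V) : Prop :=
  ∀ x y, G.Adj v x → G.Adj v y → x = y

/-- The vertices that can be reached from `v`. -/
def cluster (G : SimpleGraph V) (v : V) : Set V := {w | G.Reachable v w}

theorem cluster_subset_of_closed {G : SimpleGraph V} {v : V} {C : Set V} (hv : v ∈ C)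
    (hC : ∀ x ∈ C, ∀ y, G.Adj x y → y ∈ C) : cluster G v ⊆ C := by
  intro w hw
  obtain ⟨p⟩ := hw
  induction p with
  | nil => exact hv
  | cons h p ih => exact ih (hC _ hv _ h)

theorem cluster_eq_of_mem {G : SimpleGraph V} {v w : V} (h : w ∈ cluster G v) :
    cluster G w = cluster G v := by
  ext x
  exact ⟨fun hx => SimpleGraph.Reachable.trans h hx,
    fun hx => SimpleGraph.Reachable.trans (SimpleGraph.Reachable.symm h) hx⟩

theorem exists_pred_of_dist_eq_succ {G : SimpleGraph V} {y u : V} {n : ℕ}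
    (hr : G.Reachable y u) (hd : G.dist y u = n + 1) :
    ∃ x, G.Reachable y x ∧ G.dist y x = n ∧ G.Adj x u := by
  obtain ⟨p, hp⟩ := hr.symm.exists_walk_length_eq_dist
  rw [SimpleGraph.dist_comm, hd] at hp
  cases p with
  | nil => simp at hp
  | @cons _ x _ h q =>
    simp only [SimpleGraph.Walk.length_cons, Nat.add_right_cancel_iff] at hp
    refine ⟨x, ⟨q.reverse⟩, ?_, h.symm⟩
    have h1 : G.dist y x ≤ n := by
      rw [← hp, ← SimpleGraph.Walk.length_reverse]
      exact SimpleGraph.dist_le _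
    obtain ⟨r, hr'⟩ := (show G.Reachable y x from ⟨q.reverse⟩).exists_walk_length_eq_dist
    have h2 := SimpleGraph.dist_le (r.concat h.symm)
    rw [SimpleGraph.Walk.length_concat, hr', hd] at h2
    omega

/-- In a graph with degrees at most two, the spheres around an endpoint have at most one vertex. -/
theorem sphere_subsingleton {G : SimpleGraph V} (hG : MaxDegTwo G) {y : V}
    (hy : IsEndpoint G y) (n : ℕ) : ∀ u u', G.Reachable y u → G.Reachable y u' →
      G.dist y u = n → G.dist y u' = n → u = u' := by
  induction n using Nat.strong_induction_on with
  | _ n ih =>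
    intro u u' hu hu' hd hd'
    match n with
    | 0 =>
      rw [hu.dist_eq_zero_iff] at hd
      rw [hu'.dist_eq_zero_iff] at hd'
      exact hd.symm.trans hd'
    | 1 =>
      obtain ⟨x, hx, hxd, hxu⟩ := exists_pred_of_dist_eq_succ hu hd
      obtain ⟨x', hx', hxd', hxu'⟩ := exists_pred_of_dist_eq_succ hu' hd'
      rw [hx.dist_eq_zero_iff] at hxd
      rw [hx'.dist_eq_zero_iff] at hxd'
      subst hxd hxd'
      exact hy _ _ hxu hxu'
    | n + 2 =>
      obtain ⟨x, hx, hxd, hxu⟩ := exists_pred_of_dist_eq_succ hu hd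
      obtain ⟨x', hx', hxd', hxu'⟩ := exists_pred_of_dist_eq_succ hu' hd'
      have hxx := ih (n + 1) (by omega) x x' hx hx' hxd hxd'
      subst hxx
      obtain ⟨z, hz, hzd, hzx⟩ := exists_pred_of_dist_eq_succ hx hxd
      rcases hG x u u' z hxu hxu' hzx.symm with h | h | h
      · exact h
      · subst h; omega
      · subst h; omega

/-- Beyond an endpoint z ≠ y there are no spheres around y: the predecessor of a vertex one step
farther would be z, the only vertex of its sphere, yet z already spends its one neighbour on the
sphere before. So both endpoints lie on the last sphere, which has one vertex. -/
theorem endpoint_unique {G : SimpleGraph V} (hG : MaxDegTwo G) {y z z' : V}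
    (hy : IsEndpoint G y) (hz : IsEndpoint G z) (hz' : IsEndpoint G z')
    (hyz : G.Reachable y z) (hyz' : G.Reachable y z') (hne : y ≠ z) (hne' : y ≠ z') : z = z' := by
  have key : ∀ z z', IsEndpoint G z → G.Reachable y z → G.Reachable y z' → y ≠ z →
      ¬ G.dist y z < G.dist y z' := by
    intro z z' hz hyz hyz' hne hlt
    have hdesc : ∀ k : ℕ, G.dist y z + 1 ≤ k → ∀ u, G.Reachable y u → G.dist y u = k → False := by
      intro k hk
      induction k, hk using Nat.le_induction with
      | base =>
        intro u hu hd
        obtain ⟨x, hx, hxd, hxu⟩ := exists_pred_of_dist_eq_succ hu hd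
        have hxz := sphere_subsingleton hG hy _ x z hx hyz hxd rfl
        subst hxz
        have hpos := hyz.pos_dist_of_ne hne
        obtain ⟨m, hm⟩ : ∃ m, G.dist y x = m + 1 := ⟨G.dist y x - 1, by omega⟩
        obtain ⟨w, hw, hwd, hwx⟩ := exists_pred_of_dist_eq_succ hyz hm
        have := hz _ _ hxu hwx.symm
        subst this
        omega
      | succ k hk ih =>
        intro u hu hd
        obtain ⟨x, hx, hxd, -⟩ := exists_pred_of_dist_eq_succ hu hd
        exact ih x hx hxd
    exact hdesc _ hlt z' hyz' rfl
  refine sphere_subsingleton hG hy (G.dist y z) z z' hyz hyz' rfl ?_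
  exact le_antisymm (not_lt.1 (key z z' hz hyz hyz' hne)) (not_lt.1 (key z' z hz' hyz' hyz hne'))

theorem encard_endpoints_le_two {G : SimpleGraph V} (hG : MaxDegTwo G) (x : V) :
    {y | G.Reachable x y ∧ IsEndpoint G y}.encard ≤ 2 := by
  by_contra! h
  obtain ⟨t, ht, ht3⟩ := Set.exists_subset_encard_eq (k := 3) (Order.add_one_le_of_lt h)
  obtain ⟨a, b, c, hab, hac, hbc, rfl⟩ := Set.encard_eq_three.1 ht3
  obtain ⟨ha, hb, hc⟩ : _ ∧ _ ∧ _ := ⟨ht (.inl rfl), ht (.inr (.inl rfl)), ht (.inr (.inr rfl))⟩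
  exact hbc (endpoint_unique hG ha.2 hb.2 hc.2 (ha.1.symm.trans hb.1) (ha.1.symm.trans hc.1)
    hab hac)

/-- The graph with all edges at `a` removed. -/
def isolate (G : SimpleGraph V) (a : V) : SimpleGraph V where
  Adj x y := G.Adj x y ∧ x ≠ a ∧ y ≠ a
  symm := ⟨fun _ _ h => ⟨h.1.symm, h.2.2, h.2.1⟩⟩
  loopless := ⟨fun _ h => G.loopless.irrefl _ h.1⟩

/-- Cutting a bi-infinite path at `a` leaves an infinite path at each neighbour of `a`. -/
theorem infinite_cluster_isolate {G : SimpleGraph V} (hG : MaxDegTwo G) {v a : V}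
    (hinf : (cluster G v).Infinite) (hE : ∀ u ∈ cluster G v, ∃ x y, x ≠ y ∧ G.Adj u x ∧ G.Adj u y)
    (hva : G.Adj v a) : (cluster (isolate G a) v).Infinite := by
  intro hfin
  set H := isolate G a with hH
  have hHG : MaxDegTwo H := fun v x y z hx hy hz => hG v x y z hx.1 hy.1 hz.1
  have hav : v ≠ a := hva.ne
  have hle : H ≤ G := fun _ _ h => h.1
  have hsub : cluster H v ⊆ cluster G v := fun w hw => SimpleGraph.Reachable.mono hle hw
  have hna : a ∉ cluster H v := by
    intro ha
    have hs : cluster H a ⊆ {a} := cluster_subset_of_closed rfl (by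
      rintro x rfl y hxy
      exact absurd rfl hxy.2.1)
    exact hav (hs (SimpleGraph.Reachable.symm ha))
  have hv : IsEndpoint H v := by
    intro x y hx hy
    rcases hG v x y a hx.1 hy.1 hva with h | h | h
    · exact h
    · exact absurd h hy.2.2
    · exact absurd h hx.2.2
  -- If the cut cluster is finite, its vertex z farthest from v has at most one neighbour there, so
  -- its second neighbour in `G` is a. Then a has v and z as its only neighbours, and the original
  -- cluster is finite too.
  obtain ⟨z, hz, hzmax⟩ := Set.exists_max_image (cluster H v) (fun w => H.dist v w) hfin
    ⟨v, SimpleGraph.Reachable.refl v⟩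
  have hza : z ≠ a := fun h => hna (h ▸ hz)
  -- the farthest vertex `z` has at most one neighbour in the cut graph
  have hzend : IsEndpoint H z := by
    intro x y hx hy
    have hxr : H.Reachable v x := SimpleGraph.Reachable.trans hz hx.reachable
    have hyr : H.Reachable v y := SimpleGraph.Reachable.trans hz hy.reachable
    have aux : ∀ x, H.Adj z x → H.Reachable v x → H.dist v x + 1 = H.dist v z := by
      intro x hx hxr
      have h1 := hzmax x hxr
      have h2 : H.dist v z ≠ H.dist v x := fun h =>
        hx.ne (sphere_subsingleton hHG hv _ z x hz hxr rfl h.symm)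
      have h3 := hx.diff_dist_adj (u := v)
      omega
    have h1 := aux x hx hxr
    have h2 := aux y hy hyr
    exact sphere_subsingleton hHG hv (H.dist v x) x y hxr hyr rfl (by omega)
  have hzadj : G.Adj z a := by
    obtain ⟨x, y, hxy, hx, hy⟩ := hE z (hsub hz)
    by_contra hcon
    have hxa : x ≠ a := fun h => hcon (h ▸ hx)
    have hya : y ≠ a := fun h => hcon (h ▸ hy)
    exact hxy (hzend x y ⟨hx, hza, hxa⟩ ⟨hy, hza, hya⟩)
  have hzv : z ≠ v := by
    rintro rfl
    obtain ⟨x, y, hxy, hx, hy⟩ := hE z (hsub hz)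
    have : ∃ b, b ≠ a ∧ G.Adj z b := by
      by_cases hxa : x = a
      · exact ⟨y, fun h => hxy (hxa.trans h.symm), hy⟩
      · exact ⟨x, hxa, hx⟩
    obtain ⟨b, hba, hb⟩ := this
    have hbH : H.Adj z b := ⟨hb, hza, hba⟩
    have h1 := hzmax b hbH.reachable
    simp only [SimpleGraph.dist_self, nonpos_iff_eq_zero] at h1
    rw [hbH.reachable.dist_eq_zero_iff] at h1
    exact hbH.ne h1
  have hclosed : cluster G v ⊆ insert a (cluster H v) := by
    refine cluster_subset_of_closed (Or.inr (SimpleGraph.Reachable.refl v)) ?_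
    rintro x (rfl | hx) y hxy
    · rcases hG x v z y hva.symm hzadj.symm hxy with h | h | h
      · exact absurd h.symm hzv
      · exact Or.inr (h ▸ hz)
      · exact Or.inr (h ▸ SimpleGraph.Reachable.refl v)
    · by_cases hya : y = a
      · exact Or.inl hya
      · right
        have hxa : x ≠ a := fun h => hna (h ▸ hx)
        exact SimpleGraph.Reachable.trans hx
          (SimpleGraph.Adj.reachable (G := H) ⟨hxy, hxa, hya⟩)
  exact hinf ((hfin.insert a).subset hclosed)

end DegreeTwo


/-! ### Mutual second-nearest-neighbour graphs of abstract rankings -/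

section Ranking

variable {P : Type*} (lt : P → P → P → Prop)

/-- The points of `S` that come before `w` in the ranking of `v`. -/
def before (S : Set P) (v w : P) : Set P := {u ∈ S | u ≠ v ∧ lt v u w}

/-- Two points of `S` are joined if each is among the first two in the ranking of the other. -/
def nnGraph (S : Set P) : SimpleGraph P where
  Adj v w := v ∈ S ∧ w ∈ S ∧ v ≠ w ∧ (before lt S v w).encard ≤ 1 ∧ (before lt S w v).encard ≤ 1
  symm := ⟨fun _ _ h => ⟨h.2.1, h.1, h.2.2.1.symm, h.2.2.2.2, h.2.2.2.1⟩⟩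
  loopless := ⟨fun _ h => h.2.2.1 rfl⟩

/-- Each point of `S` ranks the others strictly and totally. -/
structure IsRanking (S : Set P) : Prop where
  irrefl : ∀ v u, ¬ lt v u u
  trans : ∀ v a b c, lt v a b → lt v b c → lt v a c
  total : ∀ v ∈ S, ∀ a ∈ S, ∀ b ∈ S, a ≠ v → b ≠ v → a ≠ b → lt v a b ∨ lt v b a

/-- The points whose cluster is infinite. -/
def infSet (S : Set P) : Set P := {v | (cluster (nnGraph lt S) v).Infinite}

/-- No infinite cluster has an endpoint. -/
def EndpointFree (S : Set P) : Prop :=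
  ∀ v ∈ infSet lt S, ∃ a b, a ≠ b ∧ (nnGraph lt S).Adj v a ∧ (nnGraph lt S).Adj v b

variable {lt} {S : Set P}

theorem IsRanking.mono {T : Set P} (h : IsRanking lt S) (hT : T ⊆ S) : IsRanking lt T :=
  ⟨h.irrefl, h.trans, fun v hv a ha b hb => h.total v (hT hv) a (hT ha) b (hT hb)⟩

theorem before_mono {T : Set P} (hT : T ⊆ S) (v w : P) : before lt T v w ⊆ before lt S v w :=
  fun _ hu => ⟨hT hu.1, hu.2⟩

theorem eq_of_encard_before_le_one {v w x y : P} (h : (before lt S v w).encard ≤ 1)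
    (hx : x ∈ before lt S v w) (hy : y ∈ before lt S v w) : x = y :=
  Set.encard_le_one_iff.1 h x y hx hy

/-- If w came before a, then whichever of a and b is later in the ranking of v would have two
predecessors: w and the other one. -/
theorem before_of_top_two (hS : IsRanking lt S) {v a b w : P} (hv : v ∈ S) (ha : a ∈ S)
    (hb : b ∈ S) (hw : w ∈ S) (hav : a ≠ v) (hbv : b ≠ v) (hwv : w ≠ v) (hab : a ≠ b)
    (haw : a ≠ w) (hbw : b ≠ w) (h1 : (before lt S v a).encard ≤ 1)
    (h2 : (before lt S v b).encard ≤ 1) : lt v a w ∧ lt v b w := by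
  have key : ∀ a b : P, a ∈ S → b ∈ S → a ≠ v → b ≠ v → a ≠ b → a ≠ w → b ≠ w →
      (before lt S v a).encard ≤ 1 → (before lt S v b).encard ≤ 1 → lt v a w := by
    intro a b ha hb hav hbv hab haw hbw h1 h2
    rcases hS.total v hv a ha w hw hav hwv haw with h | h
    · exact h
    · exfalso
      rcases hS.total v hv a ha b hb hav hbv hab with h' | h'
      · exact haw (eq_of_encard_before_le_one h2 ⟨ha, hav, h'⟩
          ⟨hw, hwv, hS.trans _ _ _ _ h h'⟩)
      · exact hbw (eq_of_encard_before_le_one h1 ⟨hb, hbv, h'⟩ ⟨hw, hwv, h⟩)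
  exact ⟨key a b ha hb hav hbv hab haw hbw h1 h2, key b a hb ha hbv hav hab.symm hbw haw h2 h1⟩

theorem maxDegTwo_nnGraph (hS : IsRanking lt S) : MaxDegTwo (nnGraph lt S) := by
  intro v x y z hx hy hz
  by_contra! h
  obtain ⟨hxy, hyz, hxz⟩ := h
  have := before_of_top_two hS hx.1 hx.2.1 hy.2.1 hz.2.1 hx.2.2.1.symm hy.2.2.1.symm
    hz.2.2.1.symm hxy hxz hyz hx.2.2.2.1 hy.2.2.2.1
  exact hxy (eq_of_encard_before_le_one hz.2.2.2.1 ⟨hx.2.1, hx.2.2.1.symm, this.1⟩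
    ⟨hy.2.1, hy.2.2.1.symm, this.2⟩)

/-- Deleting points only shrinks the sets of predecessors, so edges between surviving points
persist. All later deletions rest on this monotonicity. -/
theorem adj_of_adj_of_subset {T : Set P} (hT : T ⊆ S) {v w : P} (hv : v ∈ T) (hw : w ∈ T)
    (h : (nnGraph lt S).Adj v w) : (nnGraph lt T).Adj v w :=
  ⟨hv, hw, h.2.2.1, (Set.encard_le_encard (before_mono hT v w)).trans h.2.2.2.1,
    (Set.encard_le_encard (before_mono hT w v)).trans h.2.2.2.2⟩

theorem mem_of_mem_infSet {v : P} (hv : v ∈ infSet lt S) : v ∈ S := by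
  by_contra h
  have : cluster (nnGraph lt S) v ⊆ {v} := cluster_subset_of_closed rfl (by
    rintro x rfl y hxy
    exact absurd hxy.1 h)
  exact hv ((Set.finite_singleton v).subset this)

theorem mem_infSet_of_adj {v w : P} (hv : v ∈ infSet lt S) (h : (nnGraph lt S).Adj v w) :
    w ∈ infSet lt S := by
  have : cluster (nnGraph lt S) w = cluster (nnGraph lt S) v := cluster_eq_of_mem h.reachable
  rw [infSet, Set.mem_ofPred_eq, this]
  exact hv

theorem mem_infSet_of_mem_cluster {v w : P} (hv : v ∈ infSet lt S)
    (h : w ∈ cluster (nnGraph lt S) v) : w ∈ infSet lt S := by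
  rw [infSet, Set.mem_ofPred_eq, cluster_eq_of_mem h]
  exact hv

/-- The half-path left at v by cutting at a consists of vertices of infinite clusters, and `F`
contains none of these; so its edges survive the deletion. -/
theorem mem_infSet_delete (hS : IsRanking lt S) (hE : EndpointFree lt S) {v a : P}
    (hv : v ∈ infSet lt S) (hva : (nnGraph lt S).Adj v a) {F : Set P}
    (hF : Disjoint F (infSet lt S)) : v ∈ infSet lt (S \ insert a F) := by
  have h := infinite_cluster_isolate (maxDegTwo_nnGraph hS) hv
    (fun u hu => hE u (mem_infSet_of_mem_cluster hv hu)) hva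
  refine h.mono ?_
  have hgen : ∀ w, (isolate (nnGraph lt S) a).Reachable v w →
      (nnGraph lt (S \ insert a F)).Reachable v w ∧ w ∈ infSet lt S := by
    intro w hw
    rw [SimpleGraph.reachable_iff_reflTransGen] at hw
    induction hw with
    | refl => exact ⟨SimpleGraph.Reachable.refl v, hv⟩
    | @tail x y _ hxy ih =>
      have hy := mem_infSet_of_adj ih.2 hxy.1
      refine ⟨ih.1.trans (SimpleGraph.Adj.reachable (adj_of_adj_of_subset Set.sdiff_subset
        ⟨hxy.1.1, ?_⟩ ⟨hxy.1.2.1, ?_⟩ hxy.1)), hy⟩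
      · rintro (h | h)
        · exact hxy.2.1 h
        · exact hF.le_bot ⟨h, ih.2⟩
      · rintro (h | h)
        · exact hxy.2.2 h
        · exact hF.le_bot ⟨h, hy⟩
  exact fun w hw => (hgen w hw).1

/-- After deletion of finitely many points off the infinite clusters, a vertex `v` of an infinite
cluster has a third neighbour `w`, which is off the infinite clusters and replaces a neighbour `a`
of `v` that is deleted. -/
theorem exists_third_neighbour (hS : IsRanking lt S)
    (hE : ∀ F : Set P, F.Finite → EndpointFree lt (S \ F)) {v a b : P} (hv : v ∈ infSet lt S)
    (hab : a ≠ b) (ha : (nnGraph lt S).Adj v a) (hb : (nnGraph lt S).Adj v b) {F : Set P}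
    (hfin : F.Finite) (hF : Disjoint F (infSet lt S)) :
    ∃ w ∈ S, w ∉ F ∧ w ≠ v ∧ w ≠ a ∧ w ≠ b ∧ w ∉ infSet lt S ∧
      before lt (S \ F) v w ⊆ {a, b} ∧ (nnGraph lt (S \ insert a F)).Adj v w := by
  have hE0 : EndpointFree lt S := by simpa using hE ∅ Set.finite_empty
  have hdeg := maxDegTwo_nnGraph hS
  have key : ∀ a b : P, a ≠ b → (nnGraph lt S).Adj v a → (nnGraph lt S).Adj v b →
      ∃ w ∈ S, w ∉ F ∧ w ≠ v ∧ w ≠ a ∧ w ≠ b ∧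
        before lt (S \ F) v w ⊆ {a, b} ∧ (nnGraph lt (S \ insert a F)).Adj v w := by
    intro a b hab ha hb
    have hsub : S \ insert a F ⊆ S := Set.sdiff_subset
    have hbF : b ∉ F := fun h => hF.le_bot ⟨h, mem_infSet_of_adj hv hb⟩
    have hb' : (nnGraph lt (S \ insert a F)).Adj v b := by
      refine adj_of_adj_of_subset hsub ⟨hb.1, ?_⟩ ⟨hb.2.1, ?_⟩ hb
      · rintro (h | h)
        · exact ha.ne h
        · exact hF.le_bot ⟨h, hv⟩
      · rintro (h | h)
        · exact hab h.symm
        · exact hbF h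
    have hv' := mem_infSet_delete hS hE0 hv ha hF
    obtain ⟨x, y, hxy, hx, hy⟩ := hE _ (hfin.insert a) v hv'
    -- After the deletion v again has two neighbours; one of them is neither b nor the deleted a.
    obtain ⟨w, hwb, hw⟩ : ∃ w, w ≠ b ∧ (nnGraph lt (S \ insert a F)).Adj v w := by
      by_cases hxb : x = b
      · exact ⟨y, fun h => hxy (hxb.trans h.symm), hy⟩
      · exact ⟨x, hxb, hx⟩
    have hwa : w ≠ a := fun h => hw.2.1.2 (Or.inl h)
    have hlt := before_of_top_two hS ha.1 ha.2.1 hb.2.1 hw.2.1.1 ha.ne.symm hb.ne.symm hw.ne.symm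
      hab hwa.symm hwb.symm ha.2.2.2.1 hb.2.2.2.1
    refine ⟨w, hw.2.1.1, fun h => hw.2.1.2 (Or.inr h), hw.ne.symm, hwa, hwb, ?_, hw⟩
    intro u hu
    by_cases hua : u = a
    · exact Or.inl hua
    · right
      exact eq_of_encard_before_le_one hw.2.2.2.1
        ⟨⟨hu.1.1, fun h => h.elim hua hu.1.2⟩, hu.2⟩ ⟨hb'.2.1, hb.ne.symm, hlt.2⟩
  obtain ⟨w, hwS, hwF, hwv, hwa, hwb, hbef, hadj⟩ := key a b hab ha hb
  obtain ⟨w', hwS', hwF', hwv', hwb', hwa', hbef', hadj'⟩ := key b a hab.symm hb ha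
  -- Apart from a and b, no point of `S \ F` precedes w or w' in the ranking of v, so neither can
  -- precede the other.
  have hww : w' = w := by
    by_contra hne
    have hvS := ha.1
    rcases hS.total v hvS w' hwS' w hwS hwv' hwv hne with h | h
    · rcases hbef ⟨⟨hwS', hwF'⟩, hwv', h⟩ with h | h
      · exact hwa' h
      · exact hwb' h
    · rcases hbef' ⟨⟨hwS, hwF⟩, hwv, h⟩ with h | h
      · exact hwb h
      · exact hwa h
  subst hww
  refine ⟨w', hwS, hwF, hwv, hwa, hwb, ?_, hbef, hadj⟩
  intro hwI
  -- If w' were not adjacent to a, deleting a and `F` would leave it both of its old neighbours and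
  -- add v as a third.
  have hadjac : ∀ a b : P, a ≠ b → w' ≠ a → w' ≠ b → (nnGraph lt S).Adj v a →
      (nnGraph lt S).Adj v b → (nnGraph lt (S \ insert a F)).Adj v w' →
      (nnGraph lt S).Adj w' a := by
    intro a b hab hwa hwb ha hb hadj
    by_contra hcon
    obtain ⟨c, c', hcc, hc, hc'⟩ := hE0 w' hwI
    have hdel : ∀ c, (nnGraph lt S).Adj w' c → (nnGraph lt (S \ insert a F)).Adj w' c := by
      intro c hc
      refine adj_of_adj_of_subset Set.sdiff_subset hadj.2.1 ⟨hc.2.1, ?_⟩ hc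
      rintro (h | h)
      · exact hcon (h ▸ hc)
      · exact hF.le_bot ⟨h, mem_infSet_of_adj hwI hc⟩
    have hvw : ¬ (nnGraph lt S).Adj w' v := by
      intro h
      rcases hdeg v a b w' ha hb h.symm with h | h | h
      · exact hab h
      · exact hwb h.symm
      · exact hwa h.symm
    rcases maxDegTwo_nnGraph (hS.mono Set.sdiff_subset) w' c c' v (hdel c hc) (hdel c' hc')
      hadj.symm with h | h | h
    · exact hcc h
    · exact hvw (h ▸ hc')
    · exact hvw (h ▸ hc)
  have h1 := hadjac a b hab hwa hwb ha hb hadj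
  have h2 := hadjac b a hab.symm hwb hwa hb ha hadj'
  -- By the degree bound, the 4-cycle through v, a, w', b has no further edges and is a whole
  -- cluster.
  have hsub : cluster (nnGraph lt S) v ⊆ {v, a, w', b} := by
    refine cluster_subset_of_closed (Or.inl rfl) ?_
    have four : ∀ x p q y : P, p ≠ q → (nnGraph lt S).Adj x p → (nnGraph lt S).Adj x q →
        (nnGraph lt S).Adj x y → y = p ∨ y = q := by
      intro x p q y hpq hp hq hy
      rcases hdeg x p q y hp hq hy with h | h | h
      · exact absurd h hpq
      · exact Or.inr h.symm
      · exact Or.inl h.symm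
    rintro x (rfl | rfl | rfl | rfl) y hxy
    · rcases four _ _ _ y hab ha hb hxy with rfl | rfl <;> simp
    · rcases four _ _ _ y hwv h1.symm ha.symm hxy with rfl | rfl <;> simp
    · rcases four _ _ _ y hab h1 h2 hxy with rfl | rfl <;> simp
    · rcases four _ _ _ y hwv h2.symm hb.symm hxy with rfl | rfl <;> simp
  exact hv ((Set.toFinite _).subset hsub)

/-- Strong induction on the rank of w: the predecessors of w other than a and b are off the infinite
clusters by induction, so they may serve as the set `F` to delete. The third neighbour that v then
has can only be w. Finiteness of the rank is assumed because an ordering function may place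
infinitely many points before w. -/
theorem ranked_off_infSet (hS : IsRanking lt S)
    (hE : ∀ F : Set P, F.Finite → EndpointFree lt (S \ F)) {v a b : P} (hv : v ∈ infSet lt S)
    (hab : a ≠ b) (ha : (nnGraph lt S).Adj v a) (hb : (nnGraph lt S).Adj v b) {w : P}
    (hw : w ∈ S) (hwv : w ≠ v) (hwa : w ≠ a) (hwb : w ≠ b) (hfin : (before lt S v w).Finite) :
    w ∉ infSet lt S ∧ (nnGraph lt (S \ insert a (before lt S v w \ {a, b}))).Adj v w := by
  induction hn : (before lt S v w).ncard using Nat.strong_induction_on generalizing w with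
  | _ n ih =>
    have hF : Disjoint (before lt S v w \ {a, b}) (infSet lt S) := by
      rw [Set.disjoint_left]
      rintro u ⟨hu, hu'⟩
      simp only [Set.mem_insert_iff, Set.mem_singleton_iff, not_or] at hu'
      have hss : before lt S v u ⊂ before lt S v w :=
        ⟨fun x hx => ⟨hx.1, hx.2.1, hS.trans _ _ _ _ hx.2.2 hu.2.2⟩,
          fun h => hS.irrefl v u (h hu).2.2⟩
      exact (ih _ (hn ▸ Set.ncard_lt_ncard hss hfin) hu.1 hu.2.1 hu'.1 hu'.2
        (hfin.subset hss.1) rfl).1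
    obtain ⟨w', hwS', hwF', hwv', hwa', hwb', hwI', hbef, hadj⟩ :=
      exists_third_neighbour hS hE hv hab ha hb (hfin.subset Set.sdiff_subset) hF
    have hww : w' = w := by
      by_contra hne
      rcases hS.total v ha.1 w' hwS' w hw hwv' hwv hne with h | h
      · exact hwF' ⟨⟨hwS', hwv', h⟩, by simp [hwa', hwb']⟩
      · have : w ∈ before lt (S \ (before lt S v w \ {a, b})) v w' :=
          ⟨⟨hw, fun h => hS.irrefl _ _ h.1.2.2⟩, hwv, h⟩
        rcases hbef this with h | h
        · exact hwa h
        · exact hwb h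
    subst hww
    exact ⟨hwI', hadj⟩

variable (lt S) in
/-- `w` is off the infinite clusters and has finite rank for the vertex `v` of an infinite
cluster. -/
def Ranks (v w : P) : Prop :=
  v ∈ infSet lt S ∧ w ∈ S ∧ w ∉ infSet lt S ∧ (before lt S v w).Finite

/-- If v ranked only finitely many points, they could all be deleted as `F`. The third neighbour
that v then acquires has its predecessors in `F` together with a and b, hence finite rank, but lies
outside `F`. -/
theorem infinite_ranks (hS : IsRanking lt S)
    (hE : ∀ F : Set P, F.Finite → EndpointFree lt (S \ F)) {v : P} (hv : v ∈ infSet lt S) :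
    {w | Ranks lt S v w}.Infinite := by
  intro hfin
  have hE0 : EndpointFree lt S := by simpa using hE ∅ Set.finite_empty
  obtain ⟨a, b, hab, ha, hb⟩ := hE0 v hv
  obtain ⟨w, hwS, hwF, -, -, -, hwI, hbef, -⟩ := exists_third_neighbour hS hE hv hab ha hb hfin
    (Set.disjoint_left.2 fun w hw => hw.2.2.1)
  refine hwF ⟨hv, hwS, hwI, ?_⟩
  refine ((hfin.union (Set.toFinite {a, b}))).subset fun u hu => ?_
  by_cases huF : u ∈ {w | Ranks lt S v w}
  · exact Or.inl huF
  · exact Or.inr (hbef ⟨⟨hu.1, huF⟩, hu.2⟩)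

/-- Greedy choice: each chosen vertex discards itself and at most two neighbours, and 7 - 3 - 3
leaves a third vertex. This is the origin of the constant six below. -/
theorem exists_three_nonadjacent {G : SimpleGraph P} (hG : MaxDegTwo G) {s : Set P}
    (hs : 6 < s.encard) : ∃ x ∈ s, ∃ y ∈ s, ∃ z ∈ s, x ≠ y ∧ x ≠ z ∧ y ≠ z ∧
      ¬ G.Adj x y ∧ ¬ G.Adj x z ∧ ¬ G.Adj y z := by
  have hN : ∀ x, (insert x {y | G.Adj x y}).encard ≤ 3 := by
    intro x
    refine (Set.encard_insert_le _ _).trans ?_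
    have : {y | G.Adj x y}.encard ≤ 2 := by
      by_contra! h
      obtain ⟨t, ht, ht3⟩ := Set.exists_subset_encard_eq (k := 3) (Order.add_one_le_of_lt h)
      obtain ⟨a, b, c, hab, hac, hbc, rfl⟩ := Set.encard_eq_three.1 ht3
      rcases hG x a b c (ht (.inl rfl)) (ht (.inr (.inl rfl))) (ht (.inr (.inr rfl))) with h | h | h
      · exact hab h
      · exact hbc h
      · exact hac h
    exact (add_le_add_left this 1).trans (by norm_num)
  obtain ⟨t, hts, ht⟩ := Set.exists_subset_encard_eq (k := 7) (Order.add_one_le_of_lt hs)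
  have hdiff : ∀ (t : Set P) (x : P) (n : ℕ), ((n + 3 : ℕ) : ℕ∞) < t.encard →
      (n : ℕ∞) < (t \ insert x {y | G.Adj x y}).encard := by
    intro t x n ht
    by_contra! h
    refine absurd ht (not_lt.2 ?_)
    have := Set.encard_le_encard_sdiff_add_encard t (insert x {y | G.Adj x y})
    refine this.trans ((add_le_add h (hN x)).trans ?_)
    push_cast
    exact le_rfl
  obtain ⟨x, hx⟩ : s.Nonempty := Set.encard_pos.1 (lt_trans (by norm_num) hs)
  have h3 := hdiff s x 3 (by exact_mod_cast hs)
  obtain ⟨y, hy⟩ : (s \ insert x {y | G.Adj x y}).Nonempty :=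
    Set.encard_pos.1 (lt_trans (by norm_num) h3)
  have h0 := hdiff _ y 0 (by exact_mod_cast h3)
  obtain ⟨z, hz⟩ := Set.encard_pos.1 (lt_of_le_of_lt (by norm_num) h0)
  have hy' := hy.2
  have hz1 := hz.1.2
  have hz2 := hz.2
  simp only [Set.mem_insert_iff, Set.mem_ofPred_eq, not_or] at hy' hz1 hz2
  exact ⟨x, hx, y, hy.1, z, hz.1.1, fun h => hy'.1 h.symm, fun h => hz1.1 h.symm,
    fun h => hz2.1 h.symm, hy'.2, hz1.2, hz2.2⟩

theorem encard_ranks_le_six (hS : IsRanking lt S)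
    (hE : ∀ F : Set P, F.Finite → EndpointFree lt (S \ F)) (w : P) :
    {v | Ranks lt S v w}.encard ≤ 6 := by
  by_contra! hcon
  obtain ⟨x, hx, y, hy, z, hz, hxy, hxz, hyz, hnxy, hnxz, hnyz⟩ :=
    exists_three_nonadjacent (maxDegTwo_nnGraph hS) hcon
  have hE0 : EndpointFree lt S := by simpa using hE ∅ Set.finite_empty
  have key : ∀ v, Ranks lt S v w → ∃ a T, T.Finite ∧ (nnGraph lt S).Adj v a ∧
      Disjoint T (infSet lt S) ∧ w ∉ T ∧ w ≠ a ∧ (nnGraph lt (S \ insert a T)).Adj v w := by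
    intro v hv
    obtain ⟨a, b, hab, ha, hb⟩ := hE0 v hv.1
    have hne : ∀ u ∈ infSet lt S, w ≠ u := fun u hu h => hv.2.2.1 (h ▸ hu)
    have hwa := hne a (mem_infSet_of_adj hv.1 ha)
    refine ⟨a, before lt S v w \ {a, b}, hv.2.2.2.subset Set.sdiff_subset, ha, ?_,
      fun h => hS.irrefl _ _ h.1.2.2, hwa, ?_⟩
    · rw [Set.disjoint_left]
      rintro u ⟨hu, hu'⟩
      simp only [Set.mem_insert_iff, Set.mem_singleton_iff, not_or] at hu'
      exact (ranked_off_infSet hS hE hv.1 hab ha hb hu.1 hu.2.1 hu'.1 hu'.2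
        (hv.2.2.2.subset fun t ht => ⟨ht.1, ht.2.1, hS.trans _ _ _ _ ht.2.2 hu.2.2⟩)).1
    · exact (ranked_off_infSet hS hE hv.1 hab ha hb hv.2.1 (hne v hv.1) hwa
        (hne b (mem_infSet_of_adj hv.1 hb)) hv.2.2.2).2
  obtain ⟨a, A, hA, hxa, hAI, hwA, hwa, hxw⟩ := key x hx
  obtain ⟨b, B, hB, hyb, hBI, hwB, hwb, hyw⟩ := key y hy
  obtain ⟨c, C, hC, hzc, hCI, hwC, hwc, hzw⟩ := key z hz
  -- All three deletions at once. The vertices x, y, z survive: they are on infinite clusters, hence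
  -- outside `A`, `B`, `C`, and being pairwise nonadjacent they are none of the deleted neighbours
  -- a, b, c.
  set D : Set P := insert a A ∪ insert b B ∪ insert c C with hD
  have hwD : w ∈ S \ D := by
    refine ⟨hx.2.1, ?_⟩
    simp [hD, hwA, hwB, hwC, hwa, hwb, hwc]
  have hmem : ∀ v ∈ infSet lt S, v ≠ a → v ≠ b → v ≠ c → v ∈ S \ D := by
    intro v hv h1 h2 h3
    have hA' : v ∉ A := fun h => hAI.le_bot ⟨h, hv⟩
    have hB' : v ∉ B := fun h => hBI.le_bot ⟨h, hv⟩
    have hC' : v ∉ C := fun h => hCI.le_bot ⟨h, hv⟩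
    exact ⟨mem_of_mem_infSet hv, by simp [hD, hA', hB', hC', h1, h2, h3]⟩
  have hne : ∀ {u v a}, (nnGraph lt S).Adj v a → ¬ (nnGraph lt S).Adj v u → u ≠ a :=
    fun h1 h2 h => h2 (h ▸ h1)
  have hnyx := fun h => hnxy (SimpleGraph.Adj.symm h)
  have hnzx := fun h => hnxz (SimpleGraph.Adj.symm h)
  have hnzy := fun h => hnyz (SimpleGraph.Adj.symm h)
  have hxD := hmem x hx.1 hxa.ne (hne hyb hnyx) (hne hzc hnzx)
  have hyD := hmem y hy.1 (hne hxa hnxy) hyb.ne (hne hzc hnzy)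
  have hzD := hmem z hz.1 (hne hxa hnxz) (hne hyb hnyz) hzc.ne
  have sA : S \ D ⊆ S \ insert a A := Set.sdiff_subset_sdiff_right fun u hu => Or.inl (Or.inl hu)
  have sB : S \ D ⊆ S \ insert b B := Set.sdiff_subset_sdiff_right fun u hu => Or.inl (Or.inr hu)
  have sC : S \ D ⊆ S \ insert c C := Set.sdiff_subset_sdiff_right fun u hu => Or.inr hu
  rcases maxDegTwo_nnGraph (hS.mono (Set.sdiff_subset (t := D))) w x y z
    (adj_of_adj_of_subset sA hxD hwD hxw).symm (adj_of_adj_of_subset sB hyD hwD hyw).symm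
    (adj_of_adj_of_subset sC hzD hwD hzw).symm with h | h | h
  · exact hxy h
  · exact hyz h
  · exact hxz h

end Ranking

/-! ### Measurable enumeration of the points of a configuration -/

namespace MarkedConfig

section Counts

variable {d : ℕ} {M : Type*}

/-- Distinct points have distinct positions. -/
def Simple (ξ : MarkedConfig d M) : Prop := Set.InjOn Prod.fst ξ.carrier

variable (d) in
/-- An enumeration of a countable basis of `ℝ ^ d`. -/
noncomputable def cell : ℕ → Set (Fin d → ℝ) :=
  ((TopologicalSpace.countable_countableBasis (Fin d → ℝ)).exists_eq_range
    ((TopologicalSpace.isBasis_countableBasis (Fin d → ℝ)).exists_subset_of_mem_open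
      (Set.mem_univ 0) isOpen_univ |>.imp fun _ h => h.1)).choose

theorem range_cell : Set.range (cell d) = TopologicalSpace.countableBasis (Fin d → ℝ) :=
  ((TopologicalSpace.countable_countableBasis (Fin d → ℝ)).exists_eq_range
    ((TopologicalSpace.isBasis_countableBasis (Fin d → ℝ)).exists_subset_of_mem_open
      (Set.mem_univ 0) isOpen_univ |>.imp fun _ h => h.1)).choose_spec.symm

theorem isOpen_cell (i : ℕ) : IsOpen (cell d i) :=
  TopologicalSpace.isOpen_of_mem_countableBasis (range_cell (d := d) ▸ Set.mem_range_self i)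

theorem exists_cell_subset {x : Fin d → ℝ} {U : Set (Fin d → ℝ)} (hx : x ∈ U) (hU : IsOpen U) :
    ∃ i, x ∈ cell d i ∧ cell d i ⊆ U := by
  obtain ⟨V, hV, hxV, hVU⟩ :=
    (TopologicalSpace.isBasis_countableBasis (Fin d → ℝ)).exists_subset_of_mem_open hx hU
  rw [← range_cell] at hV
  obtain ⟨i, rfl⟩ := hV
  exact ⟨i, hxV, hVU⟩

/-- The `i`-th cell contains exactly one point. -/
def Solo (ξ : MarkedConfig d M) (i : ℕ) : Prop := ξ.posCount (cell d i) = 1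

open Classical in
/-- The point in the `i`-th cell, if there is exactly one. -/
noncomputable def pt [Nonempty M] (ξ : MarkedConfig d M) (i : ℕ) : (Fin d → ℝ) × M :=
  if h : ξ.Solo i then (Set.encard_eq_one.1 h).choose else Classical.arbitrary _

variable [Nonempty M] {ξ : MarkedConfig d M} {i : ℕ}

theorem Solo.inter_eq (h : ξ.Solo i) : ξ.carrier ∩ {p | p.1 ∈ cell d i} = {ξ.pt i} := by
  rw [pt, dif_pos h]
  exact (Set.encard_eq_one.1 h).choose_spec

theorem Solo.mem (h : ξ.Solo i) : ξ.pt i ∈ ξ.carrier :=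
  (h.inter_eq.symm.subset rfl).1

theorem Solo.eq_pt (h : ξ.Solo i) {p : (Fin d → ℝ) × M} (hp : p ∈ ξ.carrier)
    (hpi : p.1 ∈ cell d i) : p = ξ.pt i :=
  h.inter_eq.subset ⟨hp, hpi⟩

theorem pt_of_not_solo (h : ¬ ξ.Solo i) : ξ.pt i = Classical.arbitrary _ := dif_neg h

/-- By local finiteness the unit ball around p meets only finitely many other positions, and p has a
basic neighbourhood inside the ball that avoids them. -/
theorem Simple.exists_solo (hξ : ξ.Simple) {p : (Fin d → ℝ) × M} (hp : p ∈ ξ.carrier) :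
    ∃ i, ξ.Solo i ∧ ξ.pt i = p := by
  have hfin := ξ.locallyFinite (Metric.ball p.1 1) Metric.isBounded_ball
  set F : Set (Fin d → ℝ) := Prod.fst '' ({q ∈ ξ.carrier | q.1 ∈ Metric.ball p.1 1} \ {p}) with hF
  have hFc : IsClosed F := ((hfin.subset Set.sdiff_subset).image _).isClosed
  obtain ⟨i, hpi, hi⟩ := exists_cell_subset (x := p.1) (U := Metric.ball p.1 1 ∩ Fᶜ)
    ⟨Metric.mem_ball_self one_pos, by
      rintro ⟨q, ⟨hq, hqp⟩, h⟩
      exact hqp (hξ hq.1 hp h)⟩ (Metric.isOpen_ball.inter hFc.isOpen_compl)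
  have h1 : ξ.carrier ∩ {q | q.1 ∈ cell d i} = {p} := by
    refine Set.Subset.antisymm ?_ (Set.singleton_subset_iff.2 ⟨hp, hpi⟩)
    rintro q ⟨hq, hqi⟩
    by_contra hqp
    exact (hi hqi).2 ⟨q, ⟨⟨hq, (hi hqi).1⟩, hqp⟩, rfl⟩
  have h2 : ξ.Solo i := by
    rw [Solo, posCount, count, h1, Set.encard_singleton]
  exact ⟨i, h2, (h2.eq_pt hp hpi).symm⟩

/-- The `i`-th cell contains exactly one point, and this point is not the only point of an earlier
cell. -/
def Fresh (ξ : MarkedConfig d M) (i : ℕ) : Prop :=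
  ξ.Solo i ∧ ∀ j < i, ξ.Solo j → (ξ.pt j).1 ≠ (ξ.pt i).1

open Classical in
/-- The points of a simple configuration, listed without repetition. -/
noncomputable def freshEquiv (hξ : ξ.Simple) : {i | ξ.Fresh i} ≃ ξ.carrier :=
  Equiv.ofBijective (fun i => ⟨ξ.pt i, i.2.1.mem⟩) <| by
    constructor
    · rintro ⟨i, hi⟩ ⟨j, hj⟩ h
      have h' : (ξ.pt i).1 = (ξ.pt j).1 := congrArg (fun p => p.1.1) h
      rcases lt_trichotomy i j with hij | hij | hij
      · exact absurd h' (hj.2 i hij hi.1)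
      · exact Subtype.ext hij
      · exact absurd h'.symm (hi.2 j hij hj.1)
    · rintro ⟨p, hp⟩
      have hex := hξ.exists_solo hp
      obtain ⟨h1, h2⟩ := Nat.find_spec hex
      refine ⟨⟨Nat.find hex, h1, fun j hj hs heq => Nat.find_min hex hj ⟨hs, ?_⟩⟩,
        Subtype.ext h2⟩
      rw [h2] at heq
      exact hξ hs.mem hp heq

theorem Simple.tsum_eq (hξ : ξ.Simple) (g : (Fin d → ℝ) × M → ℝ≥0∞) :
    ∑' x : ξ.carrier, g x = ∑' i, {i | ξ.Fresh i}.indicator (fun i => g (ξ.pt i)) i := by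
  rw [← tsum_subtype, ← (freshEquiv hξ).tsum_eq]
  rfl

open Classical in
/-- A point of the configuration, if there is one: the one in the `i`-th cell if that cell contains
exactly one point. -/
noncomputable def sel (i : ℕ) (ξ : MarkedConfig d M) : (Fin d → ℝ) × M :=
  if ξ.Solo i then ξ.pt i else
    -- Otherwise the first cell with exactly one point is used. The second alternative in the
    -- predicate makes the search terminate even if there is no such cell.
    ξ.pt (Nat.find (p := fun n => ξ.Solo n ∨ ∀ j, ¬ ξ.Solo j)
      (by by_cases h : ∃ n, ξ.Solo n
          · exact h.imp fun _ => Or.inl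
          · exact ⟨0, Or.inr (not_exists.1 h)⟩))

theorem sel_of_solo (h : ξ.Solo i) : sel i ξ = ξ.pt i := if_pos h

theorem Simple.sel_mem (hξ : ξ.Simple) (hne : ξ.carrier.Nonempty) (i : ℕ) :
    sel i ξ ∈ ξ.carrier := by
  classical
  rw [sel]
  split_ifs with h
  · exact h.mem
  · have hex : ∃ n, ξ.Solo n ∨ ∀ j, ¬ ξ.Solo j := by
      by_cases h : ∃ n, ξ.Solo n
      · exact h.imp fun _ => Or.inl
      · exact ⟨0, Or.inr (not_exists.1 h)⟩
    obtain ⟨x, hx⟩ := hne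
    obtain ⟨j, hj, -⟩ := hξ.exists_solo hx
    exact ((Nat.find_spec hex).resolve_right fun h => h j hj).mem

theorem Simple.exists_sel (hξ : ξ.Simple) {p : (Fin d → ℝ) × M}
    (hp : p ∈ ξ.carrier) : ∃ i, sel i ξ = p := by
  obtain ⟨i, hi, rfl⟩ := hξ.exists_solo hp
  exact ⟨i, sel_of_solo hi⟩

end Counts

section Measurability

variable {d : ℕ} {M : Type*} [MeasurableSpace M] {Ω : Type*} [MeasurableSpace Ω]

theorem measurable_count {B : Set ((Fin d → ℝ) × M)} (hB : MeasurableSet B) :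
    Measurable fun ξ : MarkedConfig d M => ξ.count B := by
  rw [measurable_iff_comap_le]
  exact le_iSup (fun B : {B : Set ((Fin d → ℝ) × M) // MeasurableSet B} =>
    MeasurableSpace.comap (fun ξ : MarkedConfig d M => ξ.count B.1) ⊤) ⟨B, hB⟩

theorem measurable_of_count {X : Ω → MarkedConfig d M}
    (h : ∀ B, MeasurableSet B → Measurable fun ω => (X ω).count B) : Measurable X := by
  rw [measurable_iff_comap_le, instMeasurableSpace, MeasurableSpace.comap_iSup]
  refine iSup_le fun B => ?_
  rw [MeasurableSpace.comap_comp, ← measurable_iff_comap_le]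
  exact h B.1 B.2

theorem measurable_posCount {B : Set (Fin d → ℝ)} (hB : MeasurableSet B) :
    Measurable fun ξ : MarkedConfig d M => ξ.posCount B :=
  measurable_count (measurable_fst hB)

theorem measurable_translate (t : Fin d → ℝ) :
    Measurable fun ξ : MarkedConfig d M => ξ.translate t := by
  refine measurable_of_count fun B hB => ?_
  have : (fun ξ : MarkedConfig d M => (ξ.translate t).count B) =
      fun ξ => ξ.count ((fun p => (p.1 + t, p.2)) ⁻¹' B) := by
    funext ξ
    have hinj : Function.Injective fun p : (Fin d → ℝ) × M => (p.1 + t, p.2) := by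
      rintro ⟨a, b⟩ ⟨a', b'⟩ h
      simpa using h
    rw [count, count, ← hinj.encard_image (ξ.carrier ∩ _), Set.image_inter_preimage]
    rfl
  rw [this]
  exact measurable_count ((measurable_fst.add_const t).prodMk measurable_snd hB)

theorem measurableSet_solo (i : ℕ) : MeasurableSet {ξ : MarkedConfig d M | ξ.Solo i} :=
  measurable_posCount (isOpen_cell i).measurableSet (measurableSet_singleton 1)

theorem measurable_erase {X : Ω → MarkedConfig d M} (hX : Measurable X)
    {z : Ω → (Fin d → ℝ) × M} (hz : Measurable z)
    (hzX : ∀ ω, (X ω).carrier.Nonempty → z ω ∈ (X ω).carrier) :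
    Measurable fun ω => (X ω).erase (z ω) := by
  classical
  refine measurable_of_count fun B hB => ?_
  -- Removing z lowers the count by one exactly if z is in `B`. For an empty configuration z is
  -- arbitrary, but the truncated difference is still zero.
  have : (fun ω => ((X ω).erase (z ω)).count B) =
      fun ω => if z ω ∈ B then (X ω).count B - 1 else (X ω).count B := by
    funext ω
    by_cases hne : (X ω).carrier.Nonempty
    · split_ifs with h
      · rw [count, count, erase, ← Set.inter_sdiff_right_comm, Set.encard_sdiff_singleton_of_mem]
        exact ⟨hzX ω hne, h⟩
      · rw [count, count, erase, ← Set.inter_sdiff_right_comm, Set.sdiff_singleton_eq_self]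
        exact fun h' => h h'.2
    · rw [Set.not_nonempty_iff_eq_empty] at hne
      simp [count, erase, hne]
  rw [this]
  exact Measurable.ite (hz hB)
    ((Measurable.of_discrete (f := fun n : ℕ∞ => n - 1)).comp ((measurable_count hB).comp hX))
    ((measurable_count hB).comp hX)

variable [Nonempty M]

theorem measurable_pt (i : ℕ) : Measurable fun ξ : MarkedConfig d M => ξ.pt i := by
  intro B hB
  have hcell : MeasurableSet {p : (Fin d → ℝ) × M | p.1 ∈ cell d i} :=
    measurable_fst (isOpen_cell i).measurableSet
  have : (fun ξ : MarkedConfig d M => ξ.pt i) ⁻¹' B =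
      ({ξ | ξ.Solo i} ∩ {ξ | ξ.count ({p | p.1 ∈ cell d i} ∩ B) = 1}) ∪
        ({ξ | ξ.Solo i}ᶜ ∩ {_ξ | Classical.arbitrary _ ∈ B}) := by
    ext ξ
    by_cases h : ξ.Solo i
    · have : ξ.count ({p | p.1 ∈ cell d i} ∩ B) = 1 ↔ ξ.pt i ∈ B := by
        rw [count, ← Set.inter_assoc, h.inter_eq]
        by_cases hB : ξ.pt i ∈ B
        · rw [Set.inter_eq_left.2 (Set.singleton_subset_iff.2 hB)]
          simp [hB]
        · rw [Set.singleton_inter_eq_empty.2 hB]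
          simp [hB]
      simp [h, this]
    · simp [h, pt_of_not_solo h]
  rw [this]
  exact ((measurableSet_solo i).inter
    (measurable_count (hcell.inter hB) (measurableSet_singleton 1))).union
      ((measurableSet_solo i).compl.inter (MeasurableSet.const _))

theorem measurableSet_fresh (i : ℕ) : MeasurableSet {ξ : MarkedConfig d M | ξ.Fresh i} := by
  have : {ξ : MarkedConfig d M | ξ.Fresh i} = {ξ | ξ.Solo i} ∩
      ⋂ j : ℕ, ⋂ _ : j < i, ({ξ | ξ.Solo j}ᶜ ∪ {ξ | (ξ.pt j).1 = (ξ.pt i).1}ᶜ) := by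
    ext ξ
    simp [Fresh, imp_iff_not_or]
  rw [this]
  refine (measurableSet_solo i).inter (MeasurableSet.iInter fun j => MeasurableSet.iInter fun _ =>
    (measurableSet_solo j).compl.union (MeasurableSet.compl ?_))
  exact measurableSet_eq_fun (measurable_fst.comp (measurable_pt j))
    (measurable_fst.comp (measurable_pt i))

theorem measurable_tsum {X : Ω → MarkedConfig d M} (hX : Measurable X) (hs : ∀ ω, (X ω).Simple)
    {g : Ω → (Fin d → ℝ) × M → ℝ≥0∞} (hg : Measurable (Function.uncurry g)) :
    Measurable fun ω => ∑' x : (X ω).carrier, g ω x := by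
  have : (fun ω => ∑' x : (X ω).carrier, g ω x) = fun ω => ∑' i,
      {ω | (X ω).Fresh i}.indicator (fun ω => g ω ((X ω).pt i)) ω := by
    funext ω
    rw [(hs ω).tsum_eq]
    rfl
  rw [this]
  exact Measurable.tsum fun i =>
    (hg.comp (measurable_id.prodMk ((measurable_pt i).comp hX))).indicator
      (hX (measurableSet_fresh i))

theorem measurableSet_exists {X : Ω → MarkedConfig d M} (hX : Measurable X)
    (hs : ∀ ω, (X ω).Simple) {p : Ω → (Fin d → ℝ) × M → Prop}
    (hp : MeasurableSet {q : Ω × ((Fin d → ℝ) × M) | p q.1 q.2}) :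
    MeasurableSet {ω | ∃ x ∈ (X ω).carrier, p ω x} := by
  have : {ω | ∃ x ∈ (X ω).carrier, p ω x} =
      ⋃ i, {ω | (X ω).Solo i} ∩ {ω | p ω ((X ω).pt i)} := by
    ext ω
    simp only [Set.mem_iUnion]
    constructor
    · rintro ⟨x, hx, hpx⟩
      obtain ⟨i, hi, rfl⟩ := (hs ω).exists_solo hx
      exact ⟨i, hi, hpx⟩
    · rintro ⟨i, hi, hpx⟩
      exact ⟨_, hi.mem, hpx⟩
  rw [this]
  exact MeasurableSet.iUnion fun i => (hX (measurableSet_solo i)).inter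
    ((measurable_id.prodMk ((measurable_pt i).comp hX)) hp)

theorem measurable_sel (i : ℕ) : Measurable (sel i : MarkedConfig d M → _) := by
  classical
  refine Measurable.ite (measurableSet_solo i) (measurable_pt i)
    (Measurable.find (p := fun n (ξ : MarkedConfig d M) => ξ.Solo n ∨ ∀ j, ¬ ξ.Solo j)
      (f := fun n (ξ : MarkedConfig d M) => ξ.pt n) measurable_pt (fun n => ?_) _)
  have : {ξ : MarkedConfig d M | ξ.Solo n ∨ ∀ j, ¬ ξ.Solo j} =
      {ξ | ξ.Solo n} ∪ ⋂ j, {ξ | ξ.Solo j}ᶜ := by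
    ext ξ; simp
  rw [this]
  exact (measurableSet_solo n).union (MeasurableSet.iInter fun j => (measurableSet_solo j).compl)

end Measurability

end MarkedConfig

/-! ### Mass transport -/

section MassTransport

variable {d : ℕ} {M : Type*}

theorem tsum_indicator_one_eq_encard {α : Type*} (s : Set α) (p : α → Prop) :
    ∑' y : s, {y | p y}.indicator (1 : α → ℝ≥0∞) y = ({y ∈ s | p y}.encard : ℝ≥0∞) := by
  rw [← ENNReal.tsum_set_one, tsum_subtype s, tsum_subtype _ fun _ => (1 : ℝ≥0∞)]
  refine tsum_congr fun y => ?_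
  by_cases h1 : y ∈ s <;> by_cases h2 : p y <;> simp [h1, h2]

/-- Translation of the position of a marked point. -/
def shift (t : Fin d → ℝ) (p : (Fin d → ℝ) × M) : (Fin d → ℝ) × M := (p.1 + t, p.2)

theorem shift_injective (t : Fin d → ℝ) : Function.Injective (shift t : (Fin d → ℝ) × M → _) := by
  rintro ⟨a, b⟩ ⟨a', b'⟩ h
  simpa [shift] using h

theorem shift_mem_translate {ξ : MarkedConfig d M} {t : Fin d → ℝ} {p : (Fin d → ℝ) × M} :
    shift t p ∈ (ξ.translate t).carrier ↔ p ∈ ξ.carrier :=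
  (shift_injective t).mem_set_image

theorem tsum_translate (ξ : MarkedConfig d M) (t : Fin d → ℝ) (g : (Fin d → ℝ) × M → ℝ≥0∞) :
    ∑' x : (ξ.translate t).carrier, g x = ∑' x : ξ.carrier, g (shift t x) :=
  ((Equiv.Set.image (shift t) ξ.carrier (shift_injective t)).tsum_eq
    (fun x : (ξ.translate t).carrier => g x)).symm

theorem MarkedConfig.Simple.translate {ξ : MarkedConfig d M} (h : ξ.Simple) (t : Fin d → ℝ) :
    (ξ.translate t).Simple := by
  rintro _ ⟨p, hp, rfl⟩ _ ⟨q, hq, rfl⟩ hpq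
  have : p.1 = q.1 := by simpa using hpq
  rw [h hp hq this]

theorem MarkedConfig.Simple.erase {ξ : MarkedConfig d M} (h : ξ.Simple)
    (z : (Fin d → ℝ) × M) : (ξ.erase z).Simple :=
  h.mono Set.sdiff_subset

variable (d M) in
/-- Simple configurations. -/
abbrev SimpleConfig := {ξ : MarkedConfig d M // ξ.Simple}

/-- Translation of simple configurations. -/
def SimpleConfig.translate (t : Fin d → ℝ) (ξ : SimpleConfig d M) : SimpleConfig d M :=
  ⟨ξ.1.translate t, ξ.2.translate t⟩

theorem SimpleConfig.measurable_translate [MeasurableSpace M] (t : Fin d → ℝ) :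
    Measurable (SimpleConfig.translate t : SimpleConfig d M → _) :=
  ((MarkedConfig.measurable_translate t).comp measurable_subtype_coe).subtype_mk

variable (d) in
/-- The unit box with lower corner `z`. -/
def box (z : Fin d → ℤ) : Set (Fin d → ℝ) := {x | ∀ i, ⌊x i⌋ = z i}

theorem measurableSet_box (z : Fin d → ℤ) : MeasurableSet (box d z) := by
  have : box d z = ⋂ i, (fun x : Fin d → ℝ => ⌊x i⌋) ⁻¹' {z i} := by
    ext x; simp [box]
  rw [this]
  exact MeasurableSet.iInter fun i =>
    (Int.measurable_floor.comp (measurable_pi_apply i)) (measurableSet_singleton _)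

theorem add_mem_box_iff {x : Fin d → ℝ} {z w : Fin d → ℤ} :
    x + (fun i => (w i : ℝ)) ∈ box d z ↔ x ∈ box d (z - w) := by
  simp only [box, Set.mem_ofPred_eq, Pi.add_apply, Int.floor_add_intCast, Pi.sub_apply,
    eq_sub_iff_add_eq]

theorem mem_box_iff {x : Fin d → ℝ} {z : Fin d → ℤ} : x ∈ box d z ↔ z = fun i => ⌊x i⌋ := by
  simp only [box, Set.mem_ofPred_eq, funext_iff, eq_comm]

theorem tsum_indicator_box (x : Fin d → ℝ) :
    ∑' z, (box d z).indicator (1 : (Fin d → ℝ) → ℝ≥0∞) x = 1 := by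
  rw [tsum_eq_single (fun i => ⌊x i⌋)]
  · rw [Set.indicator_of_mem (mem_box_iff.2 rfl), Pi.one_apply]
  · intro z hz
    exact Set.indicator_of_notMem (fun h => hz (mem_box_iff.1 h)) _

/-- The number of pairs `(x, y)` related by `R` with `x` in `A` and `y` in `B`. -/
noncomputable def mass (R : SimpleConfig d M → (Fin d → ℝ) × M → (Fin d → ℝ) × M → Prop)
    (A B : Set (Fin d → ℝ)) (ξ : SimpleConfig d M) : ℝ≥0∞ :=
  ∑' x : ξ.1.carrier, ∑' y : ξ.1.carrier,
    A.indicator 1 x.1.1 * B.indicator 1 y.1.1 * {y | R ξ x y}.indicator 1 y.1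

variable {R : SimpleConfig d M → (Fin d → ℝ) × M → (Fin d → ℝ) × M → Prop}

theorem mass_translate (hinv : ∀ ξ t x y, R (ξ.translate t) (shift t x) (shift t y) ↔ R ξ x y)
    (w z z' : Fin d → ℤ) (ξ : SimpleConfig d M) :
    mass R (box d z) (box d z') (ξ.translate fun i => (w i : ℝ)) =
      mass R (box d (z - w)) (box d (z' - w)) ξ := by
  set t : Fin d → ℝ := fun i => (w i : ℝ) with ht
  have hind : ∀ (z : Fin d → ℤ) (x : (Fin d → ℝ) × M),
      (box d z).indicator (1 : (Fin d → ℝ) → ℝ≥0∞)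
      (shift t x).1 = (box d (z - w)).indicator 1 x.1 := by
    intro z x
    have hiff : (shift t x).1 ∈ box d z ↔ x.1 ∈ box d (z - w) := add_mem_box_iff
    by_cases h : x.1 ∈ box d (z - w)
    · rw [Set.indicator_of_mem h, Set.indicator_of_mem (hiff.2 h)]; rfl
    · rw [Set.indicator_of_notMem h, Set.indicator_of_notMem (mt hiff.1 h)]
  rw [mass, mass]
  refine (tsum_translate ξ.1 t fun x => ∑' y : (ξ.1.translate t).carrier,
    (box d z).indicator 1 x.1 * (box d z').indicator 1 y.1.1 *
      {y | R (ξ.translate t) x y}.indicator 1 y.1).trans (tsum_congr fun x => ?_)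
  refine (tsum_translate ξ.1 t fun y => (box d z).indicator 1 (shift t x.1).1 *
    (box d z').indicator 1 y.1 * {y | R (ξ.translate t) (shift t x) y}.indicator 1 y).trans
      (tsum_congr fun y => ?_)
  rw [hind, hind]
  congr 1
  by_cases h : R ξ x y
  · rw [Set.indicator_of_mem (show y.1 ∈ {y | R ξ x y} from h),
      Set.indicator_of_mem (show shift t y.1 ∈ {y | R _ _ y} from (hinv ξ t x y).2 h)]; rfl
  · rw [Set.indicator_of_notMem (show y.1 ∉ {y | R ξ x y} from h),
      Set.indicator_of_notMem (show shift t y.1 ∉ {y | R _ _ y} from mt (hinv ξ t x y).1 h)]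

/-- The boxes partition space, so summing over the box of the target leaves the total mass sent out
of `A`. The companion identity below gives the mass received. -/
theorem tsum_mass_box_right (A : Set (Fin d → ℝ)) (ξ : SimpleConfig d M) :
    ∑' z, mass R A (box d z) ξ = ∑' x : ξ.1.carrier, A.indicator 1 x.1.1 *
      ({y ∈ ξ.1.carrier | R ξ x y}.encard : ℝ≥0∞) := by
  simp only [mass]
  rw [ENNReal.tsum_comm]
  refine tsum_congr fun x => ?_
  rw [ENNReal.tsum_comm, ← tsum_indicator_one_eq_encard, ← ENNReal.tsum_mul_left]
  refine tsum_congr fun y => ?_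
  rw [ENNReal.tsum_mul_right, ENNReal.tsum_mul_left, tsum_indicator_box, mul_one]

theorem tsum_mass_box_left (B : Set (Fin d → ℝ)) (ξ : SimpleConfig d M) :
    ∑' z, mass R (box d z) B ξ = ∑' y : ξ.1.carrier, B.indicator 1 y.1.1 *
      ({x ∈ ξ.1.carrier | R ξ x y}.encard : ℝ≥0∞) := by
  simp only [mass]
  rw [ENNReal.tsum_comm]
  refine (tsum_congr fun x => ENNReal.tsum_comm).trans ?_
  rw [ENNReal.tsum_comm]
  refine tsum_congr fun y => ?_
  rw [← tsum_indicator_one_eq_encard, ← ENNReal.tsum_mul_left]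
  refine tsum_congr fun x => ?_
  rw [ENNReal.tsum_mul_right, ENNReal.tsum_mul_right, tsum_indicator_box, one_mul]
  rfl

variable [MeasurableSpace M]

/-- On the points of the configuration, the relation agrees with a measurable one. -/
def MeasurableRel (R : SimpleConfig d M → (Fin d → ℝ) × M → (Fin d → ℝ) × M → Prop) : Prop :=
  ∃ R' : SimpleConfig d M → (Fin d → ℝ) × M → (Fin d → ℝ) × M → Prop, MeasurableSet
    {q : SimpleConfig d M × ((Fin d → ℝ) × M) × ((Fin d → ℝ) × M) | R' q.1 q.2.1 q.2.2} ∧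
      ∀ ξ, ∀ x ∈ ξ.1.carrier, ∀ y ∈ ξ.1.carrier, (R ξ x y ↔ R' ξ x y)

variable [Nonempty M]

theorem measurable_mass (hR : MeasurableRel R) {A B : Set (Fin d → ℝ)} (hA : MeasurableSet A) (hB : MeasurableSet B) :
    Measurable (mass R A B) := by
  obtain ⟨R', hR', hRR'⟩ := hR
  have hmass : mass R A B = mass R' A B := by
    funext ξ
    refine tsum_congr fun x => tsum_congr fun y => ?_
    have h := hRR' ξ x x.2 y y.2
    congr 1
    by_cases h' : R ξ x y
    · rw [Set.indicator_of_mem (show y.1 ∈ {y | R ξ x y} from h'),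
        Set.indicator_of_mem (show y.1 ∈ {y | R' ξ x y} from h.1 h')]
    · rw [Set.indicator_of_notMem (show y.1 ∉ {y | R ξ x y} from h'),
        Set.indicator_of_notMem (show y.1 ∉ {y | R' ξ x y} from mt h.2 h')]
  rw [hmass]
  refine MarkedConfig.measurable_tsum measurable_subtype_coe (fun ξ => ξ.2)
    (g := fun ξ x => ∑' y : ξ.1.carrier,
      A.indicator 1 x.1 * B.indicator 1 y.1.1 * {y | R' ξ x y}.indicator 1 y.1) ?_
  refine MarkedConfig.measurable_tsum (Ω := SimpleConfig d M × ((Fin d → ℝ) × M))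
    (X := fun q => q.1.1) (measurable_subtype_coe.comp measurable_fst) (fun q => q.1.2)
    (g := fun q y => A.indicator 1 q.2.1 * B.indicator 1 y.1 *
      {y | R' q.1 q.2 y}.indicator 1 y) ?_
  refine Measurable.mul (Measurable.mul ?_ ?_) ?_
  · exact (measurable_one.indicator hA).comp (measurable_fst.comp
      (measurable_snd.comp measurable_fst))
  · exact (measurable_one.indicator hB).comp (measurable_fst.comp measurable_snd)
  · exact (measurable_one (α := ℝ≥0∞)).indicator (f := 1)
      (s := {q : (SimpleConfig d M × ((Fin d → ℝ) × M)) × ((Fin d → ℝ) × M) |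
        R' q.1.1 q.1.2 q.2})
      (hR'.preimage ((measurable_fst.comp measurable_fst).prodMk
        ((measurable_snd.comp measurable_fst).prodMk measurable_snd)))

/-- Mass transport: if each point of a stationary process of finite intensity is related to a
bounded number of points, then each point is related from only finitely many points. -/
theorem finite_in_of_encard_out_le {P : Measure (SimpleConfig d M)}
    (hP : ∀ t : Fin d → ℝ, P.map (SimpleConfig.translate t) = P)
    (hint : ∫⁻ ξ, (ξ.1.posCount (box d 0) : ℝ≥0∞) ∂P ≠ ∞)
    (hR : MeasurableRel R)
    (hinv : ∀ ξ t x y, R (ξ.translate t) (shift t x) (shift t y) ↔ R ξ x y) {K : ℕ}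
    (hout : ∀ᵐ ξ ∂P, ∀ x ∈ ξ.1.carrier, {y ∈ ξ.1.carrier | R ξ x y}.encard ≤ K) :
    ∀ᵐ ξ ∂P, ∀ y ∈ ξ.1.carrier, {x ∈ ξ.1.carrier | R ξ x y}.Finite := by
  have hmeas := fun z z' => measurable_mass hR (measurableSet_box (d := d) z)
    (measurableSet_box (d := d) z')
  -- Stationarity turns the expected mass from box z into box 0 into that from box 0 into box -z.
  have hshift : ∀ z : Fin d → ℤ, ∫⁻ ξ, mass R (box d z) (box d 0) ξ ∂P =
      ∫⁻ ξ, mass R (box d 0) (box d (-z)) ξ ∂P := by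
    intro z
    conv_lhs => rw [← hP fun i => (z i : ℝ)]
    rw [lintegral_map (hmeas _ _) (SimpleConfig.measurable_translate _)]
    simp_rw [mass_translate hinv, sub_self, zero_sub]
  -- Summed over z, the expected mass received by the unit box equals the expected mass it sends,
  -- which is at most `K` times the intensity.
  have hfin : ∫⁻ ξ, ∑' z, mass R (box d z) (box d 0) ξ ∂P ≠ ∞ := by
    rw [lintegral_tsum fun z => (hmeas _ _).aemeasurable]
    simp_rw [hshift]
    rw [show ∑' z : Fin d → ℤ, ∫⁻ ξ, mass R (box d 0) (box d (-z)) ξ ∂P =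
        ∑' z, ∫⁻ ξ, mass R (box d 0) (box d z) ξ ∂P from
        (Equiv.neg (Fin d → ℤ)).tsum_eq fun z => ∫⁻ ξ, mass R (box d 0) (box d z) ξ ∂P,
      ← lintegral_tsum fun z => (hmeas _ _).aemeasurable]
    refine ne_top_of_le_ne_top (ENNReal.mul_ne_top (ENNReal.natCast_ne_top K) hint) ?_
    rw [← lintegral_const_mul' _ _ (ENNReal.natCast_ne_top K)]
    refine lintegral_mono_ae ?_
    filter_upwards [hout] with ξ hξ
    rw [tsum_mass_box_right, mul_comm]
    have hc : (ξ.1.posCount (box d 0) : ℝ≥0∞) =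
        ∑' x : ξ.1.carrier, (box d 0).indicator 1 x.1.1 :=
      (tsum_indicator_one_eq_encard ξ.1.carrier fun p => p.1 ∈ box d 0).symm
    rw [hc, ← ENNReal.tsum_mul_right]
    refine ENNReal.tsum_le_tsum fun x => mul_le_mul_right ?_ _
    have := ENat.toENNReal_le.2 (hξ x x.2)
    simpa using this
  have hbox : ∀ᵐ ξ ∂P, ∀ y ∈ ξ.1.carrier, y.1 ∈ box d 0 →
      {x ∈ ξ.1.carrier | R ξ x y}.Finite := by
    filter_upwards [ae_lt_top (Measurable.tsum fun z => hmeas z 0) hfin] with ξ hξ y hy hyb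
    rw [tsum_mass_box_left] at hξ
    have h1 := (ENNReal.le_tsum (f := fun y : ξ.1.carrier => (box d 0).indicator 1 y.1.1 *
      ({x ∈ ξ.1.carrier | R ξ x y}.encard : ℝ≥0∞)) ⟨y, hy⟩).trans_lt hξ
    simp only [Set.indicator_of_mem hyb, Pi.one_apply, one_mul] at h1
    exact Set.encard_lt_top_iff.1 (ENat.toENNReal_lt_top.1 h1)
  -- Countably many integer translations bring every point into the box at the origin.
  have hall : ∀ᵐ ξ ∂P, ∀ w : Fin d → ℤ, ∀ y ∈ (ξ.1.translate fun i => (w i : ℝ)).carrier,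
      y.1 ∈ box d 0 → {x ∈ (ξ.1.translate fun i => (w i : ℝ)).carrier |
        R (ξ.translate fun i => (w i : ℝ)) x y}.Finite := by
    rw [ae_all_iff]
    intro w
    rw [← hP fun i => (w i : ℝ)] at hbox
    exact ae_of_ae_map (SimpleConfig.measurable_translate _).aemeasurable hbox
  filter_upwards [hall] with ξ hξ y hy
  have h := hξ (fun i => -⌊y.1 i⌋) (shift _ y) (shift_mem_translate.2 hy)
    (add_mem_box_iff.2 (mem_box_iff.2 (by ext i; simp)))
  refine Set.Finite.of_finite_image (f := shift fun i => ((-⌊y.1 i⌋ : ℤ) : ℝ)) (h.subset ?_)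
    (shift_injective _).injOn
  rintro _ ⟨x, ⟨hx, hxy⟩, rfl⟩
  exact ⟨shift_mem_translate.2 hx, (hinv _ _ _ _).2 hxy⟩

end MassTransport

/-! ### Transport of rankings along a bijection -/

section Iso

variable {P : Type*} {lt : P → P → P → Prop} (e : P ≃ P)

/-- With e a translation, the lemmas of this section give the translation invariance that mass
transport asks of a relation. -/
theorem before_image (he : ∀ v u w, lt (e v) (e u) (e w) ↔ lt v u w) (S : Set P) (v w : P) :
    before lt (e '' S) (e v) (e w) = e '' before lt S v w := by
  ext u
  constructor
  · rintro ⟨⟨u, hu, rfl⟩, hne, hlt⟩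
    exact ⟨u, ⟨hu, fun h => hne (h ▸ rfl), (he _ _ _).1 hlt⟩, rfl⟩
  · rintro ⟨u, ⟨hu, hne, hlt⟩, rfl⟩
    exact ⟨⟨u, hu, rfl⟩, fun h => hne (e.injective h), (he _ _ _).2 hlt⟩

/-- A bijection that preserves the ranking is a graph isomorphism. -/
def nnGraphIso (he : ∀ v u w, lt (e v) (e u) (e w) ↔ lt v u w) (S : Set P) :
    nnGraph lt S ≃g nnGraph lt (e '' S) where
  toEquiv := e
  map_rel_iff' := by
    intro v w
    change _ ∧ _ ∧ _ ∧ _ ∧ _ ↔ _ ∧ _ ∧ _ ∧ _ ∧ _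
    rw [before_image e he, before_image e he, e.injective.encard_image, e.injective.encard_image,
      e.injective.mem_set_image, e.injective.mem_set_image, e.injective.ne_iff]

theorem reachable_image_iff (he : ∀ v u w, lt (e v) (e u) (e w) ↔ lt v u w) (S : Set P) (v w : P) :
    (nnGraph lt (e '' S)).Reachable (e v) (e w) ↔ (nnGraph lt S).Reachable v w :=
  SimpleGraph.Iso.reachable_iff (φ := nnGraphIso e he S)

theorem isEndpoint_image_iff (he : ∀ v u w, lt (e v) (e u) (e w) ↔ lt v u w) (S : Set P) (v : P) :
    IsEndpoint (nnGraph lt (e '' S)) (e v) ↔ IsEndpoint (nnGraph lt S) v := by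
  have hadj : ∀ x y, (nnGraph lt (e '' S)).Adj (e x) (e y) ↔ (nnGraph lt S).Adj x y :=
    fun x y => (nnGraphIso e he S).map_rel_iff'
  rw [IsEndpoint, IsEndpoint, e.surjective.forall₂]
  simp only [hadj, e.injective.eq_iff]

theorem mem_infSet_image_iff (he : ∀ v u w, lt (e v) (e u) (e w) ↔ lt v u w) (S : Set P) (v : P) :
    e v ∈ infSet lt (e '' S) ↔ v ∈ infSet lt S := by
  have : cluster (nnGraph lt (e '' S)) (e v) = e '' cluster (nnGraph lt S) v := by
    ext w
    obtain ⟨w, rfl⟩ := e.surjective w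
    rw [e.injective.mem_set_image]
    exact reachable_image_iff e he S v w
  rw [infSet, infSet, Set.mem_ofPred_eq, Set.mem_ofPred_eq, this,
    Set.infinite_image_iff e.injective.injOn]

theorem ranks_image_iff (he : ∀ v u w, lt (e v) (e u) (e w) ↔ lt v u w) (S : Set P) (v w : P) :
    Ranks lt (e '' S) (e v) (e w) ↔ Ranks lt S v w := by
  rw [Ranks, Ranks, mem_infSet_image_iff e he, mem_infSet_image_iff e he, before_image e he,
    e.injective.mem_set_image, Set.finite_image_iff e.injective.injOn]

end Iso

/-- `y` can be reached from `x` in `n` steps. -/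
def StepsTo {V : Type*} (G : SimpleGraph V) : ℕ → V → V → Prop
  | 0, x, y => x = y
  | n + 1, x, y => ∃ z, StepsTo G n x z ∧ G.Adj z y

/-- Exhibits reachability as a countable union of relations, each obtained by quantifying over one
intermediate point; this is what makes it measurable. -/
theorem reachable_iff_exists_stepsTo {V : Type*} {G : SimpleGraph V} {x y : V} :
    G.Reachable x y ↔ ∃ n, StepsTo G n x y := by
  constructor
  · intro h
    rw [SimpleGraph.reachable_iff_reflTransGen] at h
    induction h with
    | refl => exact ⟨0, rfl⟩
    | tail _ hab ih =>
      obtain ⟨n, hn⟩ := ih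
      exact ⟨n + 1, _, hn, hab⟩
  · rintro ⟨n, hn⟩
    induction n generalizing y with
    | zero => exact hn ▸ SimpleGraph.Reachable.refl _
    | succ n ih =>
      obtain ⟨z, hz, hzy⟩ := hn
      exact (ih hz).trans hzy.reachable

/-! ### The ranking of an ordering function -/

section FCloser

variable {d : ℕ} {M : Type*} {ν : Seminorm ℝ (Fin d → ℝ)} {f : ℝ≥0 → M → ℝ≥0}

theorem continuous_seminorm (ν : Seminorm ℝ (Fin d → ℝ)) : Continuous ν :=
  continuousOn_univ.1 (ν.convexOn.continuousOn isOpen_univ)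

theorem MarkedConfig.Nonequidistant.simple {ξ : MarkedConfig d M} (h : ξ.Nonequidistant ν) :
    ξ.Simple :=
  fun a ha b hb hab => h.2 a ha b hb (congrArg ν hab)

theorem FCloser.trans' {v a b c : (Fin d → ℝ) × M} (h1 : FCloser ν f v a b)
    (h2 : FCloser ν f v b c) : FCloser ν f v a c := by
  rcases h1 with h1 | ⟨h1, h1'⟩ <;> rcases h2 with h2 | ⟨h2, h2'⟩
  · exact Or.inl (h1.trans h2)
  · exact Or.inl (h2 ▸ h1)
  · exact Or.inl (h1 ▸ h2)
  · exact Or.inr ⟨h1.trans h2, h1'.trans h2'⟩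

/-- Nonequidistance, applied to the pairs {a, v} and {b, v}, shows that two other points are never
equally far from v, so the distance breaks every tie in the value of `f`. -/
theorem isRanking_fCloser (hν : ∀ x, ν x = 0 → x = 0) {ξ : MarkedConfig d M}
    (hξ : ξ.Nonequidistant ν) : IsRanking (FCloser ν f) ξ.carrier where
  irrefl v u h := by rcases h with h | ⟨_, h⟩ <;> exact lt_irrefl _ h
  trans v a b c := FCloser.trans'
  total v hv a ha b hb hav hbv hab := by
    have hne : ν (a.1 - v.1) ≠ ν (b.1 - v.1) := by
      intro h
      have hpos : 0 < ν (a.1 - v.1) := by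
        refine lt_of_le_of_ne (apply_nonneg _ _) fun h0 => hav (hξ.simple ha hv ?_)
        exact sub_eq_zero.1 (hν _ h0.symm)
      have hmem : a ∈ ({b, v} : Set ((Fin d → ℝ) × M)) :=
        hξ.1 a ha v hv b hb v hv h hpos ▸ Or.inl rfl
      rcases hmem with h | h
      · exact hab h
      · exact hav h
    rcases lt_trichotomy (f (ν (a.1 - v.1)).toNNReal a.2) (f (ν (b.1 - v.1)).toNNReal b.2) with
      h | h | h
    · exact Or.inl (Or.inl h)
    · rcases hne.lt_or_gt with h' | h'
      · exact Or.inl (Or.inr ⟨h, h'⟩)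
      · exact Or.inr (Or.inr ⟨h.symm, h'⟩)
    · exact Or.inr (Or.inl h)

theorem fCloser_shift (t : Fin d → ℝ) (v u w : (Fin d → ℝ) × M) :
    FCloser ν f (shift t v) (shift t u) (shift t w) ↔ FCloser ν f v u w := by
  simp only [FCloser, shift, add_sub_add_right_eq_sub]

/-- Translation as a bijection of marked points. -/
def shiftEquiv (t : Fin d → ℝ) : (Fin d → ℝ) × M ≃ (Fin d → ℝ) × M :=
  (Equiv.addRight t).prodCongr (Equiv.refl M)

/-- The passage from a graph on the points of ξ to one on all marked points. In the latter form the
graphs before and after deletions share a vertex type. -/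
theorem adj_fkNNGraph_two {ξ : MarkedConfig d M} {v w : ξ.carrier}
    (h : (fkNNGraph ν f 2 ξ).Adj v w) : (nnGraph (FCloser ν f) ξ.carrier).Adj v w := by
  have key : ∀ v w, IsAmongNN ν f ξ 2 v w → (before (FCloser ν f) ξ.carrier v w).encard ≤ 1 := by
    rintro v w ⟨n, -, hn, -, -, hc⟩
    have h2 : (before (FCloser ν f) ξ.carrier v w).encard + 1 ≤ 1 + 1 := by
      refine hc.le.trans ?_
      rw [one_add_one_eq_two]
      exact_mod_cast hn
    exact (ENat.add_le_add_iff_right ENat.one_ne_top).1 h2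
  exact ⟨v.2, w.2, fun h' => h.ne (Subtype.ext h'), key v w h.1, key w v h.2⟩

theorem exists_mem_infSet_of_percolates {ξ : MarkedConfig d M}
    (h : Percolates (fkNNGraph ν f 2 ξ)) : ∃ v ∈ ξ.carrier, v ∈ infSet (FCloser ν f) ξ.carrier := by
  obtain ⟨C, hC⟩ := h
  obtain ⟨v, rfl⟩ := C.exists_rep
  refine ⟨v, v.2, ((hC.image Subtype.val_injective.injOn)).mono ?_⟩
  rintro _ ⟨w, hw, rfl⟩
  have hr : (fkNNGraph ν f 2 ξ).Reachable v w := (SimpleGraph.ConnectedComponent.exact hw).symm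
  exact hr.map (⟨Subtype.val, adj_fkNNGraph_two⟩ :
    fkNNGraph ν f 2 ξ →g nnGraph (FCloser ν f) ξ.carrier)

end FCloser

/-! ### Measurability of graph properties -/

section MeasurableRel

variable {d : ℕ} {M : Type*} [MeasurableSpace M]

theorem measurable_encard [Nonempty M] {Ω : Type*} [MeasurableSpace Ω]
    {X : Ω → MarkedConfig d M} (hX : Measurable X) (hs : ∀ ω, (X ω).Simple)
    {p : Ω → (Fin d → ℝ) × M → Prop}
    (hp : MeasurableSet {q : Ω × ((Fin d → ℝ) × M) | p q.1 q.2}) :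
    Measurable fun ω => ({u ∈ (X ω).carrier | p ω u}.encard : ℝ≥0∞) := by
  simp_rw [← tsum_indicator_one_eq_encard]
  refine MarkedConfig.measurable_tsum hX hs (g := fun ω => {u | p ω u}.indicator 1) ?_
  exact (measurable_one (α := ℝ≥0∞)).indicator (f := 1) hp

namespace MeasurableRel

variable {R T : SimpleConfig d M → (Fin d → ℝ) × M → (Fin d → ℝ) × M → Prop}

theorem congr (hR : MeasurableRel R) (h : ∀ ξ, ∀ x ∈ ξ.1.carrier, ∀ y ∈ ξ.1.carrier,
    (T ξ x y ↔ R ξ x y)) : MeasurableRel T := by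
  obtain ⟨R', h1, h2⟩ := hR
  exact ⟨R', h1, fun ξ x hx y hy => (h ξ x hx y hy).trans (h2 ξ x hx y hy)⟩

theorem and (hR : MeasurableRel R) (hT : MeasurableRel T) :
    MeasurableRel fun ξ x y => R ξ x y ∧ T ξ x y := by
  obtain ⟨R', h1, h2⟩ := hR
  obtain ⟨T', h3, h4⟩ := hT
  exact ⟨fun ξ x y => R' ξ x y ∧ T' ξ x y, h1.inter h3,
    fun ξ x hx y hy => and_congr (h2 ξ x hx y hy) (h4 ξ x hx y hy)⟩

theorem not (hR : MeasurableRel R) : MeasurableRel fun ξ x y => ¬ R ξ x y := by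
  obtain ⟨R', h1, h2⟩ := hR
  exact ⟨fun ξ x y => ¬ R' ξ x y, h1.compl, fun ξ x hx y hy => not_congr (h2 ξ x hx y hy)⟩

theorem iUnion {R : ℕ → SimpleConfig d M → (Fin d → ℝ) × M → (Fin d → ℝ) × M → Prop}
    (hR : ∀ n, MeasurableRel (R n)) : MeasurableRel fun ξ x y => ∃ n, R n ξ x y := by
  choose R' h1 h2 using hR
  refine ⟨fun ξ x y => ∃ n, R' n ξ x y, ?_,
    fun ξ x hx y hy => exists_congr fun n => h2 n ξ x hx y hy⟩
  simp_rw [Set.ofPred_exists]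
  exact MeasurableSet.iUnion h1

theorem swap (hR : MeasurableRel R) : MeasurableRel fun ξ x y => R ξ y x := by
  obtain ⟨R', h1, h2⟩ := hR
  exact ⟨fun ξ x y => R' ξ y x, h1.preimage (measurable_fst.prodMk
    ((measurable_snd.comp measurable_snd).prodMk (measurable_fst.comp measurable_snd))),
    fun ξ x hx y hy => h2 ξ y hy x hx⟩

/-- The diagonal of `M` need not be measurable. Points of a simple configuration differ exactly if
their positions do, and this is a measurable condition; hence `MeasurableRel` demands agreement on
points only. -/
theorem ne : MeasurableRel fun (_ : SimpleConfig d M) x y => x ≠ y := by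
  refine ⟨fun _ x y => x.1 ≠ y.1, ?_, fun ξ x hx y hy => (ξ.2.ne_iff hx hy).symm⟩
  exact (measurableSet_eq_fun (measurable_fst.comp (measurable_fst.comp measurable_snd))
    (measurable_fst.comp (measurable_snd.comp measurable_snd))).compl

variable [Nonempty M]

theorem exists_mem (hR : MeasurableRel R) (hT : MeasurableRel T) :
    MeasurableRel fun ξ x y => ∃ z ∈ ξ.1.carrier, R ξ x z ∧ T ξ z y := by
  obtain ⟨R', h1, h2⟩ := hR
  obtain ⟨T', h3, h4⟩ := hT
  refine ⟨fun ξ x y => ∃ z ∈ ξ.1.carrier, R' ξ x z ∧ T' ξ z y, ?_, fun ξ x hx y hy =>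
    exists_congr fun z => and_congr_right fun hz => and_congr (h2 ξ x hx z hz) (h4 ξ z hz y hy)⟩
  refine MarkedConfig.measurableSet_exists
    (Ω := SimpleConfig d M × ((Fin d → ℝ) × M) × ((Fin d → ℝ) × M)) (X := fun q => q.1.1)
    (measurable_subtype_coe.comp measurable_fst) (fun q => q.1.2)
    (p := fun q z => R' q.1 q.2.1 z ∧ T' q.1 z q.2.2) (MeasurableSet.inter ?_ ?_)
  · exact h1.preimage ((measurable_fst.comp measurable_fst).prodMk
      ((measurable_fst.comp (measurable_snd.comp measurable_fst)).prodMk measurable_snd))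
  · exact h3.preimage ((measurable_fst.comp measurable_fst).prodMk
      (measurable_snd.prodMk (measurable_snd.comp (measurable_snd.comp measurable_fst))))

theorem infinite (hR : MeasurableRel R) :
    MeasurableRel fun ξ x _ => {z ∈ ξ.1.carrier | R ξ x z}.Infinite := by
  obtain ⟨R', h1, h2⟩ := hR
  refine ⟨fun ξ x _ => ({z ∈ ξ.1.carrier | R' ξ x z}.encard : ℝ≥0∞) = ∞, ?_, ?_⟩
  · refine measurable_encard (Ω := SimpleConfig d M × ((Fin d → ℝ) × M) × ((Fin d → ℝ) × M))
      (X := fun q => q.1.1) (p := fun q z => R' q.1 q.2.1 z)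
      (measurable_subtype_coe.comp measurable_fst) (fun q => q.1.2) ?_ (measurableSet_singleton ∞)
    exact h1.preimage ((measurable_fst.comp measurable_fst).prodMk
      ((measurable_fst.comp (measurable_snd.comp measurable_fst)).prodMk measurable_snd))
  · intro ξ x hx y hy
    beta_reduce
    rw [ENat.toENNReal_eq_top, Set.encard_eq_top_iff]
    have : {z ∈ ξ.1.carrier | R ξ x z} = {z ∈ ξ.1.carrier | R' ξ x z} :=
      Set.ext fun z => and_congr_right fun hz => h2 ξ x hx z hz
    rw [this]

end MeasurableRel

variable {ν : Seminorm ℝ (Fin d → ℝ)} {f : ℝ≥0 → M → ℝ≥0}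

theorem measurableSet_fCloser (ν : Seminorm ℝ (Fin d → ℝ))
    (hf : Measurable fun p : ℝ≥0 × M => f p.1 p.2) :
    MeasurableSet {q : ((Fin d → ℝ) × M) × ((Fin d → ℝ) × M) × ((Fin d → ℝ) × M) |
      FCloser ν f q.1 q.2.1 q.2.2} := by
  have hν : Measurable ν := (continuous_seminorm ν).measurable
  have h1 : Measurable fun q : ((Fin d → ℝ) × M) × ((Fin d → ℝ) × M) × ((Fin d → ℝ) × M) =>
      ν (q.2.1.1 - q.1.1) := hν.comp (by fun_prop)
  have h2 : Measurable fun q : ((Fin d → ℝ) × M) × ((Fin d → ℝ) × M) × ((Fin d → ℝ) × M) =>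
      ν (q.2.2.1 - q.1.1) := hν.comp (by fun_prop)
  have h3 : Measurable fun q : ((Fin d → ℝ) × M) × ((Fin d → ℝ) × M) × ((Fin d → ℝ) × M) =>
      f (ν (q.2.1.1 - q.1.1)).toNNReal q.2.1.2 :=
    hf.comp (h1.real_toNNReal.prodMk (by fun_prop))
  have h4 : Measurable fun q : ((Fin d → ℝ) × M) × ((Fin d → ℝ) × M) × ((Fin d → ℝ) × M) =>
      f (ν (q.2.2.1 - q.1.1)).toNNReal q.2.2.2 :=
    hf.comp (h2.real_toNNReal.prodMk (by fun_prop))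
  exact (measurableSet_lt h3 h4).union ((measurableSet_eq_fun h3 h4).inter
    (measurableSet_lt h1 h2))

variable [Nonempty M]

theorem measurable_encard_before (ν : Seminorm ℝ (Fin d → ℝ))
    (hf : Measurable fun p : ℝ≥0 × M => f p.1 p.2) {s : Set ℝ≥0∞} (hs : MeasurableSet s) :
    MeasurableRel fun ξ x y => ((before (FCloser ν f) ξ.1.carrier x y).encard : ℝ≥0∞) ∈ s := by
  refine ⟨fun ξ x y => ({u ∈ ξ.1.carrier | u.1 ≠ x.1 ∧ FCloser ν f x u y}.encard : ℝ≥0∞) ∈ s,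
    ?_, ?_⟩
  · refine measurable_encard (Ω := SimpleConfig d M × ((Fin d → ℝ) × M) × ((Fin d → ℝ) × M))
      (X := fun q => q.1.1) (p := fun q u => u.1 ≠ q.2.1.1 ∧ FCloser ν f q.2.1 u q.2.2)
      (measurable_subtype_coe.comp measurable_fst) (fun q => q.1.2) (MeasurableSet.inter ?_ ?_) hs
    · exact (measurableSet_eq_fun (by fun_prop) (by fun_prop)).compl
    · exact (measurableSet_fCloser ν hf).preimage
        ((measurable_fst.comp (measurable_snd.comp measurable_fst)).prodMk
        (measurable_snd.prodMk (measurable_snd.comp (measurable_snd.comp measurable_fst))))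
  · intro ξ x hx y hy
    have : before (FCloser ν f) ξ.1.carrier x y =
        {u ∈ ξ.1.carrier | u.1 ≠ x.1 ∧ FCloser ν f x u y} :=
      Set.ext fun u => and_congr_right fun hu => and_congr_left fun _ => (ξ.2.ne_iff hu hx).symm
    beta_reduce
    rw [this]

theorem measurableRel_adj (ν : Seminorm ℝ (Fin d → ℝ))
    (hf : Measurable fun p : ℝ≥0 × M => f p.1 p.2) :
    MeasurableRel fun ξ x y => (nnGraph (FCloser ν f) ξ.1.carrier).Adj x y := by
  have h := measurable_encard_before ν hf (measurableSet_Iic (a := 1))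
  refine (MeasurableRel.ne.and (h.and h.swap)).congr fun ξ x hx y hy => ?_
  change _ ∧ _ ∧ _ ∧ _ ∧ _ ↔ _ ∧ _ ∧ _
  simp only [hx, hy, true_and, Set.mem_Iic]
  rw [← ENat.toENNReal_le, ← ENat.toENNReal_le, ENat.toENNReal_one]

theorem measurableRel_reachable (ν : Seminorm ℝ (Fin d → ℝ))
    (hf : Measurable fun p : ℝ≥0 × M => f p.1 p.2) :
    MeasurableRel fun ξ x y => (nnGraph (FCloser ν f) ξ.1.carrier).Reachable x y := by
  have hstep : ∀ n, MeasurableRel fun ξ x y =>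
      StepsTo (nnGraph (FCloser ν f) ξ.1.carrier) n x y := by
    intro n
    induction n with
    | zero => exact MeasurableRel.ne.not.congr fun _ x _ y _ => not_not.symm
    | succ n ih =>
      refine (ih.exists_mem (measurableRel_adj ν hf)).congr fun ξ x hx y hy =>
        exists_congr fun z => ?_
      exact ⟨fun h => ⟨h.2.1, h⟩, fun h => h.2⟩
  exact (MeasurableRel.iUnion hstep).congr fun ξ x hx y hy => reachable_iff_exists_stepsTo

theorem measurableRel_isEndpoint (ν : Seminorm ℝ (Fin d → ℝ))
    (hf : Measurable fun p : ℝ≥0 × M => f p.1 p.2) :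
    MeasurableRel fun ξ _ y => IsEndpoint (nnGraph (FCloser ν f) ξ.1.carrier) y := by
  have hadj := measurableRel_adj ν hf
  obtain ⟨A, hA, hA'⟩ := hadj
  refine ⟨fun ξ _ y => ¬ ∃ a ∈ ξ.1.carrier, ∃ b ∈ ξ.1.carrier, a.1 ≠ b.1 ∧ A ξ y a ∧ A ξ y b,
    MeasurableSet.compl ?_, ?_⟩
  · refine MarkedConfig.measurableSet_exists
      (Ω := SimpleConfig d M × ((Fin d → ℝ) × M) × ((Fin d → ℝ) × M)) (X := fun q => q.1.1)
      (measurable_subtype_coe.comp measurable_fst) (fun q => q.1.2)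
      (p := fun q a => ∃ b ∈ q.1.1.carrier, a.1 ≠ b.1 ∧ A q.1 q.2.2 a ∧ A q.1 q.2.2 b) ?_
    refine MarkedConfig.measurableSet_exists
      (Ω := (SimpleConfig d M × ((Fin d → ℝ) × M) × ((Fin d → ℝ) × M)) × ((Fin d → ℝ) × M))
      (X := fun q => q.1.1.1)
      (measurable_subtype_coe.comp (measurable_fst.comp measurable_fst)) (fun q => q.1.1.2)
      (p := fun q b => q.2.1 ≠ b.1 ∧ A q.1.1 q.1.2.2 q.2 ∧ A q.1.1 q.1.2.2 b)
      (MeasurableSet.inter ?_ (MeasurableSet.inter ?_ ?_))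
    · exact (measurableSet_eq_fun (by fun_prop) (by fun_prop)).compl
    · exact hA.preimage (by fun_prop : Measurable
        fun q : ((SimpleConfig d M × ((Fin d → ℝ) × M) × ((Fin d → ℝ) × M)) × ((Fin d → ℝ) × M))
          × ((Fin d → ℝ) × M) => (q.1.1.1, q.1.1.2.2, q.1.2))
    · exact hA.preimage (by fun_prop : Measurable
        fun q : ((SimpleConfig d M × ((Fin d → ℝ) × M) × ((Fin d → ℝ) × M)) × ((Fin d → ℝ) × M))
          × ((Fin d → ℝ) × M) => (q.1.1.1, q.1.1.2.2, q.2))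
  · intro ξ x hx y hy
    constructor
    · rintro h ⟨a, ha, b, hb, hab, h1, h2⟩
      exact hab (congrArg Prod.fst (h a b ((hA' ξ y hy a ha).2 h1) ((hA' ξ y hy b hb).2 h2)))
    · intro h a b ha hb
      by_contra hab
      exact h ⟨a, ha.2.1, b, hb.2.1, (ξ.2.ne_iff ha.2.1 hb.2.1).2 hab,
        (hA' ξ y hy a ha.2.1).1 ha, (hA' ξ y hy b hb.2.1).1 hb⟩

theorem cluster_subset_carrier {P : Type*} {lt : P → P → P → Prop} {S : Set P} {v : P}
    (hv : v ∈ S) : cluster (nnGraph lt S) v ⊆ S :=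
  cluster_subset_of_closed hv fun _ _ _ h => h.2.1

theorem measurableRel_mem_infSet (ν : Seminorm ℝ (Fin d → ℝ))
    (hf : Measurable fun p : ℝ≥0 × M => f p.1 p.2) :
    MeasurableRel fun ξ x _ => x ∈ infSet (FCloser ν f) ξ.1.carrier := by
  refine (measurableRel_reachable ν hf).infinite.congr fun ξ x hx y hy => ?_
  have : {z ∈ ξ.1.carrier | (nnGraph (FCloser ν f) ξ.1.carrier).Reachable x z} =
      cluster (nnGraph (FCloser ν f) ξ.1.carrier) x :=
    Set.ext fun z => ⟨fun h => h.2, fun h => ⟨cluster_subset_carrier hx h, h⟩⟩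
  rw [this]
  rfl

theorem measurableRel_ranks (ν : Seminorm ℝ (Fin d → ℝ))
    (hf : Measurable fun p : ℝ≥0 × M => f p.1 p.2) :
    MeasurableRel fun ξ x y => Ranks (FCloser ν f) ξ.1.carrier x y := by
  have h1 := measurableRel_mem_infSet ν hf
  have h2 := measurable_encard_before ν hf (measurableSet_Iio (a := ∞))
  refine (h1.and (h1.swap.not.and h2)).congr fun ξ x hx y hy => ?_
  rw [Ranks, Set.mem_Iio, ENat.toENNReal_lt_top, Set.encard_lt_top_iff]
  simp [hy]

end MeasurableRel

/-! ### Stationary deletion-tolerant processes -/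

section Main

variable {d : ℕ} {M : Type*}

instance : Inhabited (SimpleConfig d M) :=
  ⟨⟨⟨∅, fun _ _ => by simp⟩, fun _ h => h.elim⟩⟩

/-- A configuration with a point removed. -/
noncomputable def SimpleConfig.erase (ξ : SimpleConfig d M) (z : (Fin d → ℝ) × M) :
    SimpleConfig d M :=
  ⟨ξ.1.erase z, ξ.2.erase z⟩

theorem posCount_mono (ξ : MarkedConfig d M) {A B : Set (Fin d → ℝ)} (h : A ⊆ B) :
    ξ.posCount A ≤ ξ.posCount B :=
  Set.encard_le_encard fun _ hp => ⟨hp.1, h hp.2⟩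

theorem box_zero_subset : box d 0 ⊆ Set.Icc 0 1 := by
  intro x hx
  constructor <;> intro i
  · exact Int.floor_nonneg.1 (hx i).ge
  · exact (Int.lt_floor_add_one (x i)).le.trans (by simp [hx i])

/-- The configurations `ξ` such that `p` holds for all configurations that arise from `ξ` by
deletion of at most `n` points, one after the other. -/
def DeletionStable (p : SimpleConfig d M → Prop) : ℕ → SimpleConfig d M → Prop
  | 0, ξ => p ξ
  | n + 1, ξ => DeletionStable p n ξ ∧ ∀ z ∈ ξ.1.carrier, DeletionStable p n (ξ.erase z)

/-- Induction on `F`, one deletion at a time; elements of `F` that are not points of the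
configuration cost nothing. Thus countably many almost sure statements control uncountably many sets
`F`. -/
theorem DeletionStable.of_finite {q : Set ((Fin d → ℝ) × M) → Prop}
    {F : Set ((Fin d → ℝ) × M)} (hF : F.Finite) {ξ : SimpleConfig d M}
    (h : ∀ n, DeletionStable (fun ξ => q ξ.1.carrier) n ξ) : q (ξ.1.carrier \ F) := by
  induction F, hF using Set.Finite.induction_on generalizing ξ with
  | empty => rw [Set.sdiff_empty]; exact h 0
  | @insert a F _ _ ih =>
    by_cases ha : a ∈ ξ.1.carrier
    · have := ih (ξ := ξ.erase a) fun n => (h (n + 1)).2 a ha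
      rwa [show (ξ.erase a).1.carrier = ξ.1.carrier \ {a} from rfl, Set.sdiff_sdiff,
        Set.singleton_union] at this
    · rw [Set.insert_eq, ← Set.sdiff_sdiff, Set.sdiff_singleton_eq_self ha]
      exact ih h

variable [MeasurableSpace M]

theorem SimpleConfig.measure_ext {P Q : Measure (SimpleConfig d M)}
    (h : P.map Subtype.val = Q.map Subtype.val) : P = Q := by
  ext A hA
  obtain ⟨B, hB, rfl⟩ := hA
  rw [← Measure.map_apply measurable_subtype_coe hB, h,
    Measure.map_apply measurable_subtype_coe hB]

theorem SimpleConfig.absolutelyContinuous_of_map {P Q : Measure (SimpleConfig d M)}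
    (h : P.map Subtype.val ≪ Q.map Subtype.val) : P ≪ Q := by
  refine Measure.AbsolutelyContinuous.mk fun A hA h0 => ?_
  obtain ⟨B, hB, rfl⟩ := hA
  rw [← Measure.map_apply measurable_subtype_coe hB] at h0 ⊢
  exact h h0

/-- The enumeration of points needs distinct positions everywhere. The exceptional set is enlarged
to a measurable null set, on which the empty configuration is substituted. -/
theorem exists_simple_version {Ω : Type*} [MeasurableSpace Ω] {μ : Measure Ω}
    {X : Ω → MarkedConfig d M} (hX : Measurable X) (hs : ∀ᵐ ω ∂μ, (X ω).Simple) :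
    ∃ Y : Ω → SimpleConfig d M, Measurable Y ∧ ∀ᵐ ω ∂μ, (Y ω).1 = X ω := by
  classical
  set N := toMeasurable μ {ω | ¬ (X ω).Simple} with hN
  have hN0 : μ N = 0 := (measure_toMeasurable _).trans hs
  have hNs : ∀ ω, ω ∉ N → (X ω).Simple := fun ω hω => by
    by_contra h
    exact hω (subset_toMeasurable _ _ h)
  refine ⟨fun ω => ⟨if ω ∈ N then (default : SimpleConfig d M).1 else X ω, ?_⟩, ?_, ?_⟩
  · split_ifs with h
    · exact (default : SimpleConfig d M).2
    · exact hNs ω h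
  · exact (Measurable.ite (measurableSet_toMeasurable _ _) measurable_const hX).subtype_mk
  · filter_upwards [measure_eq_zero_iff_ae_notMem.1 hN0] with ω hω
    exact if_neg hω

variable {P : Measure (SimpleConfig d M)}

theorem ae_deletionStable (hdel : ∀ p : SimpleConfig d M → Prop, (∀ᵐ ξ ∂P, p ξ) →
      ∀ᵐ ξ ∂P, ∀ z ∈ ξ.1.carrier, p (ξ.erase z)) {p : SimpleConfig d M → Prop}
    (hp : ∀ᵐ ξ ∂P, p ξ) : ∀ᵐ ξ ∂P, ∀ n, DeletionStable p n ξ := by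
  rw [ae_all_iff]
  intro n
  induction n with
  | zero => exact hp
  | succ n ih => exact ih.and (hdel _ ih)

variable [Nonempty M] {ν : Seminorm ℝ (Fin d → ℝ)} {f : ℝ≥0 → M → ℝ≥0}

/-- The first mass transport: each point sends mass to the at most two endpoints of its cluster, and
an endpoint of an infinite cluster would receive mass from all of it. -/
theorem ae_endpointFree (hf : IsOrderingFunction f)
    (hP : ∀ t : Fin d → ℝ, P.map (SimpleConfig.translate t) = P)
    (hint : ∫⁻ ξ, (ξ.1.posCount (box d 0) : ℝ≥0∞) ∂P ≠ ∞)
    (hrank : ∀ᵐ ξ ∂P, IsRanking (FCloser ν f) ξ.1.carrier) :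
    ∀ᵐ ξ ∂P, EndpointFree (FCloser ν f) ξ.1.carrier := by
  have h := finite_in_of_encard_out_le hP hint
    (R := fun ξ x y => (nnGraph (FCloser ν f) ξ.1.carrier).Reachable x y ∧
      IsEndpoint (nnGraph (FCloser ν f) ξ.1.carrier) y)
    ((measurableRel_reachable ν hf.1).and (measurableRel_isEndpoint ν hf.1))
    (fun ξ t x y => and_congr
      (reachable_image_iff (shiftEquiv t) (fCloser_shift t) ξ.1.carrier x y)
      (isEndpoint_image_iff (shiftEquiv t) (fCloser_shift t) ξ.1.carrier y))
    (K := 2) (by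
      filter_upwards [hrank] with ξ hξ x hx
      exact (Set.encard_le_encard fun y hy => hy.2).trans
        (encard_endpoints_le_two (maxDegTwo_nnGraph hξ) x))
  filter_upwards [h] with ξ hξ v hv
  by_contra hcon
  have hend : IsEndpoint (nnGraph (FCloser ν f) ξ.1.carrier) v := by
    intro a b ha hb
    by_contra hab
    exact hcon ⟨a, b, hab, ha, hb⟩
  have hmem := mem_of_mem_infSet hv
  refine hv ((hξ v hmem).subset fun w hw => ⟨cluster_subset_carrier hmem hw, ?_, hend⟩)
  exact SimpleGraph.Reachable.symm hw

/-- The law of a stationary simple process of finite intensity for which almost sure properties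
persist after the deletion of points is carried by configurations without infinite clusters. -/
theorem ae_infSet_eq_empty (hf : IsOrderingFunction f)
    (hP : ∀ t : Fin d → ℝ, P.map (SimpleConfig.translate t) = P)
    (hint : ∫⁻ ξ, (ξ.1.posCount (box d 0) : ℝ≥0∞) ∂P ≠ ∞)
    (hrank : ∀ᵐ ξ ∂P, IsRanking (FCloser ν f) ξ.1.carrier)
    (hdel : ∀ p : SimpleConfig d M → Prop, (∀ᵐ ξ ∂P, p ξ) →
      ∀ᵐ ξ ∂P, ∀ z ∈ ξ.1.carrier, p (ξ.erase z)) :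
    ∀ᵐ ξ ∂P, infSet (FCloser ν f) ξ.1.carrier = ∅ := by
  have hE : ∀ᵐ ξ ∂P, ∀ F : Set ((Fin d → ℝ) × M), F.Finite →
      EndpointFree (FCloser ν f) (ξ.1.carrier \ F) := by
    filter_upwards [ae_deletionStable hdel (ae_endpointFree hf hP hint hrank)] with ξ hξ F hF
    exact DeletionStable.of_finite hF hξ
  -- The second mass transport: a point sends mass to each vertex that ranks it.
  have h := finite_in_of_encard_out_le hP hint
    (R := fun ξ x y => Ranks (FCloser ν f) ξ.1.carrier y x)
    (measurableRel_ranks ν hf.1).swap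
    (fun ξ t x y => ranks_image_iff (shiftEquiv t) (fCloser_shift t) ξ.1.carrier y x)
    (K := 6) (by
      filter_upwards [hrank, hE] with ξ hξ hEξ x hx
      exact (Set.encard_le_encard fun y hy => hy.2).trans (encard_ranks_le_six hξ hEξ x))
  filter_upwards [h, hrank, hE] with ξ hξ hrξ hEξ
  rw [Set.eq_empty_iff_forall_notMem]
  intro v hv
  exact infinite_ranks hrξ hEξ hv ((hξ v (mem_of_mem_infSet hv)).subset
    fun w hw => ⟨hw.2.1, hw⟩)

/-- Allows the almost sure property to be transferred to the law. `FCloser` is always irreflexive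
and transitive, so only totality matters, and distinctness is again read off from positions. -/
theorem measurableSet_isRanking (ν : Seminorm ℝ (Fin d → ℝ))
    (hf : Measurable fun p : ℝ≥0 × M => f p.1 p.2) :
    MeasurableSet {ξ : SimpleConfig d M | IsRanking (FCloser ν f) ξ.1.carrier} := by
  have heq : {ξ : SimpleConfig d M | IsRanking (FCloser ν f) ξ.1.carrier} =
      {ξ | ∃ v ∈ ξ.1.carrier, ∃ a ∈ ξ.1.carrier, ∃ b ∈ ξ.1.carrier, (a.1 ≠ v.1 ∧ b.1 ≠ v.1 ∧
        a.1 ≠ b.1) ∧ ¬ FCloser ν f v a b ∧ ¬ FCloser ν f v b a}ᶜ := by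
    ext ξ
    constructor
    · rintro h ⟨v, hv, a, ha, b, hb, ⟨h1, h2, h3⟩, h4, h5⟩
      rcases h.total v hv a ha b hb (ne_of_apply_ne _ h1) (ne_of_apply_ne _ h2)
        (ne_of_apply_ne _ h3) with h | h
      · exact h4 h
      · exact h5 h
    · intro h
      refine ⟨fun v u h => ?_, fun v a b c => FCloser.trans', fun v hv a ha b hb h1 h2 h3 => ?_⟩
      · rcases h with h | ⟨_, h⟩ <;> exact lt_irrefl _ h
      · by_contra! hcon
        exact h ⟨v, hv, a, ha, b, hb, ⟨(ξ.2.ne_iff ha hv).2 h1, (ξ.2.ne_iff hb hv).2 h2,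
          (ξ.2.ne_iff ha hb).2 h3⟩, hcon⟩
  have hlt := measurableSet_fCloser ν hf
  rw [heq]
  refine (MarkedConfig.measurableSet_exists measurable_subtype_coe (fun ξ => ξ.2)
    (p := fun ξ v => ∃ a ∈ ξ.1.carrier, ∃ b ∈ ξ.1.carrier, (a.1 ≠ v.1 ∧ b.1 ≠ v.1 ∧
        a.1 ≠ b.1) ∧ ¬ FCloser ν f v a b ∧ ¬ FCloser ν f v b a) ?_).compl
  refine MarkedConfig.measurableSet_exists (Ω := SimpleConfig d M × ((Fin d → ℝ) × M))
    (X := fun q => q.1.1) (measurable_subtype_coe.comp measurable_fst) (fun q => q.1.2)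
    (p := fun q a => ∃ b ∈ q.1.1.carrier, (a.1 ≠ q.2.1 ∧ b.1 ≠ q.2.1 ∧
        a.1 ≠ b.1) ∧ ¬ FCloser ν f q.2 a b ∧ ¬ FCloser ν f q.2 b a) ?_
  refine MarkedConfig.measurableSet_exists
    (Ω := (SimpleConfig d M × ((Fin d → ℝ) × M)) × ((Fin d → ℝ) × M))
    (X := fun q => q.1.1.1) (measurable_subtype_coe.comp (measurable_fst.comp measurable_fst))
    (fun q => q.1.1.2) (p := fun q b => (q.2.1 ≠ q.1.2.1 ∧ b.1 ≠ q.1.2.1 ∧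
        q.2.1 ≠ b.1) ∧ ¬ FCloser ν f q.1.2 q.2 b ∧ ¬ FCloser ν f q.1.2 b q.2) ?_
  refine MeasurableSet.inter (MeasurableSet.inter ?_ (MeasurableSet.inter ?_ ?_))
    (MeasurableSet.inter ?_ ?_)
  · exact (measurableSet_eq_fun (by fun_prop) (by fun_prop)).compl
  · exact (measurableSet_eq_fun (by fun_prop) (by fun_prop)).compl
  · exact (measurableSet_eq_fun (by fun_prop) (by fun_prop)).compl
  · exact (hlt.preimage (by fun_prop : Measurable
      fun q : ((SimpleConfig d M × ((Fin d → ℝ) × M)) × ((Fin d → ℝ) × M)) ×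
        ((Fin d → ℝ) × M) => (q.1.1.2, q.1.2, q.2))).compl
  · exact (hlt.preimage (by fun_prop : Measurable
      fun q : ((SimpleConfig d M × ((Fin d → ℝ) × M)) × ((Fin d → ℝ) × M)) ×
        ((Fin d → ℝ) × M) => (q.1.1.2, q.2, q.1.2))).compl

/-- No percolation of the `f`-2NN graph for a stationary, nonequidistant, deletion-tolerant process
of finite intensity. -/
theorem not_percolates_of_deletionTolerant (hν : ∀ x, ν x = 0 → x = 0)
    {Ω : Type*} [MeasurableSpace Ω] {μ : Measure Ω} {X : Ω → MarkedConfig d M}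
    (hf : IsOrderingFunction f) (hX : Measurable X) (hstat : IsStationary X μ)
    (hne : ∀ᵐ ω ∂μ, (X ω).Nonequidistant ν) (hint : HasFiniteIntensity X μ)
    (hdel : IsDeletionTolerant X μ) : ∀ᵐ ω ∂μ, ¬ Percolates (fkNNGraph ν f 2 (X ω)) := by
  obtain ⟨Y, hY, hYX⟩ := exists_simple_version hX (hne.mono fun ω h => h.simple)
  have hval : (μ.map Y).map Subtype.val = μ.map X := by
    rw [Measure.map_map measurable_subtype_coe hY]
    exact Measure.map_congr hYX
  have hP : ∀ t : Fin d → ℝ, (μ.map Y).map (SimpleConfig.translate t) = μ.map Y := by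
    intro t
    refine SimpleConfig.measure_ext ?_
    rw [hval, ← hstat t, Measure.map_map (SimpleConfig.measurable_translate t) hY,
      Measure.map_map measurable_subtype_coe ((SimpleConfig.measurable_translate t).comp hY)]
    exact Measure.map_congr (hYX.mono fun ω h => congrArg (fun ξ => ξ.translate t) h)
  have hint' : ∫⁻ ξ, (ξ.1.posCount (box d 0) : ℝ≥0∞) ∂(μ.map Y) ≠ ∞ := by
    have hm : Measurable fun ξ : SimpleConfig d M => (ξ.1.posCount (box d 0) : ℝ≥0∞) :=
      (Measurable.of_discrete (f := fun n : ℕ∞ => (n : ℝ≥0∞))).comp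
        ((MarkedConfig.measurable_posCount (measurableSet_box 0)).comp measurable_subtype_coe)
    rw [lintegral_map hm hY]
    refine ne_top_of_le_ne_top hint.ne (lintegral_mono_ae ?_)
    filter_upwards [hYX] with ω hω
    rw [hω]
    exact ENat.toENNReal_le.2 (posCount_mono _ box_zero_subset)
  have hrank : ∀ᵐ ξ ∂(μ.map Y), IsRanking (FCloser ν f) ξ.1.carrier := by
    rw [ae_map_iff hY.aemeasurable (measurableSet_isRanking ν hf.1)]
    filter_upwards [hne, hYX] with ω h1 h2
    rw [h2]
    exact isRanking_fCloser hν h1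
  have hdel' : ∀ p : SimpleConfig d M → Prop, (∀ᵐ ξ ∂(μ.map Y), p ξ) →
      ∀ᵐ ξ ∂(μ.map Y), ∀ z ∈ ξ.1.carrier, p (ξ.erase z) := by
    intro p hp
    -- Deletion tolerance speaks of one measurable choice of a point at a time; the countably many
    -- choices `sel i` exhaust the points of a simple configuration.
    have hi : ∀ᵐ ξ ∂(μ.map Y), ∀ i, p (ξ.erase (MarkedConfig.sel i ξ.1)) := by
      rw [ae_all_iff]
      intro i
      have hsel : Measurable fun ξ : SimpleConfig d M => MarkedConfig.sel i ξ.1 :=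
        (MarkedConfig.measurable_sel i).comp measurable_subtype_coe
      have hme : Measurable fun ξ : SimpleConfig d M => ξ.erase (MarkedConfig.sel i ξ.1) :=
        (MarkedConfig.measurable_erase measurable_subtype_coe hsel
          fun ξ hξ => ξ.2.sel_mem hξ i).subtype_mk
      have hz : IsPointOf (fun ω => MarkedConfig.sel i (Y ω).1) X μ := by
        refine ⟨hsel.comp hY, ?_⟩
        filter_upwards [hYX] with ω hω
        rw [← hω]
        exact fun h => (Y ω).2.sel_mem h i
      have hac : (μ.map Y).map (fun ξ => ξ.erase (MarkedConfig.sel i ξ.1)) ≪ μ.map Y := by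
        refine SimpleConfig.absolutelyContinuous_of_map ?_
        rw [hval, Measure.map_map measurable_subtype_coe hme,
          Measure.map_map (measurable_subtype_coe.comp hme) hY]
        have := hdel _ hz
        rwa [Measure.map_congr (g := fun ω => ((Y ω).erase (MarkedConfig.sel i (Y ω).1)).1)]
          at this
        filter_upwards [hYX] with ω hω
        rw [← hω]
        rfl
      exact ae_of_ae_map hme.aemeasurable (hac.ae_le hp)
    filter_upwards [hi] with ξ hξ z hz
    obtain ⟨i, rfl⟩ := ξ.2.exists_sel hz
    exact hξ i
  have h := ae_of_ae_map hY.aemeasurable (ae_infSet_eq_empty hf hP hint' hrank hdel')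
  filter_upwards [h, hYX] with ω h1 h2 hperc
  rw [h2] at h1
  obtain ⟨v, -, hv⟩ := exists_mem_infSet_of_percolates hperc
  exact (h1 ▸ hv :)

end Main

/-! ### Finite-dimensional distributions of mixed Poisson processes -/

section Fidi

variable {d : ℕ} {ι : Type*}

/-- The numbers of points in the sets `E i`. -/
noncomputable def numbers (E : ι → Set (Fin d → ℝ)) (ξ : MarkedConfig d Unit) : ι → ℕ :=
  fun i => (ξ.posCount (E i)).toNat

theorem posCount_ne_top {M : Type*} (ξ : MarkedConfig d M) {B : Set (Fin d → ℝ)}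
    (hB : Bornology.IsBounded B) : ξ.posCount B ≠ ⊤ :=
  Set.encard_ne_top_iff.2 (ξ.locallyFinite B hB)

theorem coe_numbers {E : ι → Set (Fin d → ℝ)} {i : ι} (hE : Bornology.IsBounded (E i))
    (ξ : MarkedConfig d Unit) : (numbers E ξ i : ℕ∞) = ξ.posCount (E i) :=
  ENat.natCast_toNat (posCount_ne_top ξ hE)

theorem measurable_numbers {E : ι → Set (Fin d → ℝ)} (hE : ∀ i, MeasurableSet (E i)) :
    Measurable (numbers E) :=
  measurable_pi_iff.2 fun i =>
    (Measurable.of_discrete (f := ENat.toNat)).comp (MarkedConfig.measurable_posCount (hE i))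

variable [Fintype ι]

/-- The probability that independent Poisson variables with parameters `Λ (E i)` take the
values `k i`. -/
noncomputable def fidi (Λ : Measure (Fin d → ℝ)) (E : ι → Set (Fin d → ℝ)) (k : ι → ℕ) : ℝ≥0∞ :=
  ∏ i, poissonMeasure (Λ (E i)).toNNReal {k i}

theorem measurable_fidi {E : ι → Set (Fin d → ℝ)} (hE : ∀ i, MeasurableSet (E i)) (k : ι → ℕ) :
    Measurable fun Λ : Measure (Fin d → ℝ) => fidi Λ E k := by
  refine Finset.measurable_prod _ fun i _ => ?_
  have h : Measurable fun r : ℝ≥0 => poissonMeasure r {k i} := by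
    simp_rw [poissonMeasure_singleton]
    fun_prop
  exact h.comp (Measure.measurable_coe (hE i)).ennreal_toNNReal

theorem tsum_fidi (Λ : Measure (Fin d → ℝ)) (E : ι → Set (Fin d → ℝ)) : ∑' k, fidi Λ E k = 1 := by
  have h : ∀ k, fidi Λ E k = Measure.pi (fun i => poissonMeasure (Λ (E i)).toNNReal) {k} :=
    fun k => (Measure.pi_singleton _ k).symm
  have h1 := Measure.tsum_indicator_apply_singleton
    (Measure.pi fun i => poissonMeasure (Λ (E i)).toNNReal) Set.univ MeasurableSet.univ
  simpa only [h, Set.indicator_univ, measure_univ] using h1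

theorem succ_mul_poissonMeasure_succ (r : ℝ≥0) (n : ℕ) :
    ((n + 1 : ℕ) : ℝ≥0∞) * poissonMeasure r {n + 1} = r * poissonMeasure r {n} := by
  rw [poissonMeasure_singleton, poissonMeasure_singleton, ← ENNReal.ofReal_natCast,
    ← ENNReal.ofReal_coe_nnreal, ← ENNReal.ofReal_mul (by positivity),
    ← ENNReal.ofReal_mul (by positivity)]
  congr 1
  rw [Nat.factorial_succ, pow_succ]
  push_cast
  field_simp

theorem succ_mul_fidi_add_single [DecidableEq ι] {Λ : Measure (Fin d → ℝ)}
    {E : ι → Set (Fin d → ℝ)} (s : ι) (hs : Λ (E s) ≠ ∞) (k : ι → ℕ) :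
    ((k s + 1 : ℕ) : ℝ≥0∞) * fidi Λ E (k + Pi.single s 1) = Λ (E s) * fidi Λ E k := by
  rw [fidi, fidi, ← Finset.mul_prod_erase _ _ (Finset.mem_univ s),
    ← Finset.mul_prod_erase (a := s) _ (fun i => poissonMeasure (Λ (E i)).toNNReal {k i})
      (Finset.mem_univ s), ← mul_assoc, ← mul_assoc]
  congr 1
  · rw [Pi.add_apply, Pi.single_eq_same, succ_mul_poissonMeasure_succ, ENNReal.coe_toNNReal hs]
  · refine Finset.prod_congr rfl fun i hi => ?_
    rw [Pi.add_apply, Pi.single_eq_of_ne (Finset.ne_of_mem_erase hi), add_zero]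

/-- The Mecke equation for a vector of independent Poisson variables. -/
theorem tsum_mul_fidi_sub_single [DecidableEq ι] {Λ : Measure (Fin d → ℝ)}
    {E : ι → Set (Fin d → ℝ)} (s : ι) (hs : Λ (E s) ≠ ∞) (h : (ι → ℕ) → ℝ≥0∞) :
    ∑' k, ((k s : ℕ) : ℝ≥0∞) * h (k - Pi.single s 1) * fidi Λ E k =
      Λ (E s) * ∑' k, h k * fidi Λ E k := by
  have hinj : Function.Injective fun k : ι → ℕ => k + Pi.single s 1 := add_left_injective _
  rw [← hinj.tsum_eq, ← ENNReal.tsum_mul_left]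
  · refine tsum_congr fun k => ?_
    rw [add_tsub_cancel_right, Pi.add_apply, Pi.single_eq_same, mul_right_comm,
      succ_mul_fidi_add_single s hs, mul_right_comm, mul_assoc, mul_comm (h k)]
  -- Terms with `k s = 0` vanish, so the shift by one in coordinate s loses nothing and the
  -- truncated subtraction is harmless.
  · intro k hk
    have hks : k s ≠ 0 := by
      intro h0
      simp [h0] at hk
    refine ⟨k - Pi.single s 1, tsub_add_cancel_of_le fun i => ?_⟩
    by_cases his : i = s
    · subst his
      rw [Pi.single_eq_same]
      exact Nat.one_le_iff_ne_zero.2 hks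
    · rw [Pi.single_eq_of_ne his]
      exact Nat.zero_le _

/-- The finite-dimensional distributions of `P` are those of a Poisson process with a random
intensity measure of law `Q`. -/
def IsMixedPoisson (P : Measure (MarkedConfig d Unit)) (Q : Measure (Measure (Fin d → ℝ))) : Prop :=
  (∀ᵐ Λ ∂Q, IsFiniteOnBounded Λ) ∧
    ∀ (n : ℕ) (B : Fin n → Set (Fin d → ℝ)) (k : Fin n → ℕ),
      (∀ i, MeasurableSet (B i)) → (∀ i, Bornology.IsBounded (B i)) →
      Pairwise (fun i j => Disjoint (B i) (B j)) →
        P {ξ | ∀ i, ξ.posCount (B i) = (k i : ℕ∞)} = ∫⁻ Λ, poissonFidi Λ B k ∂Q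

variable {P : Measure (MarkedConfig d Unit)} {Q : Measure (Measure (Fin d → ℝ))}

theorem IsMixedPoisson.lintegral_numbers (h : IsMixedPoisson P Q) {E : ι → Set (Fin d → ℝ)}
    (hE : ∀ i, MeasurableSet (E i)) (hb : ∀ i, Bornology.IsBounded (E i))
    (hd : Pairwise fun i j => Disjoint (E i) (E j)) (g : (ι → ℕ) → ℝ≥0∞) :
    ∫⁻ ξ, g (numbers E ξ) ∂P = ∫⁻ Λ, ∑' k, g k * fidi Λ E k ∂Q := by
  have hk : ∀ k, P.map (numbers E) {k} = ∫⁻ Λ, fidi Λ E k ∂Q := by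
    intro k
    let e := (Fintype.equivFin ι).symm
    rw [Measure.map_apply (measurable_numbers hE) (measurableSet_singleton k)]
    have h1 := h.2 _ (fun i => E (e i)) (fun i => k (e i)) (fun i => hE _) (fun i => hb _)
      (fun i j hij => hd (e.injective.ne hij))
    have h2 : numbers E ⁻¹' {k} = {ξ | ∀ i, ξ.posCount (E (e i)) = (k (e i) : ℕ∞)} := by
      ext ξ
      simp only [Set.mem_preimage, Set.mem_singleton_iff, Set.mem_ofPred_eq, funext_iff]
      rw [← e.forall_congr_right]
      refine forall_congr' fun i => ?_
      rw [← coe_numbers (hb _), Nat.cast_inj]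
    rw [h2, h1]
    refine lintegral_congr fun Λ => ?_
    rw [fidi, poissonFidi, ← e.prod_comp]
  rw [← lintegral_map (f := g) (Measurable.of_discrete) (measurable_numbers hE),
    lintegral_countable']
  simp_rw [hk]
  rw [lintegral_tsum fun k => ((measurable_fidi hE k).const_mul _).aemeasurable]
  refine tsum_congr fun k => ?_
  rw [lintegral_const_mul _ (measurable_fidi hE k)]

end Fidi

/-! ### Reduced Campbell measures -/

section Campbell

variable {d : ℕ}

theorem simple_of_unit (ξ : MarkedConfig d Unit) : ξ.Simple := fun _ _ _ _ h => Prod.ext h rfl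

/-- The reduced Campbell measure: the expected number of points `x` of `ξ` such that the pair of
`x` and `ξ` without `x` belongs to a given set. -/
noncomputable def campbell (P : Measure (MarkedConfig d Unit)) :
    Measure ((Fin d → ℝ) × MarkedConfig d Unit) :=
  Measure.sum fun i => (P.restrict {ξ | ξ.Fresh i}).map
    fun ξ => ((MarkedConfig.sel i ξ).1, ξ.erase (MarkedConfig.sel i ξ))

theorem measurable_erase_sel (i : ℕ) :
    Measurable fun ξ : MarkedConfig d Unit => ξ.erase (MarkedConfig.sel i ξ) :=
  MarkedConfig.measurable_erase measurable_id (MarkedConfig.measurable_sel i)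
    fun ξ hξ => (simple_of_unit ξ).sel_mem hξ i

theorem measurable_sel_erase (i : ℕ) : Measurable fun ξ : MarkedConfig d Unit =>
    ((MarkedConfig.sel i ξ).1, ξ.erase (MarkedConfig.sel i ξ)) :=
  (measurable_fst.comp (MarkedConfig.measurable_sel i)).prodMk (measurable_erase_sel i)

variable {P : Measure (MarkedConfig d Unit)}

theorem campbell_apply {S : Set ((Fin d → ℝ) × MarkedConfig d Unit)} (hS : MeasurableSet S) :
    campbell P S = ∫⁻ ξ, ∑' x : ξ.carrier, S.indicator 1 (x.1.1, ξ.erase x.1) ∂P := by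
  have h1 : ∀ ξ : MarkedConfig d Unit,
      ∑' x : ξ.carrier, S.indicator (1 : (Fin d → ℝ) × MarkedConfig d Unit → ℝ≥0∞) (x.1.1, ξ.erase x.1) =
        ∑' i, ({ξ : MarkedConfig d Unit | ξ.Fresh i} ∩
          ((fun ξ => ((MarkedConfig.sel i ξ).1, ξ.erase (MarkedConfig.sel i ξ))) ⁻¹' S)).indicator
            (1 : MarkedConfig d Unit → ℝ≥0∞) ξ := by
    intro ξ
    rw [(simple_of_unit ξ).tsum_eq fun x => S.indicator (1 : (Fin d → ℝ) × MarkedConfig d Unit → ℝ≥0∞) (x.1, ξ.erase x)]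
    refine tsum_congr fun i => ?_
    by_cases hi : ξ.Fresh i
    · rw [Set.indicator_of_mem (show i ∈ {i | ξ.Fresh i} from hi), ← MarkedConfig.sel_of_solo hi.1]
      by_cases hS : ((MarkedConfig.sel i ξ).1, ξ.erase (MarkedConfig.sel i ξ)) ∈ S
      · rw [Set.indicator_of_mem hS]
        have hmem : ξ ∈ {ξ : MarkedConfig d Unit | ξ.Fresh i} ∩
            ((fun ξ => ((MarkedConfig.sel i ξ).1, ξ.erase (MarkedConfig.sel i ξ))) ⁻¹' S) :=
          ⟨hi, hS⟩
        exact (Set.indicator_of_mem hmem (1 : MarkedConfig d Unit → ℝ≥0∞)).symm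
      · rw [Set.indicator_of_notMem hS, Set.indicator_of_notMem fun h => hS h.2]
    · rw [Set.indicator_of_notMem (show i ∉ {i | ξ.Fresh i} from hi),
        Set.indicator_of_notMem fun h => hi h.1]
  simp_rw [h1]
  have hm := fun i =>
    (MarkedConfig.measurableSet_fresh i).inter ((measurable_sel_erase (d := d) i) hS)
  rw [lintegral_tsum fun i => (measurable_one.indicator (hm i)).aemeasurable, campbell,
    Measure.sum_apply _ hS]
  refine tsum_congr fun i => ?_
  rw [Measure.map_apply (measurable_sel_erase i) hS,
    Measure.restrict_apply (measurable_sel_erase i hS), lintegral_indicator_one (hm i),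
    Set.inter_comm]

/-- One Campbell-null set serves all points of ξ simultaneously, hence every random choice of a
point, whatever else that choice depends on. -/
theorem ae_forall_notMem_of_campbell_eq_zero {S : Set ((Fin d → ℝ) × MarkedConfig d Unit)}
    (hS : MeasurableSet S) (h : campbell P S = 0) :
    ∀ᵐ ξ ∂P, ∀ x ∈ ξ.carrier, (x.1, ξ.erase x) ∉ S := by
  rw [campbell, Measure.sum_apply _ hS, ENNReal.tsum_eq_zero] at h
  have h2 : ∀ᵐ ξ ∂P, ∀ i, ξ.Fresh i →
      ((MarkedConfig.sel i ξ).1, ξ.erase (MarkedConfig.sel i ξ)) ∉ S := by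
    rw [ae_all_iff]
    intro i
    have hi := h i
    rw [Measure.map_apply (measurable_sel_erase i) hS] at hi
    exact (ae_restrict_iff' (MarkedConfig.measurableSet_fresh i)).1
      (measure_eq_zero_iff_ae_notMem.1 hi)
  filter_upwards [h2] with ξ hξ x hx
  obtain ⟨⟨i, hi⟩, hix⟩ := (MarkedConfig.freshEquiv (simple_of_unit ξ)).surjective ⟨x, hx⟩
  have hx' : MarkedConfig.sel i ξ = x :=
    (MarkedConfig.sel_of_solo hi.1).trans (congrArg Subtype.val hix)
  exact hx' ▸ hξ i hi

end Campbell

/-! ### Events that depend on finitely many counts -/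

section Cylinder

variable {d : ℕ}

/-- The events that are determined by the numbers of points in the members of a finite family of
bounded measurable sets. -/
def cylinders (d : ℕ) : Set (Set (MarkedConfig d Unit)) :=
  {A | ∃ T : Finset (Set (Fin d → ℝ)), (∀ B ∈ T, MeasurableSet B ∧ Bornology.IsBounded B) ∧
    ∀ ξ ξ' : MarkedConfig d Unit, (∀ B ∈ T, ξ.posCount B = ξ'.posCount B) → (ξ ∈ A ↔ ξ' ∈ A)}

theorem isSetAlgebra_cylinders : IsSetAlgebra (cylinders d) where
  empty_mem := ⟨∅, by simp, by simp⟩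
  compl_mem := by
    rintro A ⟨T, hT, h⟩
    exact ⟨T, hT, fun ξ ξ' hξ => not_congr (h ξ ξ' hξ)⟩
  union_mem := by
    classical
    rintro A A' ⟨T, hT, h⟩ ⟨T', hT', h'⟩
    refine ⟨T ∪ T', fun B hB => (Finset.mem_union.1 hB).elim (hT B) (hT' B),
      fun ξ ξ' hξ => or_congr (h ξ ξ' fun B hB => ?_) (h' ξ ξ' fun B hB => ?_)⟩
    · exact hξ B (Finset.mem_union_left _ hB)
    · exact hξ B (Finset.mem_union_right _ hB)

/-- The vector of counts takes values in a countable space whose singletons are measurable, so every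
set of values is measurable. -/
theorem measurableSet_of_mem_cylinders {A : Set (MarkedConfig d Unit)} (hA : A ∈ cylinders d) :
    MeasurableSet A := by
  obtain ⟨T, hT, h⟩ := hA
  let F : MarkedConfig d Unit → (T → ℕ∞) := fun ξ B => ξ.posCount B
  have hF : Measurable F :=
    measurable_pi_iff.2 fun B => MarkedConfig.measurable_posCount (hT B B.2).1
  have : A = F ⁻¹' (F '' A) := by
    refine Set.Subset.antisymm (Set.subset_preimage_image F A) ?_
    rintro ξ ⟨ξ', hξ', heq⟩
    exact (h ξ' ξ fun B hB => congrFun heq ⟨B, hB⟩).1 hξ'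
  rw [this]
  exact hF (Set.to_countable _).measurableSet

/-- Exhaustion by balls: cylinder events see bounded sets only, while the evaluation σ-algebra
involves unbounded ones. -/
theorem count_eq_iSup (ξ : MarkedConfig d Unit) (B : Set ((Fin d → ℝ) × Unit)) :
    ξ.count B = ⨆ n : ℕ, ξ.posCount ((fun x => (x, ())) ⁻¹' B ∩ Metric.closedBall 0 n) := by
  refine le_antisymm ?_ (iSup_le fun n => Set.encard_le_encard fun p hp => ⟨hp.1, hp.2.1⟩)
  refine ENat.forall_natCast_le_iff_le.1 fun m hm => ?_
  obtain ⟨t, ht, htm⟩ := Set.exists_subset_encard_eq hm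
  have hfin : t.Finite := Set.encard_ne_top_iff.1 (htm ▸ ENat.natCast_ne_top m)
  obtain ⟨R, hR⟩ := (hfin.image Prod.fst).isBounded.exists_norm_le
  obtain ⟨n, hn⟩ := exists_nat_ge R
  refine htm.symm.le.trans ((Set.encard_le_encard fun p hp => ?_).trans
    (le_iSup (fun n : ℕ => ξ.posCount ((fun x => (x, ())) ⁻¹' B ∩ Metric.closedBall 0 n)) n))
  exact ⟨(ht hp).1, (ht hp).2, mem_closedBall_zero_iff.2 ((hR _ ⟨p, hp, rfl⟩).trans hn)⟩

theorem generateFrom_cylinders :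
    (MarkedConfig.instMeasurableSpace : MeasurableSpace (MarkedConfig d Unit)) =
      MeasurableSpace.generateFrom (cylinders d) := by
  refine le_antisymm ?_ (MeasurableSpace.generateFrom_le fun A => measurableSet_of_mem_cylinders)
  rw [MarkedConfig.instMeasurableSpace]
  refine iSup_le fun ⟨B, hB⟩ => ?_
  rw [← measurable_iff_comap_le]
  have hpos : ∀ C : Set (Fin d → ℝ), MeasurableSet C → Bornology.IsBounded C →
      Measurable[MeasurableSpace.generateFrom (cylinders d)]
        fun ξ : MarkedConfig d Unit => ξ.posCount C := fun C hC hCb s _ =>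
    MeasurableSpace.measurableSet_generateFrom ⟨{C}, by simp [hC, hCb], fun ξ ξ' h => by
      simp [h C (Finset.mem_singleton_self C)]⟩
  have hsup : Measurable[MeasurableSpace.generateFrom (cylinders d)]
      fun ξ : MarkedConfig d Unit => (ξ.count B : ℝ≥0∞) := by
    simp_rw [count_eq_iSup, ENat.toENNReal_iSup]
    exact Measurable.iSup fun n => (Measurable.of_discrete (f := fun n : ℕ∞ => (n : ℝ≥0∞))).comp
      (hpos _ ((measurable_prodMk_right hB).inter Metric.isClosed_closedBall.measurableSet)
        (Metric.isBounded_closedBall.subset Set.inter_subset_right))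
  intro s _
  have hs : (fun ξ : MarkedConfig d Unit => ξ.count B) ⁻¹' s =
      (fun ξ : MarkedConfig d Unit => (ξ.count B : ℝ≥0∞)) ⁻¹' (ENat.toENNReal '' s) := by
    ext ξ
    exact (ENat.toENNReal_strictMono.injective.mem_set_image).symm
  rw [hs]
  exact hsup ((s.to_countable.image _).measurableSet)

end Cylinder

/-! ### The Mecke equation on cylinder events -/

section Atoms

variable {d : ℕ}

/-- The atoms of the finite algebra generated by `T`, up to the one outside of all members. -/
def atom (T s : Finset (Set (Fin d → ℝ))) : Set (Fin d → ℝ) := {x | ∀ B ∈ T, x ∈ B ↔ B ∈ s}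

variable {T s t : Finset (Set (Fin d → ℝ))}

theorem measurableSet_atom (hT : ∀ B ∈ T, MeasurableSet B) : MeasurableSet (atom T s) := by
  have : atom T s = ⋂ B ∈ T, {x | x ∈ B ↔ B ∈ s} := by
    ext x; simp [atom]
  rw [this]
  refine MeasurableSet.biInter T.countable_toSet fun B hB => ?_
  by_cases h : B ∈ s
  · simp only [h, iff_true]
    exact hT B hB
  · simp only [h, iff_false]
    exact (hT B hB).compl

theorem isBounded_atom (hT : ∀ B ∈ T, Bornology.IsBounded B) (hs : s.Nonempty) (hsT : s ⊆ T) :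
    Bornology.IsBounded (atom T s) := by
  obtain ⟨B, hB⟩ := hs
  exact (hT B (hsT hB)).subset fun x hx => (hx B (hsT hB)).2 hB

theorem disjoint_atom (hs : s ⊆ T) (ht : t ⊆ T) (hst : s ≠ t) :
    Disjoint (atom T s) (atom T t) := by
  rw [Set.disjoint_left]
  intro x hx hx'
  refine hst (Finset.ext fun B => ⟨fun h => ?_, fun h => ?_⟩)
  · exact (hx' B (hs h)).1 ((hx B (hs h)).2 h)
  · exact (hx B (ht h)).1 ((hx' B (ht h)).2 h)

open Classical in
/-- The index set of the atoms. -/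
noncomputable abbrev atomIndex (T : Finset (Set (Fin d → ℝ))) : Finset (Finset (Set (Fin d → ℝ))) :=
  -- The empty label is excluded because its atom, the complement of all members, need not be
  -- bounded.
  T.powerset.erase ∅

theorem subset_of_mem_atomIndex (h : s ∈ atomIndex T) : s ⊆ T :=
  Finset.mem_powerset.1 (Finset.mem_of_mem_erase h)

theorem nonempty_of_mem_atomIndex (h : s ∈ atomIndex T) : s.Nonempty :=
  Finset.nonempty_iff_ne_empty.2 (Finset.ne_of_mem_erase h)

open Classical in
theorem indicator_eq_sum_atom {B : Set (Fin d → ℝ)} (hB : B ∈ T) (x : Fin d → ℝ) :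
    B.indicator (1 : (Fin d → ℝ) → ℝ≥0∞) x =
      ∑ s : atomIndex T, if B ∈ s.1 then (atom T s.1).indicator 1 x else 0 := by
  by_cases hx : x ∈ B
  · have hmem : T.filter (fun C => x ∈ C) ∈ atomIndex T := by
      refine Finset.mem_erase.2 ⟨?_, Finset.mem_powerset.2 (Finset.filter_subset _ _)⟩
      exact Finset.nonempty_iff_ne_empty.1 ⟨B, Finset.mem_filter.2 ⟨hB, hx⟩⟩
    have hatom : x ∈ atom T (T.filter fun C => x ∈ C) := fun C hC => by simp [hC]
    rw [Finset.sum_eq_single (⟨_, hmem⟩ : atomIndex T)]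
    · rw [if_pos (Finset.mem_filter.2 ⟨hB, hx⟩), Set.indicator_of_mem hx,
        Set.indicator_of_mem hatom]
    · intro s _ hs
      have : x ∉ atom T s.1 := fun h =>
        Set.disjoint_left.1 (disjoint_atom (subset_of_mem_atomIndex s.2)
          (subset_of_mem_atomIndex hmem) fun h => hs (Subtype.ext h)) h hatom
      rw [Set.indicator_of_notMem this, ite_self]
    · exact fun h => absurd (Finset.mem_univ _) h
  · rw [Set.indicator_of_notMem hx]
    refine (Finset.sum_eq_zero fun s _ => ?_).symm
    split_ifs with h
    · exact Set.indicator_of_notMem (fun h' => hx ((h' B hB).2 h)) _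
    · rfl

open Classical in
theorem measure_eq_sum_atom (hT : ∀ B ∈ T, MeasurableSet B) {B : Set (Fin d → ℝ)} (hB : B ∈ T)
    (Λ : Measure (Fin d → ℝ)) :
    Λ B = ∑ s : atomIndex T, if B ∈ s.1 then Λ (atom T s.1) else 0 := by
  rw [← lintegral_indicator_one (hT B hB)]
  simp_rw [indicator_eq_sum_atom hB]
  rw [lintegral_finsetSum]
  · refine Finset.sum_congr rfl fun s _ => ?_
    split_ifs
    · exact lintegral_indicator_one (measurableSet_atom hT)
    · exact lintegral_zero
  · intro s _
    split_ifs
    · exact measurable_one.indicator (measurableSet_atom hT)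
    · exact measurable_const

theorem coe_posCount {M : Type*} (ξ : MarkedConfig d M) (B : Set (Fin d → ℝ)) :
    (ξ.posCount B : ℝ≥0∞) = ∑' x : ξ.carrier, B.indicator 1 x.1.1 :=
  (tsum_indicator_one_eq_encard ξ.carrier fun p => p.1 ∈ B).symm

open Classical in
theorem coe_posCount_eq_sum_atom {B : Set (Fin d → ℝ)} (hB : B ∈ T) (ξ : MarkedConfig d Unit) :
    (ξ.posCount B : ℝ≥0∞) =
      ∑ s : atomIndex T, if B ∈ s.1 then (ξ.posCount (atom T s.1) : ℝ≥0∞) else 0 := by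
  rw [coe_posCount]
  simp_rw [indicator_eq_sum_atom hB]
  rw [Summable.tsum_finsetSum fun _ _ => ENNReal.summable]
  refine Finset.sum_congr rfl fun s _ => ?_
  split_ifs
  · rw [coe_posCount]
  · exact tsum_zero

theorem numbers_erase {ι : Type*} [DecidableEq ι] {E : ι → Set (Fin d → ℝ)}
    (hd : Pairwise fun i j => Disjoint (E i) (E j)) {ξ : MarkedConfig d Unit}
    {x : (Fin d → ℝ) × Unit} (hx : x ∈ ξ.carrier) {i : ι} (hxi : x.1 ∈ E i) :
    numbers E (ξ.erase x) = numbers E ξ - Pi.single i 1 := by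
  funext j
  simp only [numbers, MarkedConfig.posCount, MarkedConfig.count, MarkedConfig.erase,
    ← Set.inter_sdiff_right_comm, Pi.sub_apply]
  by_cases hij : j = i
  · subst hij
    rw [Set.encard_sdiff_singleton_of_mem (show x ∈ ξ.carrier ∩ {p | p.1 ∈ E j} from ⟨hx, hxi⟩),
      Pi.single_eq_same, ENat.toNat_sub]
    · rfl
    · exact ENat.one_ne_top
  · rw [Set.sdiff_singleton_eq_self, Pi.single_eq_of_ne hij, Nat.sub_zero]
    exact fun h => Set.disjoint_left.1 (hd hij) h.2 hxi

open Classical in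
/-- The probability of a cylinder event is a mixture of Poisson probabilities, and the reduced
Campbell measure weights it with the intensity. -/
theorem exists_mixing {A : Set (MarkedConfig d Unit)} (hA : A ∈ cylinders d) {D : Set (Fin d → ℝ)} (hD : MeasurableSet D)
    (hDb : Bornology.IsBounded D) :
    ∃ φ : Measure (Fin d → ℝ) → ℝ≥0∞, Measurable φ ∧ (∀ Λ, φ Λ ≤ 1) ∧
      ∀ (P : Measure (MarkedConfig d Unit)) (Q : Measure (Measure (Fin d → ℝ))),
        IsMixedPoisson P Q → P A = ∫⁻ Λ, φ Λ ∂Q ∧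
          campbell P (D ×ˢ A) = ∫⁻ Λ, Λ D * φ Λ ∂Q := by
  have hAm := measurableSet_of_mem_cylinders hA
  obtain ⟨T₀, hT₀, hA'⟩ := hA
  -- With `D` included, both `A` and the number of points in `D` are functions of the counts in
  -- disjoint bounded atoms.
  set T := insert D T₀ with hTdef
  have hDT : D ∈ T := Finset.mem_insert_self _ _
  have hT : ∀ B ∈ T, MeasurableSet B ∧ Bornology.IsBounded B := by
    intro B hB
    rcases Finset.mem_insert.1 hB with rfl | hB
    · exact ⟨hD, hDb⟩
    · exact hT₀ B hB
  have hTm : ∀ B ∈ T, MeasurableSet B := fun B hB => (hT B hB).1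
  let E : atomIndex T → Set (Fin d → ℝ) := fun s => atom T s.1
  have hEm : ∀ s, MeasurableSet (E s) := fun s => measurableSet_atom hTm
  have hEb : ∀ s, Bornology.IsBounded (E s) := fun s => isBounded_atom (fun B hB => (hT B hB).2)
    (nonempty_of_mem_atomIndex s.2) (subset_of_mem_atomIndex s.2)
  have hEd : Pairwise fun i j => Disjoint (E i) (E j) := fun i j hij =>
    disjoint_atom (subset_of_mem_atomIndex i.2) (subset_of_mem_atomIndex j.2)
      fun h => hij (Subtype.ext h)
  set K : Set (atomIndex T → ℕ) := numbers E '' A with hK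
  have hmem : ∀ ξ, numbers E ξ ∈ K ↔ ξ ∈ A := by
    intro ξ
    refine ⟨?_, fun hξ => ⟨ξ, hξ, rfl⟩⟩
    rintro ⟨ξ', hξ', heq⟩
    refine (hA' ξ' ξ fun B hB => ?_).1 hξ'
    apply ENat.toENNReal_strictMono.injective
    have hBT : B ∈ T := Finset.mem_insert_of_mem hB
    rw [coe_posCount_eq_sum_atom hBT, coe_posCount_eq_sum_atom hBT]
    refine Finset.sum_congr rfl fun s _ => ?_
    have := congrFun heq s
    rw [← Nat.cast_inj (R := ℕ∞), coe_numbers (hEb s), coe_numbers (hEb s)] at this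
    rw [show ξ'.posCount (atom T s.1) = ξ.posCount (atom T s.1) from this]
  have hind : ∀ ξ, K.indicator (1 : (atomIndex T → ℕ) → ℝ≥0∞) (numbers E ξ) =
      A.indicator (1 : MarkedConfig d Unit → ℝ≥0∞) ξ := by
    intro ξ
    by_cases hξ : ξ ∈ A
    · rw [Set.indicator_of_mem hξ, Set.indicator_of_mem ((hmem ξ).2 hξ)]; rfl
    · rw [Set.indicator_of_notMem hξ, Set.indicator_of_notMem (mt (hmem ξ).1 hξ)]
  -- The Poisson probability of the event given Λ. It depends on neither `P` nor `Q`, which later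
  -- yields uniqueness of the law.
  refine ⟨fun Λ => ∑' k, K.indicator 1 k * fidi Λ E k, ?_, fun Λ => ?_, fun P Q h => ⟨?_, ?_⟩⟩
  · exact Measurable.tsum fun k => (measurable_fidi hEm k).const_mul _
  · refine (ENNReal.tsum_le_tsum fun k => ?_).trans (tsum_fidi Λ E).le
    exact mul_le_of_le_one_left zero_le (Set.indicator_le_self' (by simp) k)
  · rw [← h.lintegral_numbers hEm hEb hEd, ← lintegral_indicator_one hAm]
    simp_rw [hind]
  -- Removing a point from atom s lowers the count of s by one and changes no other, so the Campbell
  -- sum over points in `D` is this function of the counts, to which the Mecke equation applies atom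
  -- by atom.
  · set g : (atomIndex T → ℕ) → ℝ≥0∞ := fun k => ∑ s : atomIndex T,
      if D ∈ s.1 then ((k s : ℕ) : ℝ≥0∞) * K.indicator 1 (k - Pi.single s 1) else 0 with hg
    have hpt : ∀ ξ : MarkedConfig d Unit, ∑' x : ξ.carrier,
        (D ×ˢ A).indicator (1 : (Fin d → ℝ) × MarkedConfig d Unit → ℝ≥0∞) (x.1.1, ξ.erase x.1) =
          g (numbers E ξ) := by
      intro ξ
      have hx : ∀ x : ξ.carrier, (D ×ˢ A).indicator
          (1 : (Fin d → ℝ) × MarkedConfig d Unit → ℝ≥0∞) (x.1.1, ξ.erase x.1) =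
          ∑ s : atomIndex T, if D ∈ s.1 then (E s).indicator 1 x.1.1 *
            K.indicator 1 (numbers E ξ - Pi.single s 1) else 0 := by
        intro x
        have h1 : (D ×ˢ A).indicator (1 : (Fin d → ℝ) × MarkedConfig d Unit → ℝ≥0∞)
            (x.1.1, ξ.erase x.1) = D.indicator 1 x.1.1 * A.indicator 1 (ξ.erase x.1) := by
          by_cases hxD : x.1.1 ∈ D <;> by_cases hxA : ξ.erase x.1 ∈ A <;> simp [hxD, hxA]
        rw [h1, indicator_eq_sum_atom hDT, Finset.sum_mul]
        refine Finset.sum_congr rfl fun s _ => ?_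
        split_ifs
        · by_cases hxs : x.1.1 ∈ E s
          · rw [← numbers_erase hEd x.2 hxs, hind]
          · rw [Set.indicator_of_notMem hxs, zero_mul, zero_mul]
        · exact zero_mul _
      simp_rw [hx]
      rw [Summable.tsum_finsetSum fun _ _ => ENNReal.summable]
      refine Finset.sum_congr rfl fun s _ => ?_
      split_ifs
      · rw [ENNReal.tsum_mul_right, ← coe_posCount, ← coe_numbers (hEb s), ENat.toENNReal_coe]
      · exact tsum_zero
    rw [campbell_apply (hD.prod hAm)]
    simp_rw [hpt]
    rw [h.lintegral_numbers hEm hEb hEd]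
    refine lintegral_congr_ae ?_
    filter_upwards [h.1] with Λ hΛ
    rw [measure_eq_sum_atom hTm hDT, Finset.sum_mul]
    simp_rw [hg, Finset.sum_mul]
    rw [Summable.tsum_finsetSum fun _ _ => ENNReal.summable]
    refine Finset.sum_congr rfl fun s _ => ?_
    split_ifs
    · exact tsum_mul_fidi_sub_single s (hΛ _ (hEb s)).ne _
    · simp

end Atoms

/-! ### Deletion tolerance of Cox processes -/

section Cox

variable {d : ℕ} {P : Measure (MarkedConfig d Unit)} {Q : Measure (Measure (Fin d → ℝ))}

theorem IsMixedPoisson.lintegral_posCount (h : IsMixedPoisson P Q) {D : Set (Fin d → ℝ)}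
    (hD : MeasurableSet D) (hDb : Bornology.IsBounded D) :
    ∫⁻ ξ, (ξ.posCount D : ℝ≥0∞) ∂P = ∫⁻ Λ, Λ D ∂Q := by
  have h1 := h.lintegral_numbers (ι := Unit) (E := fun _ => D) (fun _ => hD) (fun _ => hDb)
    (fun i j hij => absurd (Subsingleton.elim i j) hij) fun k => ((k () : ℕ) : ℝ≥0∞)
  have h2 : ∀ ξ : MarkedConfig d Unit,
      ((numbers (fun _ : Unit => D) ξ () : ℕ) : ℝ≥0∞) = ξ.posCount D := fun ξ => by
    rw [← coe_numbers (E := fun _ : Unit => D) (i := ()) hDb, ENat.toENNReal_coe]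
  simp_rw [h2] at h1
  rw [h1]
  refine lintegral_congr_ae ?_
  filter_upwards [h.1] with Λ hΛ
  have h3 := tsum_mul_fidi_sub_single (Λ := Λ) (E := fun _ : Unit => D) () (hΛ D hDb).ne
    fun _ => 1
  simpa only [mul_one, one_mul, tsum_fidi] using h3

theorem campbell_prod_univ {D : Set (Fin d → ℝ)} (hD : MeasurableSet D) :
    campbell P (D ×ˢ Set.univ) = ∫⁻ ξ, (ξ.posCount D : ℝ≥0∞) ∂P := by
  rw [campbell_apply (hD.prod MeasurableSet.univ)]
  refine lintegral_congr fun ξ => ?_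
  rw [coe_posCount]
  refine tsum_congr fun x => ?_
  by_cases hx : x.1.1 ∈ D <;> simp [hx]

theorem tendsto_lintegral_tsub_nat {α : Type*} [MeasurableSpace α] {ρ : Measure α}
    {g : α → ℝ≥0∞} (hg : Measurable g) (hfin : ∫⁻ a, g a ∂ρ ≠ ∞) :
    Filter.Tendsto (fun K : ℕ => ∫⁻ a, (g a - K) ∂ρ) Filter.atTop (nhds 0) := by
  have h := tendsto_lintegral_of_dominated_convergence (μ := ρ) (F := fun (K : ℕ) a => g a - K)
    (f := fun _ => 0) g (fun K => hg.sub_const _) (fun K => ae_of_all _ fun a => tsub_le_self) hfin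
    ?_
  · simpa using h
  · filter_upwards [ae_lt_top hg hfin] with a ha
    obtain ⟨n, hn⟩ := ENNReal.exists_nat_gt ha.ne
    refine tendsto_const_nhds.congr' ?_
    filter_upwards [Filter.eventually_ge_atTop n] with K hK
    exact (tsub_eq_zero_of_le (hn.le.trans (by exact_mod_cast hK))).symm

/-- The reduced Campbell measure of a mixed Poisson process is absolutely continuous. -/
theorem IsMixedPoisson.campbell_eq_zero [IsProbabilityMeasure P] (h : IsMixedPoisson P Q)
    {D : Set (Fin d → ℝ)} (hD : MeasurableSet D) (hDb : Bornology.IsBounded D)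
    (hfin : ∫⁻ ξ, (ξ.posCount D : ℝ≥0∞) ∂P ≠ ∞) {A : Set (MarkedConfig d Unit)}
    (hA : MeasurableSet A) (h0 : P A = 0) : campbell P (D ×ˢ A) = 0 := by
  set C : Measure (MarkedConfig d Unit) := ((campbell P).restrict (D ×ˢ Set.univ)).map Prod.snd
    with hCdef
  have hC : ∀ A, MeasurableSet A → C A = campbell P (D ×ˢ A) := by
    intro A hA
    rw [hCdef, Measure.map_apply measurable_snd hA, Measure.restrict_apply (measurable_snd hA)]
    congr 1
    ext ⟨x, ξ⟩
    simp [and_comm]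
  have hCfin : IsFiniteMeasure C := ⟨by
    rw [hC _ MeasurableSet.univ, campbell_prod_univ hD]
    exact hfin.lt_top⟩
  -- Approximation with respect to `C + P` controls both measures with the same cylinder event.
  have hdense := Measure.MeasureDense.of_generateFrom_isSetAlgebra_finite (μ := C + P)
    (isSetAlgebra_cylinders (d := d)) generateFrom_cylinders
  have hint : ∫⁻ Λ, Λ D ∂Q ≠ ∞ := h.lintegral_posCount hD hDb ▸ hfin
  have hmeasD : Measurable fun Λ : Measure (Fin d → ℝ) => Λ D := Measure.measurable_coe hD
  -- The intensity Λ(D) may be unbounded, so `C` is not bounded by a multiple of `P`. Truncation at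
  -- `K` bounds the main part by `K * P B`; the remainder does not depend on the event and vanishes
  -- as `K` grows.
  have key : ∀ K : ℕ, ∀ ε : ℝ≥0, 0 < ε →
      C A ≤ ∫⁻ Λ, (Λ D - K) ∂Q + (K + 1) * ε := by
    intro K ε hε
    obtain ⟨B, hB, hBε⟩ := hdense.approx A hA (measure_ne_top _ _) ε (by exact_mod_cast hε)
    rw [ENNReal.ofReal_coe_nnreal, Measure.add_apply] at hBε
    have hBm := measurableSet_of_mem_cylinders hB
    have h1 : C A ≤ C B + ε := by
      refine (measure_le_inter_add_sdiff C A B).trans (add_le_add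
        (measure_mono Set.inter_subset_right) ?_)
      refine (measure_mono fun x hx => Or.inl hx).trans (le_self_add.trans hBε.le)
    have h2 : P B ≤ ε := by
      refine (measure_le_inter_add_sdiff P B A).trans ?_
      rw [measure_mono_null Set.inter_subset_right h0, zero_add]
      exact (measure_mono fun x hx => Or.inr hx).trans (le_add_self.trans hBε.le)
    obtain ⟨φ, hφ, hφ1, hφPQ⟩ := exists_mixing hB hD hDb
    obtain ⟨hPB, hCB⟩ := hφPQ P Q h
    have h3 : C B ≤ ∫⁻ Λ, (Λ D - K) ∂Q + K * P B := by
      rw [hC B hBm, hCB, hPB, ← lintegral_const_mul _ hφ,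
        ← lintegral_add_left (hmeasD.sub_const _)]
      refine lintegral_mono fun Λ => ?_
      calc Λ D * φ Λ ≤ (Λ D - K + K) * φ Λ := mul_le_mul_left le_tsub_add _
        _ = (Λ D - K) * φ Λ + K * φ Λ := add_mul _ _ _
        _ ≤ (Λ D - K) + K * φ Λ := add_le_add_left (mul_le_of_le_one_right' (hφ1 Λ)) _
    calc C A ≤ ∫⁻ Λ, (Λ D - K) ∂Q + K * P B + ε := h1.trans (add_le_add_left h3 _)
      _ ≤ ∫⁻ Λ, (Λ D - K) ∂Q + K * ε + ε := by gcongr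
      _ = ∫⁻ Λ, (Λ D - K) ∂Q + (K + 1) * ε := by ring
  have key2 : ∀ K : ℕ, C A ≤ ∫⁻ Λ, (Λ D - K) ∂Q := by
    intro K
    refine ENNReal.le_of_forall_pos_le_add fun ε hε _ => ?_
    refine (key K (ε / (K + 1)) (by positivity)).trans (add_le_add_right ?_ _)
    rw [← ENNReal.coe_natCast, ← ENNReal.coe_one, ← ENNReal.coe_add, ← ENNReal.coe_mul]
    rw [mul_div_cancel₀]
    positivity
  rw [← hC A hA]
  exact le_antisymm (ge_of_tendsto' (tendsto_lintegral_tsub_nat hmeasD hint) key2) zero_le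

theorem isBounded_box (z : Fin d → ℤ) : Bornology.IsBounded (box d z) := by
  refine (Metric.isBounded_Icc (fun i => (z i : ℝ)) (fun i => (z i : ℝ) + 1)).subset fun x hx => ?_
  constructor <;> intro i
  · exact (Int.le_floor.1 (hx i).ge)
  · simpa [← hx i] using (Int.lt_floor_add_one (x i)).le

theorem lintegral_posCount_box (hstat : ∀ t : Fin d → ℝ, P.map (fun ξ => ξ.translate t) = P)
    (z : Fin d → ℤ) : ∫⁻ ξ, (ξ.posCount (box d z) : ℝ≥0∞) ∂P =
      ∫⁻ ξ, (ξ.posCount (box d 0) : ℝ≥0∞) ∂P := by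
  have hm : Measurable fun ξ : MarkedConfig d Unit => (ξ.posCount (box d z) : ℝ≥0∞) :=
    (Measurable.of_discrete (f := fun n : ℕ∞ => (n : ℝ≥0∞))).comp
      (MarkedConfig.measurable_posCount (measurableSet_box z))
  conv_lhs => rw [← hstat fun i => (z i : ℝ)]
  rw [lintegral_map hm (MarkedConfig.measurable_translate _)]
  refine lintegral_congr fun ξ => ?_
  rw [coe_posCount, coe_posCount, tsum_translate ξ _ fun x => (box d z).indicator 1 x.1]
  refine tsum_congr fun x => ?_
  have hiff : (shift (fun i => (z i : ℝ)) x.1).1 ∈ box d z ↔ x.1.1 ∈ box d 0 := by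
    rw [← sub_self z]
    exact add_mem_box_iff
  by_cases hx : x.1.1 ∈ box d 0
  · rw [Set.indicator_of_mem hx, Set.indicator_of_mem (hiff.2 hx)]; rfl
  · rw [Set.indicator_of_notMem hx, Set.indicator_of_notMem (mt hiff.1 hx)]

/-- A stationary Cox process of finite intensity is deletion-tolerant. -/
theorem isDeletionTolerant_of_isMixedPoisson {Ω : Type*} [MeasurableSpace Ω] {μ : Measure Ω}
    [IsProbabilityMeasure μ] {X : Ω → MarkedConfig d Unit} (hX : Measurable X)
    (h : IsMixedPoisson (μ.map X) Q) (hstat : IsStationary X μ) (hint : HasFiniteIntensity X μ) :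
    IsDeletionTolerant X μ := by
  have hprob : IsProbabilityMeasure (μ.map X) := Measure.isProbabilityMeasure_map hX.aemeasurable
  have hstat' : ∀ t : Fin d → ℝ, (μ.map X).map (fun ξ => ξ.translate t) = μ.map X := fun t => by
    rw [Measure.map_map (MarkedConfig.measurable_translate t) hX]
    exact hstat t
  have hfin : ∀ z, ∫⁻ ξ, (ξ.posCount (box d z) : ℝ≥0∞) ∂(μ.map X) ≠ ∞ := by
    intro z
    have hm : Measurable fun ξ : MarkedConfig d Unit => (ξ.posCount (box d 0) : ℝ≥0∞) :=
      (Measurable.of_discrete (f := fun n : ℕ∞ => (n : ℝ≥0∞))).comp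
        (MarkedConfig.measurable_posCount (measurableSet_box 0))
    rw [lintegral_posCount_box hstat', lintegral_map hm hX]
    exact ne_top_of_le_ne_top hint.ne (lintegral_mono fun ω =>
      ENat.toENNReal_le.2 (posCount_mono _ box_zero_subset))
  intro z hz
  refine Measure.AbsolutelyContinuous.mk fun A hA h0 => ?_
  -- If the erased process is not almost everywhere measurable, `Measure.map` is zero by convention
  -- and the claim is trivial.
  by_cases hm : AEMeasurable (fun ω => (X ω).erase (z ω)) μ
  · rw [Measure.map_apply_of_aemeasurable hm hA]
    have hcamp : campbell (μ.map X) (Set.univ ×ˢ A) = 0 := by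
      have hU : (Set.univ : Set (Fin d → ℝ)) ×ˢ A = ⋃ z, box d z ×ˢ A := by
        ext ⟨x, ξ⟩
        simp only [Set.mem_prod, Set.mem_univ, true_and, Set.mem_iUnion, exists_and_right]
        exact ⟨fun h => ⟨⟨_, mem_box_iff.2 rfl⟩, h⟩, fun h => h.2⟩
      rw [hU, measure_iUnion_null_iff]
      exact fun z => h.campbell_eq_zero (measurableSet_box z) (isBounded_box z) (hfin z) hA h0
    have h1 := ae_of_ae_map hX.aemeasurable
      (ae_forall_notMem_of_campbell_eq_zero (MeasurableSet.univ.prod hA) hcamp)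
    have h2 := ae_of_ae_map hX.aemeasurable (measure_eq_zero_iff_ae_notMem.1 h0)
    refine measure_eq_zero_iff_ae_notMem.2 ?_
    filter_upwards [h1, h2, hz.2] with ω hω1 hω2 hω3 hmem
    by_cases hne : (X ω).carrier.Nonempty
    · exact hω1 _ (hω3 hne) ⟨Set.mem_univ _, hmem⟩
    · have : (X ω).erase (z ω) = X ω := by
        rw [MarkedConfig.mk.injEq]
        rw [Set.not_nonempty_iff_eq_empty] at hne
        simp [MarkedConfig.erase, hne]
      exact hω2 (this ▸ hmem)
  · rw [Measure.map_of_not_aemeasurable hm]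
    rfl

theorem isMixedPoisson_of_isCoxProcess {Ω : Type*} [MeasurableSpace Ω] {μ : Measure Ω}
    {X : Ω → MarkedConfig d Unit} (h : IsCoxProcess X μ) :
    ∃ Q, IsMixedPoisson (μ.map X) Q := by
  obtain ⟨hX, Q, -, hQ, hfidi⟩ := h
  refine ⟨Q, hQ, fun n B k hB hb hd => ?_⟩
  rw [← hfidi n B k hB hb hd, Measure.map_apply hX]
  · rfl
  · simp_rw [Set.ofPred_forall]
    exact MeasurableSet.iInter fun i =>
      MarkedConfig.measurable_posCount (hB i) (measurableSet_singleton _)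

end Cox

/-! ### Homogeneous Poisson processes -/

section Poisson

variable {d : ℕ} {P : Measure (MarkedConfig d Unit)} {c : ℝ≥0}

theorem measurable_poissonFidi {n : ℕ} {B : Fin n → Set (Fin d → ℝ)}
    (hB : ∀ i, MeasurableSet (B i)) (k : Fin n → ℕ) :
    Measurable fun Λ : Measure (Fin d → ℝ) => poissonFidi Λ B k :=
  measurable_fidi hB k

/-- Evaluating a Dirac measure requires a measurable property; finiteness on the balls of integer
radius is one, and it implies finiteness on all bounded sets. -/
theorem ae_isFiniteOnBounded_dirac :
    ∀ᵐ Λ ∂(Measure.dirac (c • volume : Measure (Fin d → ℝ))), IsFiniteOnBounded Λ := by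
  have h : ∀ᵐ Λ ∂(Measure.dirac (c • volume : Measure (Fin d → ℝ))),
      ∀ n : ℕ, Λ (Metric.closedBall 0 n) < ∞ := by
    refine ae_all_iff.2 fun n => (ae_dirac_iff ?_).2 ?_
    · exact measurableSet_lt
        (Measure.measurable_coe Metric.isClosed_closedBall.measurableSet) measurable_const
    · exact Metric.isBounded_closedBall.measure_lt_top
  filter_upwards [h] with Λ hΛ B hB
  obtain ⟨R, hR⟩ := hB.subset_closedBall 0
  obtain ⟨n, hn⟩ := exists_nat_ge R
  exact (measure_mono (hR.trans (Metric.closedBall_subset_closedBall hn))).trans_lt (hΛ n)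

theorem isMixedPoisson_dirac {Ω : Type*} [MeasurableSpace Ω] {μ : Measure Ω}
    {X : Ω → MarkedConfig d Unit} (h : IsHomogeneousPoisson X μ c) :
    IsMixedPoisson (μ.map X) (Measure.dirac (c • volume)) := by
  obtain ⟨hX, hfidi⟩ := h
  refine ⟨ae_isFiniteOnBounded_dirac, fun n B k hB hb hd => ?_⟩
  rw [lintegral_dirac' _ (measurable_poissonFidi hB k), ← hfidi n B k hB hb hd,
    Measure.map_apply hX]
  · rfl
  · simp_rw [Set.ofPred_forall]
    exact MeasurableSet.iInter fun i =>
      MarkedConfig.measurable_posCount (hB i) (measurableSet_singleton _)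

theorem univ_mem_cylinders : Set.univ ∈ cylinders d := ⟨∅, by simp, by simp⟩

/-- The law of a mixed Poisson process is determined by the law of its intensity measure. -/
theorem IsMixedPoisson.unique {P' : Measure (MarkedConfig d Unit)}
    {Q : Measure (Measure (Fin d → ℝ))} [IsFiniteMeasure P] (h : IsMixedPoisson P Q)
    (h' : IsMixedPoisson P' Q) : P = P' := by
  have key : ∀ A ∈ cylinders d, P A = P' A := by
    intro A hA
    obtain ⟨φ, -, -, hφ⟩ := exists_mixing hA (MeasurableSet.empty (α := Fin d → ℝ))
      Bornology.isBounded_empty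
    rw [(hφ P Q h).1, (hφ P' Q h').1]
  exact ext_of_generate_finite _ generateFrom_cylinders
    (fun A hA B hB _ => isSetAlgebra_cylinders.inter_mem hA hB) key (key _ univ_mem_cylinders)

/-- Lebesgue measure is translation-invariant, so the translated law has the same finite-dimensional
distributions, and these determine the law. -/
theorem IsMixedPoisson.map_translate [IsFiniteMeasure P]
    (h : IsMixedPoisson P (Measure.dirac (c • volume))) (t : Fin d → ℝ) :
    P.map (fun ξ => ξ.translate t) = P := by
  refine (IsMixedPoisson.unique h ⟨h.1, fun n B k hB hb hd => ?_⟩).symm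
  have hmeas : ∀ i, MeasurableSet ((fun x => x + t) ⁻¹' B i) := fun i =>
    (measurable_id.add_const t) (hB i)
  have h1 := h.2 n (fun i => (fun x => x + t) ⁻¹' B i) k hmeas (fun i => ?_)
    fun i j hij => (hd hij).preimage _
  · rw [lintegral_dirac' _ (measurable_poissonFidi hB k)]
    rw [lintegral_dirac' _ (measurable_poissonFidi hmeas k)] at h1
    rw [Measure.map_apply (MarkedConfig.measurable_translate t)]
    · have hp : poissonFidi (c • volume) (fun i => (fun x => x + t) ⁻¹' B i) k =
          poissonFidi (c • volume) B k := by
        simp only [poissonFidi, Measure.smul_apply, measure_preimage_add_right]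
      rw [← hp, ← h1]
      congr 1
      ext ξ
      have : ∀ i, (ξ.translate t).posCount (B i) = ξ.posCount ((fun x => x + t) ⁻¹' B i) := by
        intro i
        apply ENat.toENNReal_strictMono.injective
        rw [coe_posCount, coe_posCount, tsum_translate ξ _ fun x => (B i).indicator 1 x.1]
        rfl
      simp [this]
    · simp_rw [Set.ofPred_forall]
      exact MeasurableSet.iInter fun i =>
        MarkedConfig.measurable_posCount (hB i) (measurableSet_singleton _)
  · obtain ⟨R, hR⟩ := (hb i).exists_norm_le
    refine isBounded_iff_forall_norm_le.2 ⟨R + ‖t‖, fun x hx => ?_⟩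
    have h2 := norm_sub_le (x + t) t
    rw [add_sub_cancel_right] at h2
    exact h2.trans (by linarith [hR _ hx])

/-- The Mecke equation for homogeneous Poisson processes. -/
theorem campbell_eq_prod [IsProbabilityMeasure P]
    (h : IsMixedPoisson P (Measure.dirac (c • volume))) :
    campbell P = (c • volume : Measure (Fin d → ℝ)).prod P := by
  refine (Measure.prod_eq_generateFrom
    (C := {D : Set (Fin d → ℝ) | MeasurableSet D ∧ Bornology.IsBounded D}) (D := cylinders d)
    ?_ generateFrom_cylinders.symm ?_ (fun A hA B hB _ => isSetAlgebra_cylinders.inter_mem hA hB)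
    ⟨fun n => Metric.closedBall 0 n, fun n => ?_, fun n => ?_, ?_⟩
    ⟨fun _ => Set.univ, fun _ => univ_mem_cylinders, fun _ => measure_lt_top _ _,
      Set.iUnion_const _⟩ ?_).symm
  · refine le_antisymm (MeasurableSpace.generateFrom_le fun D hD => hD.1) fun s hs => ?_
    rw [← Set.inter_univ s, ← Metric.iUnion_closedBall_nat (0 : Fin d → ℝ), Set.inter_iUnion]
    exact MeasurableSet.iUnion fun n => MeasurableSpace.measurableSet_generateFrom
      ⟨hs.inter Metric.isClosed_closedBall.measurableSet,
        Metric.isBounded_closedBall.subset Set.inter_subset_right⟩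
  · exact fun A hA B hB _ => ⟨hA.1.inter hB.1, hA.2.subset Set.inter_subset_left⟩
  · exact ⟨Metric.isClosed_closedBall.measurableSet, Metric.isBounded_closedBall⟩
  · exact measure_lt_top_of_subset subset_rfl Metric.isBounded_closedBall.measure_lt_top.ne
  · exact Metric.iUnion_closedBall_nat 0
  · intro D hD A hA
    obtain ⟨φ, hφ, -, hPQ⟩ := exists_mixing hA hD.1 hD.2
    obtain ⟨h1, h2⟩ := hPQ _ _ h
    rw [lintegral_dirac' _ hφ] at h1
    have hm : Measurable fun Λ : Measure (Fin d → ℝ) => Λ D * φ Λ :=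
      (Measure.measurable_coe hD.1).mul hφ
    rw [lintegral_dirac' _ hm] at h2
    rw [h1, h2]

variable {ν : Seminorm ℝ (Fin d → ℝ)}

/-- A point of the sphere can be pushed outwards along its ray, so the sphere lies in the frontier
of the closed ball, and the frontier of a convex set is null. -/
theorem volume_sphere_eq_zero (ν : Seminorm ℝ (Fin d → ℝ)) (a : Fin d → ℝ) {r : ℝ} (hr : 0 < r) :
    volume {x | ν (x - a) = r} = 0 := by
  have hconv : Convex ℝ {x | ν (x - a) ≤ r} := by
    have := ν.convex_closedBall a r
    convert! this using 1
  refine measure_mono_null ?_ (hconv.addHaar_frontier volume)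
  intro x hx
  refine ⟨subset_closure (le_of_eq hx), fun hint => ?_⟩
  have hcont : Filter.Tendsto (fun t : ℝ => a + t • (x - a)) (nhds 1) (nhds x) := by
    have : Continuous fun t : ℝ => a + t • (x - a) := by fun_prop
    simpa using this.tendsto 1
  have hev := (hcont.eventually (mem_interior_iff_mem_nhds.1 hint)).filter_mono
    (nhdsWithin_le_nhds (s := Set.Ioi 1))
  obtain ⟨t, ht, ht1⟩ := (hev.and self_mem_nhdsWithin).exists
  have ht1' : (1 : ℝ) < t := ht1
  have h1 : ν (a + t • (x - a) - a) ≤ r := ht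
  rw [add_sub_cancel_left, map_smul_eq_mul, Real.norm_of_nonneg (by linarith), hx] at h1
  nlinarith

theorem volume_origin_sphere_eq_zero [Nonempty (Fin d)] (hν : ∀ x, ν x = 0 → x = 0) {r : ℝ}
    (hr : 0 ≤ r) : volume {x | ν x = r} = 0 := by
  rcases hr.eq_or_lt with rfl | hr
  · exact measure_mono_null (fun x hx => hν x hx) (measure_singleton (0 : Fin d → ℝ))
  · simpa using volume_sphere_eq_zero ν 0 hr

/-- The pairs of a position `x` and a configuration such that adding a point at `x` creates a
coincidence of distances. -/
def coincidences (ν : Seminorm ℝ (Fin d → ℝ)) : Set ((Fin d → ℝ) × MarkedConfig d Unit) :=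
  {q | (∃ a ∈ q.2.carrier, ∃ b ∈ q.2.carrier, ∃ b' ∈ q.2.carrier,
      ν (q.1 - a.1) = ν (b.1 - b'.1) ∧ 0 < ν (b.1 - b'.1)) ∨ ∃ a ∈ q.2.carrier, ν q.1 = ν a.1}

theorem measurableSet_coincidences (ν : Seminorm ℝ (Fin d → ℝ)) :
    MeasurableSet (coincidences ν) := by
  have hν : Measurable ν := (continuous_seminorm ν).measurable
  refine MeasurableSet.union ?_ ?_
  · refine MarkedConfig.measurableSet_exists measurable_snd (fun q => simple_of_unit _)
      (p := fun q a => ∃ b ∈ q.2.carrier, ∃ b' ∈ q.2.carrier,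
        ν (q.1 - a.1) = ν (b.1 - b'.1) ∧ 0 < ν (b.1 - b'.1)) ?_
    refine MarkedConfig.measurableSet_exists
      (Ω := ((Fin d → ℝ) × MarkedConfig d Unit) × ((Fin d → ℝ) × Unit)) (X := fun q => q.1.2)
      (measurable_snd.comp measurable_fst) (fun q => simple_of_unit _)
      (p := fun q b => ∃ b' ∈ q.1.2.carrier,
        ν (q.1.1 - q.2.1) = ν (b.1 - b'.1) ∧ 0 < ν (b.1 - b'.1)) ?_
    refine MarkedConfig.measurableSet_exists
      (Ω := (((Fin d → ℝ) × MarkedConfig d Unit) × ((Fin d → ℝ) × Unit)) × ((Fin d → ℝ) × Unit))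
      (X := fun q => q.1.1.2)
      (measurable_snd.comp (measurable_fst.comp measurable_fst)) (fun q => simple_of_unit _)
      (p := fun q b' => ν (q.1.1.1 - q.1.2.1) = ν (q.2.1 - b'.1) ∧ 0 < ν (q.2.1 - b'.1)) ?_
    exact (measurableSet_eq_fun (hν.comp (by fun_prop)) (hν.comp (by fun_prop))).inter
      (measurableSet_lt measurable_const (hν.comp (by fun_prop)))
  · exact MarkedConfig.measurableSet_exists measurable_snd (fun q => simple_of_unit _)
      (p := fun q a => ν q.1 = ν a.1)
      (measurableSet_eq_fun (hν.comp (by fun_prop)) (hν.comp (by fun_prop)))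

theorem countable_carrier (ξ : MarkedConfig d Unit) : ξ.carrier.Countable := by
  have : ξ.carrier = ⋃ n : ℕ, {p ∈ ξ.carrier | p.1 ∈ Metric.closedBall 0 n} := by
    ext p
    simp only [Set.mem_iUnion, Set.mem_ofPred_eq, exists_and_left]
    refine ⟨fun h => ⟨h, ?_⟩, fun h => h.1⟩
    rw [← Set.mem_iUnion, Metric.iUnion_closedBall_nat]
    trivial
  rw [this]
  exact Set.countable_iUnion fun n => (ξ.locallyFinite _ Metric.isBounded_closedBall).countable

/-- By the product formula the configuration may be frozen. The bad positions then lie in a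
countable union of spheres. -/
theorem campbell_coincidences_eq_zero [IsProbabilityMeasure P] [Nonempty (Fin d)]
    (hν : ∀ x, ν x = 0 → x = 0) (h : IsMixedPoisson P (Measure.dirac (c • volume))) :
    campbell P (coincidences ν) = 0 := by
  rw [campbell_eq_prod h, Measure.prod_apply_symm (measurableSet_coincidences ν)]
  refine (lintegral_congr fun ξ => ?_).trans lintegral_zero
  have hnull : volume ((fun x => (x, ξ)) ⁻¹' coincidences ν) = 0 := by
    have hsub : (fun x => (x, ξ)) ⁻¹' coincidences ν ⊆
        (⋃ a ∈ ξ.carrier, ⋃ b ∈ ξ.carrier, ⋃ b' ∈ ξ.carrier,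
          {x | ν (x - a.1) = ν (b.1 - b'.1) ∧ 0 < ν (b.1 - b'.1)}) ∪
        ⋃ a ∈ ξ.carrier, {x | ν x = ν a.1} := by
      rintro x (⟨a, ha, b, hb, b', hb', hx⟩ | ⟨a, ha, hx⟩)
      · exact Or.inl (Set.mem_biUnion ha (Set.mem_biUnion hb (Set.mem_biUnion hb' hx)))
      · exact Or.inr (Set.mem_biUnion ha hx)
    have hc := countable_carrier ξ
    refine measure_mono_null hsub (measure_union_null ?_ ?_)
    · refine (measure_biUnion_null_iff hc).2 fun a _ => (measure_biUnion_null_iff hc).2 fun b _ =>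
        (measure_biUnion_null_iff hc).2 fun b' _ => ?_
      by_cases hr : 0 < ν (b.1 - b'.1)
      · exact measure_mono_null (fun x hx => hx.1) (volume_sphere_eq_zero ν a.1 hr)
      · exact measure_mono_null (fun x hx => (hr hx.2).elim) measure_empty
    · exact (measure_biUnion_null_iff hc).2 fun a _ =>
        volume_origin_sphere_eq_zero hν (apply_nonneg _ _)
  rw [Measure.smul_apply, hnull, smul_zero]

/-- If two different pairs have the same distance, some point a of one is missing from the other.
Then a forms a coincidence with the configuration without a, which the Campbell measure rules out.
-/
theorem ae_nonequidistant [IsProbabilityMeasure P] [Nonempty (Fin d)]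
    (hν : ∀ x, ν x = 0 → x = 0) (h : IsMixedPoisson P (Measure.dirac (c • volume))) :
    ∀ᵐ ξ ∂P, ξ.Nonequidistant ν := by
  filter_upwards [ae_forall_notMem_of_campbell_eq_zero (measurableSet_coincidences ν)
    (campbell_coincidences_eq_zero hν h)] with ξ hξ
  constructor
  · have key : ∀ a ∈ ξ.carrier, ∀ b ∈ ξ.carrier, ∀ a' ∈ ξ.carrier, ∀ b' ∈ ξ.carrier,
        ν (a.1 - b.1) = ν (a'.1 - b'.1) → 0 < ν (a.1 - b.1) → a = a' ∨ a = b' := by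
      intro a ha b hb a' ha' b' hb' heq hpos
      by_contra! hne
      have hba : b ≠ a := by
        rintro rfl
        simp at hpos
      exact hξ a ha (Or.inl ⟨b, ⟨hb, hba⟩, a', ⟨ha', hne.1.symm⟩, b', ⟨hb', hne.2.symm⟩, heq,
        heq ▸ hpos⟩)
    intro a ha b hb a' ha' b' hb' heq hpos
    have hba : b ≠ a := by
      rintro rfl
      simp at hpos
    have h1 := key a ha b hb a' ha' b' hb' heq hpos
    have h2 := key b hb a ha a' ha' b' hb' (by rw [map_sub_rev, heq]) (by rwa [map_sub_rev])
    rcases h1 with rfl | rfl <;> rcases h2 with rfl | rfl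
    · exact absurd rfl hba
    · rfl
    · exact Set.pair_comm _ _
    · exact absurd rfl hba
  · intro a ha b hb heq
    by_contra hne
    exact hξ a ha (Or.inr ⟨b, ⟨hb, fun h => hne h.symm⟩, heq⟩)

end Poisson

/-! ### Bidirectional nearest-neighbour graphs -/

section Bidirectional

variable {d : ℕ} {ν : Seminorm ℝ (Fin d → ℝ)}

theorem isOrderingFunction_dist : IsOrderingFunction fun (v : ℝ≥0) (_ : Unit) => v :=
  ⟨measurable_fst, fun _ => monotone_id⟩

/-- Only graphs with infinitely many vertices percolate. -/
theorem not_percolates_of_finite {V : Type*} [Finite V] (G : SimpleGraph V) : ¬ Percolates G :=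
  fun ⟨C, hC⟩ => hC C.supp.toFinite

theorem Percolates.mono {V : Type*} {G H : SimpleGraph V} (h : G ≤ H) (hG : Percolates G) :
    Percolates H := by
  obtain ⟨C, hC⟩ := hG
  refine ⟨C.map (SimpleGraph.Hom.ofLE h), hC.mono fun v hv => ?_⟩
  rw [SimpleGraph.ConnectedComponent.mem_supp_iff] at hv ⊢
  rw [← hv]
  rfl

theorem fkNNGraph_mono {M : Type*} (f : ℝ≥0 → M → ℝ≥0) {k l : ℕ} (h : k ≤ l)
    (ξ : MarkedConfig d M) : fkNNGraph ν f k ξ ≤ fkNNGraph ν f l ξ :=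
  fun _ _ ⟨⟨m, hm, hmk, hmn⟩, ⟨n, hn, hnk, hnn⟩⟩ =>
    ⟨⟨m, hm, hmk.trans h, hmn⟩, ⟨n, hn, hnk.trans h, hnn⟩⟩

theorem eq_zero_of_euclideanNorm_eq_zero (x : Fin d → ℝ) (h : euclideanNorm d x = 0) : x = 0 := by
  have h1 : ‖WithLp.toLp 2 x‖ = 0 := h
  simpa using h1

variable {Ω : Type*} [MeasurableSpace Ω] {μ : Measure Ω} [IsProbabilityMeasure μ]
  {X : Ω → MarkedConfig d Unit}

theorem not_percolates_of_isCoxProcess (hν : ∀ x, ν x = 0 → x = 0) (hX : IsCoxProcess X μ)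
    (hstat : IsStationary X μ) (hne : ∀ᵐ ω ∂μ, (X ω).Nonequidistant ν)
    (hint : HasFiniteIntensity X μ) : ∀ᵐ ω ∂μ, ¬ Percolates (bkNNGraph ν 2 (X ω)) := by
  obtain ⟨Q, hQ⟩ := isMixedPoisson_of_isCoxProcess hX
  exact not_percolates_of_deletionTolerant hν isOrderingFunction_dist hX.1 hstat hne hint
    (isDeletionTolerant_of_isMixedPoisson hX.1 hQ hstat hint)

theorem not_percolates_of_isHomogeneousPoisson (hν : ∀ x, ν x = 0 → x = 0) {c : ℝ≥0}
    (hX : IsHomogeneousPoisson X μ c) : ∀ᵐ ω ∂μ, ¬ Percolates (bkNNGraph ν 2 (X ω)) := by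
  rcases isEmpty_or_nonempty (Fin d) with hd | hd
  -- For d = 0 a single position is not a null set and the argument with spheres fails, but there is
  -- only one possible marked point.
  · exact ae_of_all _ fun ω => not_percolates_of_finite _
  have hprob : IsProbabilityMeasure (μ.map X) := Measure.isProbabilityMeasure_map hX.1.aemeasurable
  have hP := isMixedPoisson_dirac hX
  have hstat : IsStationary X μ := fun t => by
    rw [← hP.map_translate t, Measure.map_map (MarkedConfig.measurable_translate t) hX.1]
    rfl
  have hint : HasFiniteIntensity X μ := by
    have hI : MeasurableSet (Set.Icc (0 : Fin d → ℝ) 1) := measurableSet_Icc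
    have hm : Measurable fun ξ : MarkedConfig d Unit => (ξ.posCount (Set.Icc 0 1) : ℝ≥0∞) :=
      (Measurable.of_discrete (f := fun n : ℕ∞ => (n : ℝ≥0∞))).comp
        (MarkedConfig.measurable_posCount hI)
    rw [HasFiniteIntensity, ← lintegral_map hm hX.1,
      hP.lintegral_posCount hI (Metric.isBounded_Icc 0 1),
      lintegral_dirac' _ (Measure.measurable_coe hI)]
    exact (Metric.isBounded_Icc 0 1).measure_lt_top
  exact not_percolates_of_deletionTolerant hν isOrderingFunction_dist hX.1 hstat
    (ae_of_ae_map hX.1.aemeasurable (ae_nonequidistant hν hP)) hint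
    (isDeletionTolerant_of_isMixedPoisson hX.1 hP hstat hint)

/-- The graph grows with k, so absence of percolation for k = 2 excludes k = 1 as well. -/
theorem three_le_criticalB (d : ℕ) : 3 ≤ criticalB d := by
  refine le_sInf ?_
  rintro _ ⟨k, rfl, -, P, c, hP, -, hPois, hperc⟩
  by_contra! hk
  have hk2 : k ≤ 2 := by
    have : k < 3 := by exact_mod_cast hk
    omega
  refine hperc ?_
  filter_upwards [not_percolates_of_isHomogeneousPoisson eq_zero_of_euclideanNorm_eq_zero hPois]
    with ξ hξ h
  exact hξ (h.mono (fkNNGraph_mono _ hk2 ξ))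

end Bidirectional

end NNPerc

/-! ### Assembly of the four claims -/

theorem theorem2p5 {d : ℕ} (ν : Seminorm ℝ (Fin d → ℝ)) (hν : ∀ x, ν x = 0 → x = 0)
    {Ω : Type*} [MeasurableSpace Ω] (μ : Measure Ω) [IsProbabilityMeasure μ] :
    (∀ (M : Type*) [MeasurableSpace M] (f : ℝ≥0 → M → ℝ≥0)
        (X : Ω → NNPerc.MarkedConfig d M),
      NNPerc.IsOrderingFunction f →
      Measurable X →
      NNPerc.IsStationary X μ →
      (∀ᵐ ω ∂μ, (X ω).Nonequidistant ν) →
      NNPerc.HasFiniteIntensity X μ →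
      NNPerc.IsDeletionTolerant X μ →
        ∀ᵐ ω ∂μ, ¬ NNPerc.Percolates (NNPerc.fkNNGraph ν f 2 (X ω))) ∧
    (∀ X : Ω → NNPerc.MarkedConfig d Unit,
      NNPerc.IsCoxProcess X μ →
      NNPerc.IsStationary X μ →
      (∀ᵐ ω ∂μ, (X ω).Nonequidistant ν) →
      NNPerc.HasFiniteIntensity X μ →
        ∀ᵐ ω ∂μ, ¬ NNPerc.Percolates (NNPerc.bkNNGraph ν 2 (X ω))) ∧
    (∀ (X : Ω → NNPerc.MarkedConfig d Unit) (c : ℝ≥0),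
      NNPerc.IsHomogeneousPoisson X μ c →
        ∀ᵐ ω ∂μ, ¬ NNPerc.Percolates (NNPerc.bkNNGraph ν 2 (X ω))) ∧
    3 ≤ NNPerc.criticalB 2 := by
  refine ⟨fun M _ f X hf hX hstat hne hint hdel => ?_,
    fun X hX hstat hne hint => NNPerc.not_percolates_of_isCoxProcess hν hX hstat hne hint,
    fun X c hX => NNPerc.not_percolates_of_isHomogeneousPoisson hν hX,
    NNPerc.three_le_criticalB 2⟩
  -- The enumeration of points uses a default marked point. Without marks there are no marked points
  -- and hence no vertices.
  rcases isEmpty_or_nonempty M with hM | hM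
  · exact Filter.Eventually.of_forall fun ω => NNPerc.not_percolates_of_finite _
  · exact NNPerc.not_percolates_of_deletionTolerant hν hf hX hstat hne hint hdel
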